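/- Let $$\kappa^* = \min_{\beta>1}\frac{\beta}{1-\beta e^{-(\beta-1)}}\approx 4.911 .$$ For every $\kappa>\kappa^*$ there exists $k_*(\kappa)$ such that for all integers $k\ge k_*(\kappa)$ and $\alpha=\kappa 2^k\log k/k$ the following holds. For each $N$, let $\Gamma_N=\{x_1,\dots,x_N,\bar x_1,\dots,\bar x_N\}$ be the set of literals on $N$ Boolean variables, and let $M=M_N$ satisfy $\lim_{N\to\infty}M_N/N=\alpha$. Let $\boldsymbol y\in\Gamma_N^{kM}$ be a random $k$-SAT instance with $M$ clauses, each a disjunction of $k$ literals, all $kM$ literals being i.i.d. uniform on $\Gamma_N$. Let $\omega$ be a random element, independent of $\boldsymbol y$, of an arbitrary probability space $\Omega_N$, and let $\vec U=(U_1,\dots,U_N)$ be i.i.d. uniform on $[-1,1]$, independent of $(\boldsymbol y,\omega)$. A function $\Gamma_N^{kM}\to\mathbb R^N$ is called a degree $D$ function if each of its $N$ coordinates lies in the linear span of the functions $\boldsymbol y\mapsto\prod_{i\in I}f_i(y_i)$ with $|I|\le D$ and arbitrary $f_i:\Gamma_N\to\mathbb R$. Let $D=D_N=o(N)$, let $C\geq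 0$ be a constant, and let $\mathcal A^\circ=\mathcal A^\circ_N:\Gamma_N^{kM}\times\Omega_N\to\mathbb R^N$ be measurable functions such that $\mathcal A^\circ(\cdot,\omega)$ is a degree $D$ function for each fixed $\omega$, and $\mathbb E[\|\mathcal A^\circ(\boldsymbol y,\omega)\|^2]\le CN$ for all $N$ (Euclidean norm). Let $\mathcal A(\boldsymbol y,\omega,\vec U)\in\{-1,1\}^N$ be its randomized rounding, whose $i$-th coordinate is $1$ if $\mathcal A^\circ(\boldsymbol y,\omega)_i\ge U_i$ and $-1$ otherwise; identify $1$ with true and $-1$ with false. Then, as $N\to\infty$, $$\mathbb P\left[\mathcal A(\boldsymbol y,\omega,\vec U)\text{ is a satisfying assignment of }\boldsymbol y\right]=o(1).$$ -/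

import Mathlib

open MeasureTheory ProbabilityTheory Filter Topology Asymptotics
open scoped ENNReal NNReal

noncomputable section

namespace RandomKSat

/-- The constant `κ* = min_{β > 1} β / (1 - β e^{-(β - 1)}) ≈ 4.911`. On `β > 1` the denominator is
positive. -/
def kappaStar : ℝ :=
  sInf ((fun β : ℝ => β / (1 - β * Real.exp (-(β - 1)))) '' Set.Ioi 1)

theorem one_add_div_pow_le_exp (n : ℕ) (hn : n ≠ 0) (s : ℝ) (h : 0 ≤ 1 + s / n) : (1 + s/n)^n ≤ Real.exp s := by
  have h1 : 1 + s / n ≤ Real.exp (s/n) := by linarith [Real.add_one_le_exp (s/n)]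
  calc (1 + s/n)^n ≤ (Real.exp (s/n))^n := pow_le_pow_left₀ h h1 n
    _ = Real.exp s := by
      rw [← Real.exp_nat_mul]; congr 1; field_simp

theorem exp_neg_five_halves_bounds : (82084/1000000:ℝ) < Real.exp (-(5/2)) ∧ Real.exp (-(5/2)) < 82086/1000000 := by
  have h : Real.exp (-(5/2))^2 * Real.exp 1 ^ 5 = 1 := by
    rw [← Real.exp_nat_mul, ← Real.exp_nat_mul, ← Real.exp_add]; norm_num
  have h1 := Real.exp_one_gt_d9
  have h2 := Real.exp_one_lt_d9
  have hp := Real.exp_pos (-(5/2))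
  have h5 : (148.41:ℝ) < Real.exp 1 ^5 := lt_of_lt_of_le (by norm_num) (pow_le_pow_left₀ (by norm_num) h1.le 5)
  have h6 : Real.exp 1 ^5 < (148.4135:ℝ) := lt_of_le_of_lt (pow_le_pow_left₀ (Real.exp_pos 1).le h2.le 5) (by norm_num) 
  constructor
  · by_contra! hc
    have : Real.exp (-(5/2))^2 ≤ (82084/1000000:ℝ)^2 := pow_le_pow_left₀ hp.le hc 2
    nlinarith
  · by_contra! hc
    have : (82086/1000000:ℝ)^2 ≤ Real.exp (-(5/2))^2 := pow_le_pow_left₀ (by norm_num) hc 2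
    nlinarith

theorem kappaStar_lower_aux {β : ℝ} (hβ : 1 < β) : 4.9105 ≤ β + 4.9105 * (β * Real.exp (-(β - 1))) := by
  have hp := Real.exp_pos (-(β - 1))
  rcases le_total 4.9105 β with h | h
  · nlinarith [mul_pos (by linarith : 0 < β) hp]
  rcases le_total β 2 with h2 | h2
  · have h1 := one_add_div_pow_le_exp 4 (by norm_num) (-(β - 1)) (by push_cast; linarith)
    obtain ⟨u, rfl⟩ : ∃ u, β = 1 + u := ⟨β - 1, by ring⟩
    have hu : 0 < u := by linarith
    have hu1 : 0 ≤ 1 - u := by linarith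
    have h3 := mul_le_mul_of_nonneg_left h1 (show 0 ≤ 1 + u by linarith)
    push_cast at h3
    have h4 : (1 + u) * (1 + -(1 + u - 1) / 4) ^ 4 
       = 1 - 5/8*u^2 + 5/16*u^3 - 15/256*u^4 + u^5/256 := by ring
    rw [h4] at h3
    have h5 : 0 ≤ u^3 * (1 - u) := by positivity
    have h6 : 0 ≤ u^5 := by positivity
    have h7 : 0 ≤ 1 + u - 3.07 * u^2 + 1.246 * u^3 := by
      nlinarith [mul_nonneg hu.le (sq_nonneg (u - 9/10)), mul_nonneg hu1 hu.le, mul_nonneg hu1 hu1, mul_nonneg hu1 (mul_nonneg hu1 hu1)]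
    nlinarith [pow_pos hu 2, pow_pos hu 3]
  · have h1 := one_add_div_pow_le_exp 5 (by norm_num) (-(β - 7/2)) (by push_cast; linarith)
    have hq := exp_neg_five_halves_bounds.1
    have e : Real.exp (-(β-1)) = Real.exp (-(5/2)) * Real.exp (-(β - 7/2)) := by
      rw [← Real.exp_add]; congr 1; ring
    rw [e]
    obtain ⟨x, rfl⟩ : ∃ x, β = 7/2 + x := ⟨β - 7/2, by ring⟩
    push_cast at h1
    have e2 : 1 + -(7/2 + x - 7/2) / 5 = 1 - x/5 := by ring
    rw [e2] at h1
    have hx1 : 0 ≤ x + 3/2 := by linarith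
    have hx2 : 0 ≤ 1.4105 - x := by linarith
    have h3 : 0 ≤ (1 - x/5)^5 := pow_nonneg (by linarith) 5
    have h4 : 82084/1000000 * (1 - x/5)^5 ≤ Real.exp (-(5/2)) * Real.exp (-(7/2 + x - 7/2)) :=
      mul_le_mul hq.le h1 h3 (Real.exp_pos _).le
    have h5 := mul_le_mul_of_nonneg_left h4 (show 0 ≤ 7/2 + x by linarith)
    suffices h6 : 4.9105 ≤ 7/2 + x + 4.9105 * ((7/2 + x) * (82084/1000000 * (1 - x/5)^5)) by linarith
    have h8 : 0.06 * x ^ 2 - 0.007683705 * x + 0.000257187 ≤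
        7/2 + x + 4.9105 * ((7/2 + x) * (82084/1000000 * (1 - x/5)^5)) - 4.9105 ∨
        x ≤ 0 := by
      rcases le_total x 0 with hx | hx
      · exact Or.inr hx
      · left
        have h9 : 0 ≤ 0.1012293928 + 0.04836881784 * x - 0.020959821064 * x^2 +
            0.00277314555616 * x^3 - 0.00012898351424 * x^4 := by
          have : 0 ≤ x^3 * (1.4105 - x) := by positivity
          have : 0 ≤ x * (1.4105 - x) := by positivity
          nlinarith [pow_nonneg hx 3]
        nlinarith [mul_nonneg (sq_nonneg x) h9]
    rcases h8 with h8 | h8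
    · nlinarith [sq_nonneg (x - 0.064)]
    · obtain ⟨y, rfl⟩ : ∃ y, x = -y := ⟨-x, by ring⟩
      have hy : 0 ≤ y := by linarith
      have hy1 : y ≤ 3/2 := by linarith
      have y2 : y^2 ≤ (3/2)^2 := pow_le_pow_left₀ hy hy1 2
      have y3 : y^3 ≤ (3/2)^3 := pow_le_pow_left₀ hy hy1 3
      have y4 : y^4 ≤ (3/2)^4 := pow_le_pow_left₀ hy hy1 4
      have h9 : 0 ≤ 0.1612293928 - 0.04836881784 * y - 0.020959821064 * y^2 -
            0.00277314555616 * y^3 - 0.00012898351424 * y^4 := by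
        linarith
      nlinarith [mul_nonneg (sq_nonneg y) h9]

/-- The numerical value `κ* ≈ 4.911`. -/
theorem abs_kappaStar_sub_le : |kappaStar - 4.911| ≤ 0.0005 := by
  have hpos : ∀ β : ℝ, 1 < β → 0 < 1 - β * Real.exp (-(β - 1)) := fun β hβ => by
    have h := Real.add_one_lt_exp (show β - 1 ≠ 0 by linarith)
    rw [Real.exp_neg, sub_pos, ← div_eq_mul_inv, div_lt_one (Real.exp_pos _)]
    linarith
  have hlow : ∀ v ∈ (fun β : ℝ => β / (1 - β * Real.exp (-(β - 1)))) '' Set.Ioi 1,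
      (4.9105 : ℝ) ≤ v := by
    rintro _ ⟨β, hβ, rfl⟩
    rw [le_div_iff₀ (hpos β hβ)]
    linarith [kappaStar_lower_aux hβ]
  have h1 : (4.9105 : ℝ) ≤ kappaStar :=
    le_csInf ⟨_, 2, by norm_num, rfl⟩ hlow
  have h2 : kappaStar ≤ 4.9115 := by
    have h72 : (7 / 2 : ℝ) ∈ Set.Ioi 1 := by norm_num
    refine (csInf_le ⟨_, hlow⟩ ⟨7 / 2, h72, rfl⟩).trans ?_
    have h3 := hpos _ h72
    rw [div_le_iff₀ h3]
    have h4 := exp_neg_five_halves_bounds.2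
    norm_num at h4 ⊢
    linarith
  rw [abs_le]; constructor <;> linarith

/-- The literals on `N` Boolean variables: `(i, true)` is `x_i` and `(i, false)` is its negation. -/
abbrev Literal (N : ℕ) : Type := Fin N × Bool

/-- The discrete cube `{-1, 1}^N`; `1` stands for true and `-1` for false. -/
abbrev Cube (N : ℕ) : Type := Fin N → ℤˣ

/-- A `k`-SAT instance with `N` variables and `M` clauses: `y (a, j)` is the `j`-th literal of the
`a`-th clause. -/
abbrev Instance (N M k : ℕ) : Type := Fin M × Fin k → Literal N

/-- The literal `l` evaluates to true under the assignment `x`. -/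
def Literal.Holds {N : ℕ} (l : Literal N) (x : Cube N) : Prop :=
  x l.1 = if l.2 then 1 else -1

/-- Every clause, that is, every disjunction of `k` literals, evaluates to true under `x`. -/
def Satisfies {N M k : ℕ} (x : Cube N) (y : Instance N M k) : Prop :=
  ∀ a : Fin M, ∃ j : Fin k, Literal.Holds (y (a, j)) x

/-- The law of random `k`-SAT: all `k M` literals are IID uniform on the `2 N` literals. -/
def instanceLaw (N M k : ℕ) : Measure (Instance N M k) :=
  Measure.pi fun _ => uniformOn (Set.univ : Set (Literal N))

/-- The space of degree `D` functions on `Γ ^ ι`: the span of the products `∏ i ∈ I, f i (y i)`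
with at most `D` factors, the `f i : Γ → ℝ` being arbitrary. -/
def degreeSpace (ι Γ : Type*) (D : ℕ) : Submodule ℝ ((ι → Γ) → ℝ) :=
  Submodule.span ℝ
    {F | ∃ (I : Finset ι) (f : ι → Γ → ℝ), I.card ≤ D ∧ F = fun y => ∏ i ∈ I, f i (y i)}

/-- A vector-valued function is a degree `D` function if each of its coordinates is. -/
def IsDegree {ι Γ : Type*} {N : ℕ} (D : ℕ) (F : (ι → Γ) → EuclideanSpace ℝ (Fin N)) : Prop :=
  ∀ i : Fin N, (fun y => F y i) ∈ degreeSpace ι Γ D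

/-- Coordinatewise rounding with thresholds `U`: the output is `1` where `U i ≤ z i` and `-1`
elsewhere. -/
def roundAt {N : ℕ} (U : Fin N → ℝ) (z : EuclideanSpace ℝ (Fin N)) : Cube N :=
  fun i => if U i ≤ z i then 1 else -1

/-- The law of the thresholds: IID uniform on `[-1, 1]`. -/
def thresholdLaw (N : ℕ) : Measure (Fin N → ℝ) :=
  Measure.pi fun _ => cond volume (Set.Icc (-1 : ℝ) 1)

end RandomKSat

end

/-!
Suppose the rounded low degree function succeeds with probability at least `δ` along infinitely
many `N`. Run the stationary Markov chain of instances that resamples each clause independently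
with probability `ε / (D + 1)` per step. Low degree functions are noise stable, so for a suitable
fixed value of the internal randomness two consecutive outputs are, with constant probability,
both satisfying and at Hamming distance at most `η N`. Since the chain is reversible, iterating
the Cauchy-Schwarz inequality bounds the probability that this happens in all of the first `T`
steps below by `(δ ^ 2 / 2) ^ T`, which is `exp (-o(N))` for `T` of order `D`.

Conversely, along such a stable path the conditional entropy of the current output given earlier
ones starts at zero and moves in small steps. After order `D` steps the instance is nearly fresh,
and the few assignments of low conditional entropy are unlikely to satisfy it; hence the conditional
entropy crosses a prescribed window `[b', b]`. Repeating this `m` times extracts a sequence of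
`m + 1` assignments satisfying correlated instances, each having conditional entropy in `[b', b]`
given its predecessors. A first moment computation shows that such sequences exist only with
exponentially small probability as soon as `κ > κ*`, a contradiction.
-/

noncomputable section

namespace RandomKSat

open scoped Matrix

/-! ### Expectations along finite Markov chains -/

section MarkovChain

variable {S : Type*}

theorem update_succ_of_le (y : ℕ → S) (s : S) {t i : ℕ} (h : i ≤ t) :
    Function.update y (t + 1) s i = y i :=
  Function.update_of_ne (by omega) _ _

theorem dependsOn_eval (g : S → ℝ) (t : ℕ) :
    DependsOn (fun y : ℕ → S => g (y t)) (Set.Iic t) := fun y y' h => by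
  simp only [h t Set.self_mem_Iic]

theorem dependsOn_mul {ι R : Type*} {α : ι → Type*} [Mul R] {A : Set ι} {F G : (∀ i, α i) → R}
    (hF : DependsOn F A) (hG : DependsOn G A) : DependsOn (fun y => F y * G y) A :=
  fun y y' h => by simp only [hF h, hG h]

variable [Fintype S]

/-- The expectation of `F` along the first `T` steps of the Markov chain with initial law `π` and
transition matrix `K`. The functional `F` sees a whole sequence of states; those after time `T` are
frozen at the initial state. -/
def pathExp (π : S → ℝ) (K : Matrix S S ℝ) : ℕ → ((ℕ → S) → ℝ) → ℝ
  | 0, F => ∑ s, π s * F (fun _ => s)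
  | T + 1, F => pathExp π K T fun y => ∑ s, K (y T) s * F (Function.update y (T + 1) s)

variable {π : S → ℝ} {K : Matrix S S ℝ}

theorem pathExp_mono (hπ : ∀ s, 0 ≤ π s) (hK : ∀ s s', 0 ≤ K s s') (T : ℕ)
    {F G : (ℕ → S) → ℝ} (h : ∀ y, F y ≤ G y) : pathExp π K T F ≤ pathExp π K T G := by
  induction T generalizing F G with
  | zero => exact Finset.sum_le_sum fun s _ => mul_le_mul_of_nonneg_left (h _) (hπ s)
  | succ T ih =>
    exact ih fun y => Finset.sum_le_sum fun s _ => mul_le_mul_of_nonneg_left (h _) (hK _ s)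

theorem pathExp_sum {ι : Type*} (A : Finset ι) (T : ℕ) (F : ι → (ℕ → S) → ℝ) :
    pathExp π K T (fun y => ∑ i ∈ A, F i y) = ∑ i ∈ A, pathExp π K T (F i) := by
  induction T generalizing F with
  | zero =>
    simp only [pathExp, Finset.mul_sum]
    exact Finset.sum_comm
  | succ T ih =>
    simp only [pathExp, Finset.mul_sum, ← ih]
    congr 1
    ext y
    exact Finset.sum_comm

theorem pathExp_add (T : ℕ) (F G : (ℕ → S) → ℝ) :
    pathExp π K T (fun y => F y + G y) = pathExp π K T F + pathExp π K T G := by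
  induction T generalizing F G with
  | zero => simp only [pathExp, mul_add, Finset.sum_add_distrib]
  | succ T ih => simp only [pathExp, mul_add, Finset.sum_add_distrib, ih]

theorem pathExp_const_mul (T : ℕ) (a : ℝ) (F : (ℕ → S) → ℝ) :
    pathExp π K T (fun y => a * F y) = a * pathExp π K T F := by
  induction T generalizing F with
  | zero => simp only [pathExp, Finset.mul_sum, mul_left_comm a]
  | succ T ih => simp only [pathExp, ← ih, Finset.mul_sum, mul_left_comm a]

theorem pathExp_sub (T : ℕ) (F G : (ℕ → S) → ℝ) :
    pathExp π K T (fun y => F y - G y) = pathExp π K T F - pathExp π K T G := by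
  have h := pathExp_add (π := π) (K := K) T F (fun y => -1 * G y)
  rw [pathExp_const_mul] at h
  simpa only [neg_one_mul, ← sub_eq_add_neg] using h

theorem pathExp_succ_mul (T : ℕ) {g : (ℕ → S) → ℝ} (hg : DependsOn g (Set.Iic T)) (h : S → ℝ) :
    pathExp π K (T + 1) (fun y => g y * h (y (T + 1))) =
      pathExp π K T (fun y => g y * (K *ᵥ h) (y T)) := by
  rw [pathExp]
  congr 1
  ext y
  have hgy (s : S) : g (Function.update y (T + 1) s) = g y := hg fun _ => update_succ_of_le y s
  simp only [hgy, Function.update_self, Matrix.mulVec, dotProduct, Finset.mul_sum,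
    mul_left_comm (g y)]

theorem pathExp_of_dependsOn (hK1 : ∀ s, ∑ s', K s s' = 1) {t T : ℕ} (htT : t ≤ T)
    {F : (ℕ → S) → ℝ} (hF : DependsOn F (Set.Iic t)) : pathExp π K T F = pathExp π K t F := by
  induction T, htT using Nat.le_induction with
  | base => rfl
  | succ T hT ih =>
    have hFy (y : ℕ → S) (s : S) : F (Function.update y (T + 1) s) = F y :=
      hF fun _ hi => update_succ_of_le y s (le_trans hi hT)
    simp only [← ih, pathExp, hFy, ← Finset.sum_mul, hK1, one_mul]

theorem pathExp_eval (hK1 : ∀ s, ∑ s', K s s' = 1) (hst : π ᵥ* K = π) {t T : ℕ} (h : t ≤ T)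
    (g : S → ℝ) : pathExp π K T (fun y => g (y t)) = ∑ s, π s * g s := by
  rw [pathExp_of_dependsOn hK1 h (dependsOn_eval g t)]
  clear h
  induction t generalizing g with
  | zero => rfl
  | succ t ih =>
    have hstep := pathExp_succ_mul (π := π) (K := K) t (g := fun _ => 1) (fun _ _ _ => rfl) g
    simp only [one_mul] at hstep
    rw [hstep, ih]
    change π ⬝ᵥ K *ᵥ g = π ⬝ᵥ g
    rw [Matrix.dotProduct_mulVec, hst]

theorem pathExp_one (hK1 : ∀ s, ∑ s', K s s' = 1) (hπ1 : ∑ s, π s = 1) (T : ℕ) :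
    pathExp π K T (fun _ => 1) = 1 := by
  rw [pathExp_of_dependsOn hK1 T.zero_le (fun _ _ _ => rfl)]
  simpa [pathExp] using hπ1

/-- The kernel of a chain of independent coordinates which all move according to `K`. -/
def piKernel {Γ : Type*} (ι : Type*) [Fintype ι] (K : Matrix Γ Γ ℝ) :
    Matrix (ι → Γ) (ι → Γ) ℝ :=
  Matrix.of fun y y' => ∏ a, K (y a) (y' a)

theorem pathExp_pi {ι Γ : Type*} [Fintype ι] [DecidableEq ι] [Fintype Γ] (π : Γ → ℝ)
    (K : Matrix Γ Γ ℝ) (T : ℕ) (F : ι → (ℕ → Γ) → ℝ) :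
    pathExp (fun y : ι → Γ => ∏ a, π (y a)) (piKernel ι K) T (fun y => ∏ a, F a fun t => y t a) =
      ∏ a, pathExp π K T (F a) := by
  induction T generalizing F with
  | zero => simp only [pathExp, Finset.prod_univ_sum, Fintype.piFinset_univ,
      Finset.prod_mul_distrib]
  | succ T ih =>
    simp only [pathExp, ← ih]
    congr 1
    ext y
    rw [Finset.prod_univ_sum, Fintype.piFinset_univ]
    refine Finset.sum_congr rfl fun s _ => ?_
    have hupdate (a : ι) : (fun t => Function.update y (T + 1) s t a) =
        Function.update (fun t => y t a) (T + 1) (s a) := by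
      ext t
      obtain rfl | ht := eq_or_ne t (T + 1) <;> simp [*]
    simp only [hupdate, piKernel, Matrix.of_apply, Finset.prod_mul_distrib]

variable [DecidableEq S]

theorem pathExp_mul_eval_add (hK1 : ∀ s, ∑ s', K s s' = 1) {s n T : ℕ} (hT : s + n ≤ T)
    {g : (ℕ → S) → ℝ} (hg : DependsOn g (Set.Iic s)) (h : S → ℝ) :
    pathExp π K T (fun y => g y * h (y (s + n))) =
      pathExp π K T (fun y => g y * ((K ^ n) *ᵥ h) (y s)) := by
  induction n generalizing h with
  | zero => simp
  | succ n ih =>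
    have hg' {t : ℕ} (ht : s ≤ t) : DependsOn g (Set.Iic t) := hg.mono (Set.Iic_subset_Iic.2 ht)
    rw [pathExp_of_dependsOn hK1 hT (dependsOn_mul (hg' (by omega)) (dependsOn_eval h _)),
      ← add_assoc, pathExp_succ_mul _ (hg' (by omega)),
      ← pathExp_of_dependsOn hK1 (show s + n ≤ T by omega)
        (dependsOn_mul (hg' (by omega)) (dependsOn_eval _ _)),
      ih (by omega), Matrix.mulVec_mulVec, ← pow_succ]

theorem pathExp_eval_mul_eval_add (hK1 : ∀ s, ∑ s', K s s' = 1) (hst : π ᵥ* K = π) {s n T : ℕ}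
    (h : s + n ≤ T) (φ ψ : S → ℝ) :
    pathExp π K T (fun y => φ (y s) * ψ (y (s + n))) =
      ∑ a, π a * (φ a * ((K ^ n) *ᵥ ψ) a) := by
  rw [pathExp_mul_eval_add hK1 h (dependsOn_eval φ s)]
  exact pathExp_eval hK1 hst (by omega) fun a => φ a * ((K ^ n) *ᵥ ψ) a

theorem pathExp_prod_pairs (w : Matrix S S ℝ) (T : ℕ) (h : S → ℝ) :
    pathExp π K T (fun y => (∏ t ∈ Finset.range T, w (y t) (y (t + 1))) * h (y T)) =
      π ⬝ᵥ ((K ⊙ w) ^ T) *ᵥ h := by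
  induction T generalizing h with
  | zero => simp [pathExp, dotProduct]
  | succ T ih =>
    rw [pathExp, pow_succ, ← Matrix.mulVec_mulVec, ← ih]
    congr 1
    ext y
    rw [Matrix.mulVec, dotProduct, Finset.mul_sum]
    refine Finset.sum_congr rfl fun s _ => ?_
    have hpast : ∏ t ∈ Finset.range T, w (Function.update y (T + 1) s t)
        (Function.update y (T + 1) s (t + 1)) = ∏ t ∈ Finset.range T, w (y t) (y (t + 1)) :=
      Finset.prod_congr rfl fun t ht => by
        rw [Finset.mem_range] at ht
        rw [update_succ_of_le y s (by omega), update_succ_of_le y s (by omega)]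
    rw [Finset.prod_range_succ, hpast, Function.update_self, update_succ_of_le y s le_rfl,
      Matrix.hadamard_apply]
    ring

end MarkovChain

/-! ### Symmetric kernels -/

section SymmetricMatrix

variable {S : Type*} [Fintype S]

theorem sq_one_dotProduct_le (v : S → ℝ) : (1 ⬝ᵥ v) ^ 2 ≤ Fintype.card S * (v ⬝ᵥ v) := by
  simpa [dotProduct, sq] using sq_sum_le_card_mul_sum_sq (s := Finset.univ) (f := v)

theorem dotProduct_mul_self_mulVec {W : Matrix S S ℝ} (hW : W.IsSymm) (v : S → ℝ) :
    v ⬝ᵥ (W * W) *ᵥ v = W *ᵥ v ⬝ᵥ W *ᵥ v := by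
  rw [← Matrix.mulVec_mulVec, Matrix.dotProduct_mulVec, ← Matrix.mulVec_transpose, hW.eq]

/-- Cauchy–Schwarz, iterated by squaring the matrix: this is why the exponents are powers of
two. -/
theorem pow_two_pow_mul_card_le [DecidableEq S] [Nonempty S] {W : Matrix S S ℝ} (hW : W.IsSymm)
    {γ : ℝ} (hγ : 0 ≤ γ) (h : γ * Fintype.card S ≤ 1 ⬝ᵥ W *ᵥ 1) (n : ℕ) :
    γ ^ 2 ^ n * Fintype.card S ≤ 1 ⬝ᵥ (W ^ 2 ^ n) *ᵥ 1 := by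
  induction n with
  | zero => simpa using h
  | succ n ih =>
    have hcard : (0 : ℝ) < Fintype.card S := by exact_mod_cast Fintype.card_pos
    refine le_of_mul_le_mul_left ?_ hcard
    calc (Fintype.card S : ℝ) * (γ ^ 2 ^ (n + 1) * Fintype.card S)
        = (γ ^ 2 ^ n * Fintype.card S) ^ 2 := by ring
      _ ≤ (1 ⬝ᵥ (W ^ 2 ^ n) *ᵥ 1) ^ 2 := pow_le_pow_left₀ (by positivity) ih 2
      _ ≤ Fintype.card S * ((W ^ 2 ^ n) *ᵥ 1 ⬝ᵥ (W ^ 2 ^ n) *ᵥ 1) := sq_one_dotProduct_le _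
      _ = Fintype.card S * (1 ⬝ᵥ (W ^ 2 ^ (n + 1)) *ᵥ 1) := by
        rw [← dotProduct_mul_self_mulVec (hW.pow _), pow_succ 2 n, mul_two, pow_add]

theorem sum_mul_sq_sub {K : Matrix S S ℝ} (hK : K.IsSymm) (hK1 : ∀ s, ∑ s', K s s' = 1)
    (F : S → ℝ) :
    ∑ s, ∑ s', K s s' * (F s - F s') ^ 2 = 2 * (F ⬝ᵥ F - F ⬝ᵥ K *ᵥ F) := by
  have hfirst : ∑ s, ∑ s', K s s' * F s ^ 2 = F ⬝ᵥ F := by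
    simp only [← Finset.sum_mul, hK1, one_mul, dotProduct, sq]
  have hsecond : ∑ s, ∑ s', K s s' * F s' ^ 2 = F ⬝ᵥ F := by
    rw [Finset.sum_comm, ← hfirst]
    simp only [hK.apply]
  have hcross : ∑ s, ∑ s', K s s' * (F s * F s') = F ⬝ᵥ K *ᵥ F := by
    simp only [dotProduct, Matrix.mulVec, Finset.mul_sum, mul_left_comm (F _)]
  calc ∑ s, ∑ s', K s s' * (F s - F s') ^ 2
      = ∑ s, ∑ s', K s s' * F s ^ 2 + ∑ s, ∑ s', K s s' * F s' ^ 2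
          - 2 * ∑ s, ∑ s', K s s' * (F s * F s') := by
        simp only [Finset.mul_sum, ← Finset.sum_add_distrib, ← Finset.sum_sub_distrib]
        exact Finset.sum_congr rfl fun s _ => Finset.sum_congr rfl fun s' _ => by ring
    _ = 2 * (F ⬝ᵥ F - F ⬝ᵥ K *ᵥ F) := by rw [hfirst, hsecond, hcross]; ring

end SymmetricMatrix

/-! ### Resampling -/

section Noise

variable {ι Γ : Type*} [Fintype ι]

theorem isSymm_piKernel {K : Matrix Γ Γ ℝ} (hK : K.IsSymm) : (piKernel ι K).IsSymm :=
  Matrix.IsSymm.ext fun _ _ => Finset.prod_congr rfl fun _ _ => hK.apply _ _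

theorem piKernel_one [DecidableEq Γ] : piKernel ι (1 : Matrix Γ Γ ℝ) = 1 := by
  ext y y'
  simp only [piKernel, Matrix.of_apply, Matrix.one_apply, Finset.prod_ite_zero, Finset.mem_univ,
    true_imp_iff, Finset.prod_const_one, funext_iff]

variable [Fintype Γ]

theorem piKernel_mulVec_prod [DecidableEq ι] (K : Matrix Γ Γ ℝ) (h : ι → Γ → ℝ) (y : ι → Γ) :
    (piKernel ι K *ᵥ fun y => ∏ a, h a (y a)) y = ∏ a, (K *ᵥ h a) (y a) := by
  simp only [Matrix.mulVec, dotProduct, piKernel, Matrix.of_apply, Finset.prod_univ_sum,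
    Fintype.piFinset_univ, Finset.prod_mul_distrib]

theorem sum_piKernel [DecidableEq ι] {K : Matrix Γ Γ ℝ} (hK1 : ∀ c, ∑ c', K c c' = 1)
    (y : ι → Γ) : ∑ y', piKernel ι K y y' = 1 := by
  simpa [Matrix.mulVec, dotProduct, hK1] using piKernel_mulVec_prod K (fun _ _ => 1) y

theorem piKernel_mul [DecidableEq ι] (K L : Matrix Γ Γ ℝ) :
    piKernel ι K * piKernel ι L = piKernel ι (K * L) := by
  ext y y'
  exact piKernel_mulVec_prod K (fun a c => L c (y' a)) y

variable [DecidableEq Γ]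

/-- The transition matrix that keeps the state with probability `ρ` and otherwise resamples it
uniformly. -/
def resample (Γ : Type*) [Fintype Γ] [DecidableEq Γ] (ρ : ℝ) : Matrix Γ Γ ℝ :=
  fun c c' => ρ * (if c = c' then 1 else 0) + (1 - ρ) / Fintype.card Γ

theorem resample_nonneg {ρ : ℝ} (h0 : 0 ≤ ρ) (h1 : ρ ≤ 1) (c c' : Γ) :
    0 ≤ resample Γ ρ c c' := by
  have : 0 ≤ 1 - ρ := sub_nonneg.2 h1
  unfold resample
  positivity

theorem isSymm_resample (ρ : ℝ) : (resample Γ ρ).IsSymm :=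
  Matrix.IsSymm.ext fun c c' => by simp only [resample, eq_comm]

theorem resample_one : resample Γ 1 = 1 := by
  ext c c'
  simp [resample, Matrix.one_apply]

theorem resample_mulVec (ρ : ℝ) (h : Γ → ℝ) (c : Γ) :
    (resample Γ ρ *ᵥ h) c = ρ * h c + (1 - ρ) * ((∑ c', h c') / Fintype.card Γ) := by
  simp only [Matrix.mulVec, dotProduct, resample, add_mul, Finset.sum_add_distrib,
    ← Finset.mul_sum, mul_assoc, ite_mul, one_mul, zero_mul, Finset.sum_ite_eq, Finset.mem_univ,
    if_true, mul_div_assoc']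
  ring

theorem sum_resample [Nonempty Γ] (ρ : ℝ) (c : Γ) : ∑ c', resample Γ ρ c c' = 1 := by
  have h := resample_mulVec ρ (fun _ => (1 : ℝ)) c
  simpa [Matrix.mulVec, dotProduct] using h

theorem resample_mul [Nonempty Γ] (ρ σ : ℝ) :
    resample Γ ρ * resample Γ σ = resample Γ (ρ * σ) := by
  ext c c'
  have hcol : ∑ d, resample Γ σ d c' = 1 :=
    (Finset.sum_congr rfl fun d _ => (isSymm_resample σ).apply c' d).trans (sum_resample σ c')
  refine (resample_mulVec ρ (fun d => resample Γ σ d c') c).trans ?_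
  rw [hcol]
  simp only [resample]
  ring

theorem resample_pow [Nonempty Γ] (ρ : ℝ) (n : ℕ) : resample Γ ρ ^ n = resample Γ (ρ ^ n) := by
  induction n with
  | zero => simp [resample_one]
  | succ n ih => rw [pow_succ, ih, resample_mul, pow_succ]

/-- The noise operator: independent resampling of all coordinates, each of which is kept with
probability `ρ`. -/
def noise (ι Γ : Type*) [Fintype ι] [Fintype Γ] [DecidableEq Γ] (ρ : ℝ) :
    Matrix (ι → Γ) (ι → Γ) ℝ :=
  piKernel ι (resample Γ ρ)

theorem noise_nonneg {ρ : ℝ} (h0 : 0 ≤ ρ) (h1 : ρ ≤ 1) (y y' : ι → Γ) :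
    0 ≤ noise ι Γ ρ y y' :=
  Finset.prod_nonneg fun _ _ => resample_nonneg h0 h1 _ _

theorem isSymm_noise (ρ : ℝ) : (noise ι Γ ρ).IsSymm :=
  isSymm_piKernel (isSymm_resample ρ)

theorem noise_one : noise ι Γ 1 = 1 := by
  rw [noise, resample_one, piKernel_one]

variable [DecidableEq ι] [Nonempty Γ]

theorem sum_noise (ρ : ℝ) (y : ι → Γ) : ∑ y', noise ι Γ ρ y y' = 1 :=
  sum_piKernel (sum_resample ρ) y

theorem noise_mul (ρ σ : ℝ) : noise ι Γ ρ * noise ι Γ σ = noise ι Γ (ρ * σ) := by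
  rw [noise, noise, piKernel_mul, resample_mul, noise]

theorem noise_pow (ρ : ℝ) (n : ℕ) : noise ι Γ ρ ^ n = noise ι Γ (ρ ^ n) := by
  induction n with
  | zero => simp [noise_one]
  | succ n ih => rw [pow_succ, ih, noise_mul, pow_succ]

/-- For `v` an indicator: both ends of a noise-correlated pair lie in a set with probability at
least its squared density. -/
theorem sq_sum_le_card_mul_noise {ρ : ℝ} (h0 : 0 ≤ ρ) (v : (ι → Γ) → ℝ) :
    (∑ y, v y) ^ 2 ≤ Fintype.card (ι → Γ) * (v ⬝ᵥ noise ι Γ ρ *ᵥ v) := by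
  have hsqrt : noise ι Γ ρ = noise ι Γ √ρ * noise ι Γ √ρ := by
    rw [noise_mul, Real.mul_self_sqrt h0]
  have hone : noise ι Γ √ρ *ᵥ 1 = 1 := by
    ext y
    simp [Matrix.mulVec, dotProduct, sum_noise]
  have hsum : 1 ⬝ᵥ noise ι Γ √ρ *ᵥ v = ∑ y, v y := by
    rw [Matrix.dotProduct_mulVec, ← Matrix.mulVec_transpose, (isSymm_noise _).eq, hone,
      one_dotProduct]
  rw [hsqrt, dotProduct_mul_self_mulVec (isSymm_noise _), ← hsum]
  exact sq_one_dotProduct_le _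

end Noise

/-! ### Noise stability of low degree functions -/

section Filtration

theorem mul_norm_sq_le_inner_of_hasEigenvalue {E : Type*} [NormedAddCommGroup E]
    [InnerProductSpace ℝ E] [FiniteDimensional ℝ E] {T : E →ₗ[ℝ] E} (hT : T.IsSymmetric) {c : ℝ}
    (hc : ∀ μ, Module.End.HasEigenvalue T μ → c ≤ μ) (v : E) : c * ‖v‖ ^ 2 ≤ inner ℝ v (T v) := by
  let b := hT.eigenvectorBasis rfl
  have hcoord (i) : inner ℝ (b i) (T v) = hT.eigenvalues rfl i * inner ℝ (b i) v := by
    have h := hT.eigenvectorBasis_apply_self_apply rfl v i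
    rwa [OrthonormalBasis.repr_apply_apply, OrthonormalBasis.repr_apply_apply] at h
  rw [← real_inner_self_eq_norm_sq, ← b.sum_inner_mul_inner, ← b.sum_inner_mul_inner,
    Finset.mul_sum]
  refine Finset.sum_le_sum fun i _ => ?_
  have hle : c ≤ hT.eigenvalues rfl i := hc _ (hT.hasEigenvalue_eigenvalues rfl i)
  rw [hcoord, real_inner_comm v (b i)]
  linarith [mul_le_mul_of_nonneg_right hle (mul_self_nonneg (inner ℝ v (b i)))]

variable {E : Type*} [AddCommGroup E] [Module ℝ E] {T : E →ₗ[ℝ] E} {ρ : ℝ} {V : ℕ → Submodule ℝ E}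

theorem map_mem_of_filtration (hV : Monotone V) (hV0 : ∀ v ∈ V 0, T v = v)
    (hVs : ∀ d, ∀ v ∈ V (d + 1), T v - ρ ^ (d + 1) • v ∈ V d) :
    ∀ D, ∀ v ∈ V D, T v ∈ V D
  | 0, v, hv => (hV0 v hv).symm ▸ hv
  | d + 1, v, hv => by
    simpa using (V (d + 1)).add_mem (hV d.le_succ (hVs d v hv))
      ((V (d + 1)).smul_mem (ρ ^ (d + 1)) hv)

theorem pow_le_eigenvalue_of_filtration (h0 : 0 ≤ ρ) (h1 : ρ ≤ 1) (hV0 : ∀ v ∈ V 0, T v = v)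
    (hVs : ∀ d, ∀ v ∈ V (d + 1), T v - ρ ^ (d + 1) • v ∈ V d) {v : E} (hv0 : v ≠ 0) {μ : ℝ}
    (hμ : T v = μ • v) {D : ℕ} (hv : v ∈ V D) : ρ ^ D ≤ μ := by
  induction D with
  | zero =>
    have hμ1 : μ = 1 := smul_left_injective ℝ hv0 (by simp [← hμ, hV0 v hv])
    simp [hμ1]
  | succ d ih =>
    have hdiff : (μ - ρ ^ (d + 1)) • v ∈ V d := by
      rw [sub_smul, ← hμ]
      exact hVs d v hv
    by_cases hd : μ - ρ ^ (d + 1) = 0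
    · exact (sub_eq_zero.1 hd).ge
    · exact (pow_le_pow_of_le_one h0 h1 d.le_succ).trans
        (ih ((Submodule.smul_mem_iff _ hd).1 hdiff))

end Filtration

/-- On the successive quotients of the filtration `T` acts by the scalars `ρ ^ d`, so these are its
only possible eigenvalues. -/
theorem pow_mul_norm_sq_le_inner {E : Type*} [NormedAddCommGroup E] [InnerProductSpace ℝ E]
    [FiniteDimensional ℝ E] {T : E →ₗ[ℝ] E} (hT : T.IsSymmetric) {ρ : ℝ} (h0 : 0 ≤ ρ)
    (h1 : ρ ≤ 1) {V : ℕ → Submodule ℝ E} (hV : Monotone V) (hV0 : ∀ v ∈ V 0, T v = v)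
    (hVs : ∀ d, ∀ v ∈ V (d + 1), T v - ρ ^ (d + 1) • v ∈ V d) {D : ℕ} {v : E} (hv : v ∈ V D) :
    ρ ^ D * ‖v‖ ^ 2 ≤ inner ℝ v (T v) := by
  have hinv := map_mem_of_filtration hV hV0 hVs D
  refine mul_norm_sq_le_inner_of_hasEigenvalue (hT.restrict_invariant hinv) (fun μ hμ => ?_)
    (⟨v, hv⟩ : V D)
  obtain ⟨w, hw⟩ := hμ.exists_hasEigenvector
  exact pow_le_eigenvalue_of_filtration h0 h1 hV0 hVs (by simpa using hw.2)
    (congrArg Subtype.val hw.apply_eq_smul) w.2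

section Degree

variable {ι Γ : Type*}

theorem degreeSpace_mono : Monotone (degreeSpace ι Γ) := fun _ _ h =>
  Submodule.span_mono fun _ ⟨I, f, hI, hF⟩ => ⟨I, f, hI.trans h, hF⟩

theorem prod_mem_degreeSpace {I : Finset ι} (f : ι → Γ → ℝ) {d : ℕ} (h : I.card ≤ d) :
    (fun y => ∏ i ∈ I, f i (y i)) ∈ degreeSpace ι Γ d :=
  Submodule.subset_span ⟨I, f, h, rfl⟩

theorem degreeSpace_curry {κ : Type*} {D : ℕ} {F : (ι × κ → Γ) → ℝ}
    (hF : F ∈ degreeSpace (ι × κ) Γ D) :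
    (fun c : ι → κ → Γ => F fun p => c p.1 p.2) ∈ degreeSpace ι (κ → Γ) D := by
  classical
  induction hF using Submodule.span_induction with
  | mem F h =>
    obtain ⟨I, f, hI, rfl⟩ := h
    refine Submodule.subset_span ⟨I.image Prod.fst,
      fun a z => ∏ p ∈ I with p.1 = a, f p (z p.2), Finset.card_image_le.trans hI, ?_⟩
    ext c
    beta_reduce
    rw [← Finset.prod_fiberwise_of_maps_to fun p hp => Finset.mem_image_of_mem Prod.fst hp]
    refine Finset.prod_congr rfl fun a _ => Finset.prod_congr rfl fun p hp => ?_
    rw [← (Finset.mem_filter.1 hp).2]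
  | zero => exact Submodule.zero_mem _
  | add F G _ _ hF hG => exact Submodule.add_mem _ hF hG
  | smul a F _ hF => exact Submodule.smul_mem _ a hF

variable [Fintype ι] [DecidableEq ι] [Fintype Γ] [DecidableEq Γ] [Nonempty Γ]

theorem noise_mulVec_monomial (ρ : ℝ) (I : Finset ι) (f : ι → Γ → ℝ) :
    noise ι Γ ρ *ᵥ (fun y => ∏ i ∈ I, f i (y i)) =
      ∑ J ∈ I.powerset, (ρ ^ J.card * ∏ i ∈ I \ J, (1 - ρ) * ((∑ c, f i c) / Fintype.card Γ)) •
        fun y => ∏ i ∈ J, f i (y i) := by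
  ext y
  have hprod := piKernel_mulVec_prod (resample Γ ρ) (fun a c => if a ∈ I then f a c else 1) y
  simp only [Finset.prod_ite_mem, Finset.univ_inter] at hprod
  have hfactor (a : ι) : (resample Γ ρ *ᵥ fun c => if a ∈ I then f a c else 1) (y a) =
      if a ∈ I then ρ * f a (y a) + (1 - ρ) * ((∑ c, f a c) / Fintype.card Γ) else 1 := by
    rw [resample_mulVec]
    split_ifs <;> simp
  simp only [noise, hprod, hfactor, Finset.prod_ite_mem, Finset.univ_inter, Finset.prod_add,
    Finset.sum_apply, Pi.smul_apply, smul_eq_mul, Finset.prod_mul_distrib, Finset.prod_const]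
  exact Finset.sum_congr rfl fun J _ => by ring

theorem noise_mulVec_monomial_sub_mem (ρ : ℝ) {d : ℕ} {I : Finset ι} (hI : I.card ≤ d + 1)
    (f : ι → Γ → ℝ) :
    (noise ι Γ ρ *ᵥ fun y => ∏ i ∈ I, f i (y i)) - ρ ^ (d + 1) • (fun y => ∏ i ∈ I, f i (y i)) ∈
      degreeSpace ι Γ d := by
  rw [noise_mulVec_monomial]
  rcases hI.lt_or_eq with hlt | heq
  · refine Submodule.sub_mem _ (Submodule.sum_mem _ fun J hJ => Submodule.smul_mem _ _ ?_)
      (Submodule.smul_mem _ _ (prod_mem_degreeSpace f (Nat.lt_succ_iff.1 hlt)))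
    exact prod_mem_degreeSpace f
      ((Finset.card_le_card (Finset.mem_powerset.1 hJ)).trans (Nat.lt_succ_iff.1 hlt))
  · rw [← Finset.insert_erase (Finset.mem_powerset_self I),
      Finset.sum_insert (Finset.notMem_erase _ _), sdiff_self, Finset.bot_eq_empty,
      Finset.prod_empty, mul_one, heq, add_sub_cancel_left]
    refine Submodule.sum_mem _ fun J hJ => Submodule.smul_mem _ _ (prod_mem_degreeSpace f ?_)
    rw [Finset.mem_erase, Finset.mem_powerset] at hJ
    have := Finset.card_lt_card (hJ.2.ssubset_of_ne hJ.1)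
    omega

theorem noise_mulVec_sub_mem_degreeSpace (ρ : ℝ) {d : ℕ} {F : (ι → Γ) → ℝ}
    (hF : F ∈ degreeSpace ι Γ (d + 1)) :
    noise ι Γ ρ *ᵥ F - ρ ^ (d + 1) • F ∈ degreeSpace ι Γ d := by
  induction hF using Submodule.span_induction with
  | mem F h =>
    obtain ⟨I, f, hI, rfl⟩ := h
    exact noise_mulVec_monomial_sub_mem ρ hI f
  | zero => simp
  | add F G _ _ hF hG =>
    rw [Matrix.mulVec_add, smul_add, add_sub_add_comm]
    exact Submodule.add_mem _ hF hG
  | smul a F _ hF =>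
    rw [Matrix.mulVec_smul, smul_comm, ← smul_sub]
    exact Submodule.smul_mem _ _ hF

theorem noise_mulVec_of_mem_degreeSpace_zero (ρ : ℝ) {F : (ι → Γ) → ℝ}
    (hF : F ∈ degreeSpace ι Γ 0) : noise ι Γ ρ *ᵥ F = F := by
  induction hF using Submodule.span_induction with
  | mem F h =>
    obtain ⟨I, f, hI, rfl⟩ := h
    rw [noise_mulVec_monomial, Finset.card_eq_zero.1 (Nat.le_zero.1 hI)]
    simp
  | zero => simp
  | add F G _ _ hF hG => rw [Matrix.mulVec_add, hF, hG]
  | smul a F _ hF => rw [Matrix.mulVec_smul, hF]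

theorem pow_mul_dotProduct_le_noise {ρ : ℝ} (h0 : 0 ≤ ρ) (h1 : ρ ≤ 1) {D : ℕ}
    {F : (ι → Γ) → ℝ} (hF : F ∈ degreeSpace ι Γ D) :
    ρ ^ D * (F ⬝ᵥ F) ≤ F ⬝ᵥ noise ι Γ ρ *ᵥ F := by
  let e := (WithLp.linearEquiv 2 ℝ ((ι → Γ) → ℝ)).toLinearMap
  have hsymm : (Matrix.toEuclideanLin (noise ι Γ ρ)).IsSymmetric := by
    rw [Matrix.isSymmetric_toEuclideanLin_iff, Matrix.IsHermitian,
      Matrix.conjTranspose_eq_transpose_of_trivial, (isSymm_noise ρ).eq]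
  have h := pow_mul_norm_sq_le_inner hsymm h0 h1 (V := fun d => (degreeSpace ι Γ d).comap e)
    (fun _ _ h => Submodule.comap_mono (degreeSpace_mono h))
    (fun v hv => WithLp.ofLp_injective 2 (noise_mulVec_of_mem_degreeSpace_zero ρ hv))
    (fun d v hv => noise_mulVec_sub_mem_degreeSpace ρ (F := e v) hv) (D := D)
    (v := WithLp.toLp 2 F) hF
  rw [EuclideanSpace.real_norm_sq_eq, EuclideanSpace.inner_eq_star_dotProduct, dotProduct_comm] at h
  simpa [dotProduct, sq] using h

theorem sum_noise_mul_sq_sub_le {ρ : ℝ} (h0 : 0 ≤ ρ) (h1 : ρ ≤ 1) {D : ℕ}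
    {F : (ι → Γ) → ℝ} (hF : F ∈ degreeSpace ι Γ D) :
    ∑ y, ∑ y', noise ι Γ ρ y y' * (F y - F y') ^ 2 ≤ 2 * (1 - ρ ^ D) * ∑ y, F y ^ 2 := by
  have hsq : ∑ y, F y ^ 2 = F ⬝ᵥ F := by simp only [dotProduct, sq]
  rw [sum_mul_sq_sub (isSymm_noise ρ) (sum_noise ρ), hsq]
  linarith [pow_mul_dotProduct_le_noise h0 h1 hF]

end Degree

/-! ### Empirical conditional entropy -/

section Entropy

variable {N : ℕ} {P : Type*} [DecidableEq P]

/-- The number of variables in the cell `c` of the partition `p` to which `x` assigns `v`. -/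
def cellCount (p : Fin N → P) (x : Cube N) (c : P) (v : ℤˣ) : ℕ :=
  (Finset.univ.filter fun i => p i = c ∧ x i = v).card

/-- The number of variables in the cell `c` of the partition `p`. -/
def cellSize (p : Fin N → P) (c : P) : ℕ := (Finset.univ.filter fun i => p i = c).card

/-- The conditional frequency of the value `v` of `x` in the cell `c`; it is `0` on an empty
cell. -/
def condFreq (p : Fin N → P) (x : Cube N) (c : P) (v : ℤˣ) : ℝ :=
  cellCount p x c v / cellSize p c

/-- The empirical conditional entropy `H(x | p)`, in nats, of a uniformly random coordinate of the
assignment `x` given its cell in the partition `p`. -/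
def condEntropy (p : Fin N → P) (x : Cube N) : ℝ :=
  (∑ i, -Real.log (condFreq p x (p i) (x i))) / N

theorem sum_cellCount (p : Fin N → P) (x : Cube N) (c : P) :
    ∑ v, cellCount p x c v = cellSize p c := by
  rw [cellSize, Finset.card_eq_sum_card_fiberwise (f := x) (t := Finset.univ)
    fun _ _ => Finset.mem_univ _]
  exact Finset.sum_congr rfl fun v _ => by rw [cellCount, Finset.filter_filter]

theorem cellCount_le_cellSize (p : Fin N → P) (x : Cube N) (c : P) (v : ℤˣ) :
    cellCount p x c v ≤ cellSize p c :=
  Finset.card_le_card fun i => by simp +contextual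

theorem cellCount_le (p : Fin N → P) (x : Cube N) (c : P) (v : ℤˣ) : cellCount p x c v ≤ N :=
  (Finset.card_le_univ _).trans_eq (Fintype.card_fin N)

theorem cellCount_div_mem_Icc (p : Fin N → P) (x : Cube N) (c : P) (v : ℤˣ) :
    (cellCount p x c v / N : ℝ) ∈ Set.Icc (0 : ℝ) 1 :=
  ⟨by positivity, div_le_one_of_le₀ (by exact_mod_cast cellCount_le p x c v) (by positivity)⟩

theorem cellCount_le_add_hammingDist (p : Fin N → P) (x x' : Cube N) (c : P) (v : ℤˣ) :
    cellCount p x c v ≤ cellCount p x' c v + hammingDist x x' := by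
  refine (Finset.card_le_card fun i => ?_).trans (Finset.card_union_le _ _)
  simp only [Finset.mem_filter, Finset.mem_univ, true_and, Finset.mem_union]
  rintro ⟨hi, rfl⟩
  exact (eq_or_ne (x i) (x' i)).imp (fun h => ⟨hi, h.symm⟩) id

theorem abs_cellCount_sub_le (p : Fin N → P) (x x' : Cube N) (c : P) (v : ℤˣ) :
    |(cellCount p x' c v : ℝ) - cellCount p x c v| ≤ hammingDist x x' := by
  have h : (cellCount p x c v : ℝ) ≤ cellCount p x' c v + hammingDist x x' := by
    exact_mod_cast cellCount_le_add_hammingDist p x x' c v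
  have h' : (cellCount p x' c v : ℝ) ≤ cellCount p x c v + hammingDist x x' := by
    rw [hammingDist_comm]; exact_mod_cast cellCount_le_add_hammingDist p x' x c v
  rw [abs_le]; constructor <;> linarith

theorem cellSize_pos (p : Fin N → P) (i : Fin N) : 0 < cellSize p (p i) :=
  Finset.card_pos.2 ⟨i, by simp⟩

theorem cellSize_mul_condFreq (p : Fin N → P) (x : Cube N) (c : P) (v : ℤˣ) :
    cellSize p c * condFreq p x c v = cellCount p x c v := by
  refine mul_div_cancel_of_imp' fun h => ?_
  have := cellCount_le_cellSize p x c v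
  rw [Nat.cast_eq_zero] at h ⊢
  omega

theorem condFreq_nonneg (p : Fin N → P) (x : Cube N) (c : P) (v : ℤˣ) : 0 ≤ condFreq p x c v := by
  unfold condFreq; positivity

theorem condFreq_le_one (p : Fin N → P) (x : Cube N) (c : P) (v : ℤˣ) : condFreq p x c v ≤ 1 :=
  div_le_one_of_le₀ (by exact_mod_cast cellCount_le_cellSize p x c v) (by positivity)

theorem condFreq_pos (p : Fin N → P) (x : Cube N) (i : Fin N) : 0 < condFreq p x (p i) (x i) := by
  have hcount : 0 < cellCount p x (p i) (x i) := Finset.card_pos.2 ⟨i, by simp⟩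
  have hsize := cellSize_pos p i
  unfold condFreq; positivity

theorem sum_condFreq (p : Fin N → P) (x : Cube N) (i : Fin N) :
    ∑ v, condFreq p x (p i) v = 1 := by
  simp only [condFreq, ← Finset.sum_div]
  rw [div_eq_one_iff_eq (by exact_mod_cast (cellSize_pos p i).ne')]
  exact_mod_cast sum_cellCount p x (p i)

theorem sum_prod_condFreq (p : Fin N → P) (x : Cube N) :
    ∑ z : Cube N, ∏ i, condFreq p x (p i) (z i) = 1 := by
  rw [← Fintype.piFinset_univ,
    ← Finset.prod_univ_sum (fun _ => Finset.univ) fun i v => condFreq p x (p i) v]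
  exact Finset.prod_eq_one fun i _ => sum_condFreq p x i

theorem natCast_mul_condEntropy (p : Fin N → P) (x : Cube N) :
    N * condEntropy p x = ∑ i, -Real.log (condFreq p x (p i) (x i)) := by
  refine mul_div_cancel_of_imp' fun h => ?_
  obtain rfl : N = 0 := by exact_mod_cast h
  exact Fin.sum_univ_zero _

theorem prod_condFreq (p : Fin N → P) (x : Cube N) :
    ∏ i, condFreq p x (p i) (x i) = Real.exp (-(N * condEntropy p x)) := by
  rw [natCast_mul_condEntropy, ← Finset.sum_neg_distrib, Real.exp_sum]
  exact Finset.prod_congr rfl fun i _ => by rw [neg_neg, Real.exp_log (condFreq_pos p x i)]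

theorem condFreq_congr {p : Fin N → P} {x x' : Cube N}
    (h : ∀ c, cellCount p x c 1 = cellCount p x' c 1) : condFreq p x = condFreq p x' := by
  have hcount : ∀ c v, cellCount p x c v = cellCount p x' c v := by
    intro c v
    have hsum := (sum_cellCount p x c).trans (sum_cellCount p x' c).symm
    rw [UnitsInt.univ, Finset.sum_pair (by decide), Finset.sum_pair (by decide)] at hsum
    have hone := h c
    rcases Int.units_eq_one_or v with rfl | rfl
    · exact hone
    · omega
  ext c v
  rw [condFreq, condFreq, hcount]

/-- Under the product measure with marginals `condFreq p x₀`, every assignment with the same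
frequencies as `x₀` has mass `e ^ (-N H)`. -/
theorem card_condEntropy_le_of_condFreq_eq (p : Fin N → P) (b : ℝ) {s : Finset (Cube N)}
    (hfreq : ∀ x ∈ s, ∀ x' ∈ s, condFreq p x = condFreq p x')
    (hb : ∀ x ∈ s, condEntropy p x ≤ b) : (s.card : ℝ) ≤ Real.exp (N * b) := by
  rcases s.eq_empty_or_nonempty with rfl | ⟨x₀, hx₀⟩
  · simpa using Real.exp_nonneg _
  have hmass : ∑ _x ∈ s, Real.exp (-(N * b)) ≤ 1 := by
    rw [← sum_prod_condFreq p x₀]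
    refine (Finset.sum_le_sum fun x hx => ?_).trans (Finset.sum_le_sum_of_subset_of_nonneg
      (Finset.subset_univ _) fun x _ _ => Finset.prod_nonneg fun i _ => condFreq_nonneg _ _ _ _)
    rw [hfreq x₀ hx₀ x hx, prod_condFreq]
    gcongr
    exact hb x hx
  rwa [Finset.sum_const, nsmul_eq_mul, Real.exp_neg, ← div_eq_mul_inv,
    div_le_one (Real.exp_pos _)] at hmass

theorem sum_cellSize (p : Fin N → P) : ∑ c ∈ Finset.univ.image p, cellSize p c = N := by
  simp only [cellSize, ← Finset.card_eq_sum_card_image, Finset.card_univ, Fintype.card_fin]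

theorem sum_cell (p : Fin N → P) (x : Cube N) (φ : P → ℤˣ → ℝ) :
    ∑ i, φ (p i) (x i) = ∑ c ∈ Finset.univ.image p, ∑ v, cellCount p x c v * φ c v := by
  rw [← Finset.sum_fiberwise_of_maps_to (g := p) (t := Finset.univ.image p)
    fun i _ => Finset.mem_image_of_mem p (Finset.mem_univ i)]
  refine Finset.sum_congr rfl fun c _ => ?_
  rw [← Finset.sum_fiberwise _ x]
  refine Finset.sum_congr rfl fun v _ => ?_
  rw [Finset.filter_filter, cellCount, ← nsmul_eq_mul, ← Finset.sum_const]
  refine Finset.sum_congr rfl fun i hi => ?_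
  rw [(Finset.mem_filter.1 hi).2.1, (Finset.mem_filter.1 hi).2.2]

theorem sum_cell_le (p : Fin N → P) (x : Cube N) (φ : P → ℤˣ → ℝ) {B : ℝ}
    (h : ∀ c, ∑ v, condFreq p x c v * φ c v ≤ B) : ∑ i, φ (p i) (x i) ≤ N * B := by
  calc ∑ i, φ (p i) (x i)
      = ∑ c ∈ Finset.univ.image p, (cellSize p c : ℝ) * ∑ v, condFreq p x c v * φ c v := by
        simp only [sum_cell, Finset.mul_sum, ← mul_assoc, cellSize_mul_condFreq]
    _ ≤ ∑ c ∈ Finset.univ.image p, (cellSize p c : ℝ) * B :=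
        Finset.sum_le_sum fun c _ => mul_le_mul_of_nonneg_left (h c) (by positivity)
    _ = N * B := by rw [← Finset.sum_mul, ← Nat.cast_sum, sum_cellSize]

theorem condEntropy_eq (hN : N ≠ 0) (p : Fin N → P) (x : Cube N) :
    condEntropy p x = ∑ c ∈ Finset.univ.image p, (∑ v, Real.negMulLog (cellCount p x c v / N) -
      Real.negMulLog (cellSize p c / N)) := by
  have hN' : (N : ℝ) ≠ 0 := by exact_mod_cast hN
  rw [condEntropy, sum_cell p x fun c v => -Real.log (condFreq p x c v), Finset.sum_div]
  refine Finset.sum_congr rfl fun c _ => ?_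
  have hcell : Real.negMulLog (cellSize p c / N) =
      ∑ v, (cellCount p x c v / N : ℝ) * -Real.log (cellSize p c / N) := by
    rw [← Finset.sum_mul, ← Finset.sum_div, ← Nat.cast_sum, sum_cellCount, Real.negMulLog,
      neg_mul_comm]
  rw [hcell, ← Finset.sum_sub_distrib, Finset.sum_div]
  refine Finset.sum_congr rfl fun v _ => ?_
  rcases Nat.eq_zero_or_pos (cellCount p x c v) with h | h
  · simp [h]
  · have hcount : (cellCount p x c v : ℝ) ≠ 0 := by positivity
    have hsize : (cellSize p c : ℝ) ≠ 0 := by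
      exact_mod_cast (h.trans_le (cellCount_le_cellSize p x c v)).ne'
    rw [condFreq, Real.negMulLog, Real.log_div hcount hsize, Real.log_div hcount hN',
      Real.log_div hsize hN']
    ring

theorem condEntropy_sub_le (hN : N ≠ 0) (p : Fin N → P) (x x' : Cube N) {ε : ℝ}
    (h : ∀ c v, Real.negMulLog (cellCount p x' c v / N) -
      Real.negMulLog (cellCount p x c v / N) ≤ ε) :
    condEntropy p x' - condEntropy p x ≤ (Finset.univ.image p).card * (2 * ε) := by
  rw [condEntropy_eq hN, condEntropy_eq hN, ← Finset.sum_sub_distrib, ← nsmul_eq_mul]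
  refine Finset.sum_le_card_nsmul _ _ _ fun c _ => ?_
  rw [sub_sub_sub_cancel_right, ← Finset.sum_sub_distrib]
  refine (Finset.sum_le_card_nsmul _ _ _ fun v _ => h c v).trans_eq ?_
  rw [Finset.card_univ, Fintype.card_units_int, nsmul_eq_mul, Nat.cast_ofNat]

theorem mul_exp_neg_le {L u : ℝ} (hL : 1 ≤ L) (h : L ≤ u) :
    u * Real.exp (-u) ≤ L * Real.exp (-L) := by
  have hbern : u / L ≤ Real.exp (u / L - 1) := by linarith [Real.add_one_le_exp (u / L - 1)]
  have hexp : u / L - 1 ≤ u - L := by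
    rw [div_sub_one (by positivity), div_le_iff₀ (by positivity)]; nlinarith
  have hle := hbern.trans (Real.exp_le_exp.2 hexp)
  rw [div_le_iff₀ (by positivity)] at hle
  calc u * Real.exp (-u) ≤ (Real.exp (u - L) * L) * Real.exp (-u) :=
        mul_le_mul_of_nonneg_right hle (Real.exp_nonneg _)
    _ = L * Real.exp (-L) := by
        rw [mul_comm (Real.exp (u - L)), mul_assoc, ← Real.exp_add]; congr 2; ring

theorem sum_neg_log_condFreq_le (p : Fin N → P) (x : Cube N) {L : ℝ} (hL : 1 ≤ L) :
    (∑ i, if L < -Real.log (condFreq p x (p i) (x i)) then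
      -Real.log (condFreq p x (p i) (x i)) else 0) ≤ N * (2 * (L * Real.exp (-L))) := by
  refine sum_cell_le p x (fun c v => if L < -Real.log (condFreq p x c v) then
      -Real.log (condFreq p x c v) else 0) fun c => ?_
  have hvalue : ∀ v ∈ (Finset.univ : Finset ℤˣ), condFreq p x c v *
      (if L < -Real.log (condFreq p x c v) then -Real.log (condFreq p x c v) else 0) ≤
      L * Real.exp (-L) := by
    intro v _
    split_ifs with hv
    · have hpos : 0 < condFreq p x c v := by
        refine (condFreq_nonneg p x c v).lt_of_ne' fun h0 => ?_
        rw [h0, Real.log_zero] at hv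
        linarith
      have := mul_exp_neg_le hL hv.le
      rwa [neg_neg, Real.exp_log hpos, mul_comm] at this
    · rw [mul_zero]; positivity
  refine (Finset.sum_le_card_nsmul _ _ _ hvalue).trans_eq ?_
  rw [Finset.card_univ, Fintype.card_units_int]; simp

/-- The convex function `t ↦ e ^ (-l t)` lies below its chord on `[0, L]`. -/
theorem rpow_le_one_sub_truncated_log {w L l : ℝ} (hw : 0 < w) (hw1 : w ≤ 1) (hL : 0 < L)
    (hl : 0 ≤ l) : w ^ l ≤ 1 - (1 - Real.exp (-(l * L))) / L *
      (-Real.log w - if L < -Real.log w then -Real.log w else 0) := by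
  have hlog : 0 ≤ -Real.log w := neg_nonneg.2 (Real.log_nonpos hw.le hw1)
  split_ifs with h
  · rw [sub_self, mul_zero, sub_zero]; exact Real.rpow_le_one hw.le hw1 hl
  set t := -Real.log w with ht
  have hchord := convexOn_exp.2 (Set.mem_univ 0) (Set.mem_univ (-(l * L)))
    (sub_nonneg.2 ((div_le_one hL).2 (not_lt.1 h)) : 0 ≤ 1 - t / L) (by positivity : 0 ≤ t / L)
    (by ring)
  simp only [smul_eq_mul, mul_zero, zero_add, Real.exp_zero, mul_one] at hchord
  calc w ^ l = Real.exp (t / L * -(l * L)) := by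
        rw [Real.rpow_def_of_pos hw, ht]; congr 1; field_simp
    _ ≤ _ := hchord
    _ = _ := by ring

theorem sum_condFreq_rpow_le (p : Fin N → P) (x : Cube N) {L l : ℝ} (hL : 1 ≤ L) (hl : 0 ≤ l) :
    ∑ i, condFreq p x (p i) (x i) ^ l ≤
      N * (1 - (1 - Real.exp (-(l * L))) / L * (condEntropy p x - 2 * (L * Real.exp (-L)))) := by
  have hL0 : 0 < L := by linarith
  set θ := (1 - Real.exp (-(l * L))) / L with hθ
  have hθ0 : 0 ≤ θ :=
    div_nonneg (sub_nonneg.2 (Real.exp_le_one_iff.2 (neg_nonpos.2 (by positivity)))) hL0.le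
  refine (Finset.sum_le_sum fun i _ => rpow_le_one_sub_truncated_log (condFreq_pos p x i)
    (condFreq_le_one p x _ _) hL0 hl).trans ?_
  rw [← hθ, Finset.sum_sub_distrib, ← Finset.mul_sum, Finset.sum_sub_distrib,
    ← natCast_mul_condEntropy, Finset.sum_const, Finset.card_univ, Fintype.card_fin, nsmul_eq_mul]
  have := mul_le_mul_of_nonneg_left (sum_neg_log_condFreq_le p x hL) hθ0
  linarith

variable (P) in
theorem exists_condEntropy_sub_le [Finite P] {ξ : ℝ} (hξ : 0 < ξ) :
    ∃ η : ℝ, 0 < η ∧ ∀ (N : ℕ) (p : Fin N → P) (x x' : Cube N),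
      (hammingDist x x' : ℝ) ≤ η * N → condEntropy p x' - condEntropy p x ≤ ξ := by
  have := Fintype.ofFinite P
  set ε := ξ / (2 * (Fintype.card P + 1)) with hε
  have hε0 : 0 < ε := by positivity
  obtain ⟨η, hη, hcont⟩ := Metric.uniformContinuousOn_iff.1
    (isCompact_Icc.uniformContinuousOn_of_continuous (s := Set.Icc (0 : ℝ) 1)
      Real.continuous_negMulLog.continuousOn) ε hε0
  refine ⟨η / 2, by positivity, fun N p x x' hx => ?_⟩
  rcases Nat.eq_zero_or_pos N with rfl | hN
  · simp [condEntropy, hξ.le]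
  have hN' : (0 : ℝ) < N := by exact_mod_cast hN
  calc condEntropy p x' - condEntropy p x ≤ (Finset.univ.image p).card * (2 * ε) := by
        refine condEntropy_sub_le hN.ne' p x x' fun c v => ?_
        refine (le_abs_self _).trans (hcont _ (cellCount_div_mem_Icc p x' c v) _
          (cellCount_div_mem_Icc p x c v) ?_).le
        rw [Real.dist_eq, ← sub_div, abs_div, abs_of_pos hN', div_lt_iff₀ hN']
        refine (abs_cellCount_sub_le p x x' c v).trans_lt (hx.trans_lt ?_)
        nlinarith
    _ ≤ (Fintype.card P + 1) * (2 * ε) := by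
        gcongr
        exact_mod_cast (Finset.card_le_univ _).trans (Nat.le_succ _)
    _ = ξ := by rw [hε]; field_simp

theorem card_condEntropy_le [Fintype P] (p : Fin N → P) (b : ℝ) :
    ((Finset.univ.filter fun x : Cube N => condEntropy p x ≤ b).card : ℝ) ≤
      (N + 1) ^ Fintype.card P * Real.exp (N * b) := by
  let type : Cube N → P → Fin (N + 1) := fun x c =>
    ⟨cellCount p x c 1, Nat.lt_succ_of_le (cellCount_le p x c 1)⟩
  have hfreq : ∀ {x x'}, type x = type x' → condFreq p x = condFreq p x' := fun h =>
    condFreq_congr fun c => congrArg Fin.val (congrFun h c)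
  rw [Finset.card_eq_sum_card_fiberwise (f := type) (t := Finset.univ) (by simp), Nat.cast_sum]
  calc _ ≤ ∑ _a : P → Fin (N + 1), Real.exp (N * b) := by
        refine Finset.sum_le_sum fun a _ => card_condEntropy_le_of_condFreq_eq p b ?_ ?_
        · intro x hx x' hx'
          exact hfreq ((Finset.mem_filter.1 hx).2.trans (Finset.mem_filter.1 hx').2.symm)
        · intro x hx
          exact (Finset.mem_filter.1 (Finset.mem_filter.1 hx).1).2
    _ = _ := by simp [Finset.card_univ]

end Entropy

/-! ### Index tuples on which two assignments agree -/

section Agreement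

theorem sum_tuple_congr {ι κ P R : Type*} [Fintype ι] [Fintype κ] [DecidableEq κ] [DecidableEq P]
    [CommSemiring R] (p : ι → P) {φ ψ : ι → R}
    (h : ∀ c, ∑ i with p i = c, φ i = ∑ i with p i = c, ψ i) (g : (κ → P) → R) :
    ∑ I : κ → ι, (∏ s, φ (I s)) * g (p ∘ I) = ∑ I : κ → ι, (∏ s, ψ (I s)) * g (p ∘ I) := by
  classical
  have hfiber : ∀ φ : ι → R, ∑ I : κ → ι, (∏ s, φ (I s)) * g (p ∘ I) =
      ∑ c ∈ Finset.univ.image fun I : κ → ι => p ∘ I,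
        (∏ s, ∑ i with p i = c s, φ i) * g c := by
    intro φ
    rw [← Finset.sum_fiberwise_of_maps_to (g := fun I : κ → ι => p ∘ I)
      fun I _ => Finset.mem_image_of_mem _ (Finset.mem_univ I)]
    refine Finset.sum_congr rfl fun c _ => ?_
    rw [Finset.prod_univ_sum, Finset.sum_mul]
    refine Finset.sum_congr (by ext; simp [funext_iff]) fun I hI => ?_
    have hc : p ∘ I = c := funext fun s =>
      (Finset.mem_filter.1 (Fintype.mem_piFinset.1 hI s)).2
    rw [hc]
  simp only [hfiber, h]

variable {N : ℕ} {P : Type*} [DecidableEq P]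

/-- On the event that `x` agrees with `z ∘ p` at `k` random indices, the conditional likelihood of
the values of `x` depends on the cells only; averaging over the positions inside the cells then
replaces the agreement event by the same likelihood. -/
theorem card_agree_le (k : ℕ) (p : Fin N → P) (x : Cube N) (z : P → ℤˣ) {τ : ℝ} (hτ : 0 ≤ τ) :
    ((Finset.univ.filter fun I : Fin k → Fin N => (∀ s, x (I s) = z (p (I s))) ∧
      ∏ s, condFreq p x (p (I s)) (x (I s)) ≤ τ).card : ℝ) ≤ τ * N ^ k := by
  let unlikely : (Fin k → P) → ℝ := fun c =>
    if ∏ s, condFreq p x (c s) (z (c s)) ≤ τ then 1 else 0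
  have hfiber : ∀ c, ∑ i with p i = c, (if x i = z (p i) then (1 : ℝ) else 0) =
      ∑ i with p i = c, condFreq p x (p i) (z (p i)) := by
    intro c
    calc _ = (cellCount p x c (z c) : ℝ) := by
          rw [Finset.sum_boole, Finset.filter_filter, cellCount]
          congr 3; ext i; exact and_congr_right fun hi => by rw [hi]
      _ = ∑ i with p i = c, condFreq p x c (z c) := by
          rw [Finset.sum_const, nsmul_eq_mul, ← cellSize_mul_condFreq, cellSize]
      _ = _ := Finset.sum_congr rfl fun i hi => by rw [(Finset.mem_filter.1 hi).2]
  calc _ = ∑ I : Fin k → Fin N,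
        (∏ s, if x (I s) = z (p (I s)) then (1 : ℝ) else 0) * unlikely (p ∘ I) := by
        rw [Finset.natCast_card_filter]
        refine Finset.sum_congr rfl fun I _ => ?_
        rw [Finset.prod_ite_zero]
        by_cases hx : ∀ s, x (I s) = z (p (I s)) <;> simp [hx, unlikely]
    _ = ∑ I : Fin k → Fin N, (∏ s, condFreq p x (p (I s)) (z (p (I s)))) * unlikely (p ∘ I) :=
        sum_tuple_congr p hfiber unlikely
    _ ≤ ∑ _I : Fin k → Fin N, τ := by
        refine Finset.sum_le_sum fun I _ => ?_
        simp only [unlikely, Function.comp_apply]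
        split_ifs with h
        · rwa [mul_one]
        · rwa [mul_zero]
    _ = τ * N ^ k := by simp [mul_comm]

/-- A union bound for the agreements of likelihood at most `τ`, and Markov's inequality for the
`l`-th moment of the likelihood of the others. -/
theorem card_biUnion_agree_le {ι : Type*} (k : ℕ) (J : Finset ι) (p : Fin N → P) (x : Cube N)
    (z : ι → P → ℤˣ) {τ l : ℝ} (hτ : 0 < τ) (hl : 0 ≤ l) :
    ((J.biUnion fun j => Finset.univ.filter fun I : Fin k → Fin N =>
      ∀ s, x (I s) = z j (p (I s))).card : ℝ) ≤
      J.card * (τ * N ^ k) + τ⁻¹ ^ l * (∑ i, condFreq p x (p i) (x i) ^ l) ^ k := by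
  let w : (Fin k → Fin N) → ℝ := fun I => ∏ s, condFreq p x (p (I s)) (x (I s))
  let unlikely : ι → Finset (Fin k → Fin N) := fun j =>
    Finset.univ.filter fun I => (∀ s, x (I s) = z j (p (I s))) ∧ w I ≤ τ
  have hw : ∀ I, 0 ≤ w I := fun I => Finset.prod_nonneg fun s _ => condFreq_nonneg p x _ _
  have hcover : (J.biUnion fun j => Finset.univ.filter fun I : Fin k → Fin N =>
      ∀ s, x (I s) = z j (p (I s))) ⊆
      (J.biUnion unlikely) ∪ Finset.univ.filter fun I => τ < w I := by
    intro I hI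
    simp only [Finset.mem_union, Finset.mem_biUnion, Finset.mem_filter, Finset.mem_univ, true_and,
      unlikely] at hI ⊢
    obtain ⟨j, hj, hagree⟩ := hI
    exact (le_or_gt (w I) τ).imp_left fun h => ⟨j, hj, hagree, h⟩
  have hunlikely : ((J.biUnion unlikely).card : ℝ) ≤ J.card * (τ * N ^ k) := by
    refine (Nat.cast_le.2 Finset.card_biUnion_le).trans ?_
    rw [Nat.cast_sum, ← nsmul_eq_mul]
    exact Finset.sum_le_card_nsmul _ _ _ fun j _ => card_agree_le k p x (z j) hτ.le
  have hlikely : ((Finset.univ.filter fun I => τ < w I).card : ℝ) ≤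
      τ⁻¹ ^ l * (∑ i, condFreq p x (p i) (x i) ^ l) ^ k := by
    rw [Fintype.sum_pow, Finset.mul_sum, Finset.natCast_card_filter]
    refine Finset.sum_le_sum fun I _ => ?_
    rw [Real.finsetProd_rpow _ _ fun s _ => condFreq_nonneg p x _ _,
      ← Real.mul_rpow (by positivity) (hw I)]
    split_ifs with h
    · exact Real.one_le_rpow (by rw [inv_mul_eq_div, one_le_div hτ]; exact h.le) hl
    · exact Real.rpow_nonneg (mul_nonneg (by positivity) (hw I)) l
  refine (Nat.cast_le.2 ((Finset.card_le_card hcover).trans (Finset.card_union_le _ _))).trans ?_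
  rw [Nat.cast_add]
  exact add_le_add hunlikely hlikely

end Agreement

/-! ### Violated clauses -/

section Clause

variable {N : ℕ}

instance (l : Literal N) (x : Cube N) : Decidable (l.Holds x) :=
  inferInstanceAs (Decidable (x l.1 = if l.2 then 1 else -1))

/-- The `k`-clauses violated by `x`: those all of whose literals are false. -/
def violatedClauses (k : ℕ) (x : Cube N) : Finset (Fin k → Literal N) :=
  Fintype.piFinset fun _ => Finset.univ.filter fun l => ¬ l.Holds x

variable {k : ℕ}

theorem mem_violatedClauses {c : Fin k → Literal N} {x : Cube N} :
    c ∈ violatedClauses k x ↔ ∀ s, ¬ (c s).Holds x := by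
  simp [violatedClauses]

theorem not_holds_iff (l : Literal N) (x : Cube N) :
    ¬ l.Holds x ↔ x l.1 = if l.2 then -1 else 1 := by
  obtain ⟨i, b⟩ := l
  rcases Int.units_eq_one_or (x i) with h | h <;> cases b <;> simp [Literal.Holds, h]

theorem card_filter_not_holds (x : Cube N) :
    (Finset.univ.filter fun l : Literal N => ¬ l.Holds x).card = N := by
  have hsum : ∀ i, ∑ b : Bool, (if ¬ Literal.Holds (i, b) x then 1 else 0) = 1 := by
    intro i
    simp only [not_holds_iff, Fintype.sum_bool]
    rcases Int.units_eq_one_or (x i) with h | h <;> simp [h]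
  rw [Finset.card_filter, Fintype.sum_prod_type, Finset.sum_congr rfl fun i _ => hsum i]
  simp

theorem card_violatedClauses (x : Cube N) : (violatedClauses k x).card = N ^ k := by
  simp [violatedClauses, card_filter_not_holds]

theorem card_clause (N k : ℕ) : (Fintype.card (Fin k → Literal N) : ℝ) = 2 ^ k * N ^ k := by
  simp [mul_pow, mul_comm]

/-- A clause violated by both `x` and `x'` is determined by its variables, on which `x` and `x'`
agree. -/
theorem card_violatedClauses_inter_biUnion_le {ι : Type*} (x : Cube N) (J : Finset ι)
    (X : ι → Cube N) :
    (violatedClauses k x ∩ J.biUnion fun j => violatedClauses k (X j)).card ≤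
      (J.biUnion fun j => Finset.univ.filter fun I : Fin k → Fin N =>
        ∀ s, x (I s) = X j (I s)).card := by
  refine Finset.card_le_card_of_injOn (fun c s => (c s).1) ?_ ?_
  · intro c hc
    obtain ⟨hx, hJ⟩ := Finset.mem_inter.1 hc
    obtain ⟨j, hj, hX⟩ := Finset.mem_biUnion.1 hJ
    rw [mem_violatedClauses] at hx hX
    exact Finset.mem_biUnion.2 ⟨j, hj, Finset.mem_filter.2 ⟨Finset.mem_univ _, fun s =>
      ((not_holds_iff _ _).1 (hx s)).trans ((not_holds_iff _ _).1 (hX s)).symm⟩⟩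
  · intro c hc c' hc' hvars
    have hx := mem_violatedClauses.1 (Finset.mem_inter.1 hc).1
    have hx' := mem_violatedClauses.1 (Finset.mem_inter.1 hc').1
    funext s
    have hvar : (c s).1 = (c' s).1 := congrFun hvars s
    have hsign := ((not_holds_iff _ _).1 (hx s)).symm.trans
      ((congrArg x hvar).trans ((not_holds_iff _ _).1 (hx' s)))
    refine Prod.ext hvar ?_
    revert hsign
    cases (c s).2 <;> cases (c' s).2 <;> simp

theorem satisfies_uncurry_iff {M : ℕ} {x : Cube N} {y : Fin M → Fin k → Literal N} :
    Satisfies x (Function.uncurry y) ↔ ∀ a, y a ∉ violatedClauses k x := by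
  simp [Satisfies, mem_violatedClauses]

end Clause

/-! ### Avoiding a sequence of sets -/

section Avoidance

theorem ite_forall_not_le_one_sub_sum {n : ℕ} (s : Finset (Fin n)) (A : Fin n → Prop)
    [DecidablePred A] :
    (if ∀ i, ¬ A i then (1 : ℝ) else 0) ≤
      1 - ∑ i ∈ s, if A i ∧ ∀ j < i, ¬ A j then (1 : ℝ) else 0 := by
  split_ifs with h
  · simp [h]
  · rw [Finset.sum_boole, sub_nonneg, Nat.cast_le_one, Finset.card_le_one]
    intro i hi j hj
    obtain ⟨hAi, hi⟩ := (Finset.mem_filter.1 hi).2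
    obtain ⟨hAj, hj⟩ := (Finset.mem_filter.1 hj).2
    exact le_antisymm (not_lt.1 fun hji => hi j hji hAj) (not_lt.1 fun hij => hj i hij hAi)

/-- If `z i` lies in `B i` and some earlier `z j` in `B j`, then `z i` either lies in that `B j` as
well or avoids it. -/
theorem ite_mem_sub_le_ite_first {Γ : Type*} [DecidableEq Γ] {n : ℕ} (B : Fin n → Finset Γ)
    (z : Fin n → Γ) (i : Fin n) :
    (if z i ∈ B i then (1 : ℝ) else 0) -
        ((if z i ∈ B i ∩ (Finset.Iio i).biUnion B then 1 else 0) +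
          ∑ j ∈ Finset.Iio i, (if z j ∈ B j then 1 else 0) * if z i ∈ B i \ B j then 1 else 0) ≤
      if z i ∈ B i ∧ ∀ j < i, z j ∉ B j then 1 else 0 := by
  have hpair : ∀ j ∈ Finset.Iio i,
      (0 : ℝ) ≤ (if z j ∈ B j then 1 else 0) * if z i ∈ B i \ B j then 1 else 0 :=
    fun j _ => by positivity
  have hpairs := Finset.sum_nonneg hpair
  have hboth : (0 : ℝ) ≤ if z i ∈ B i ∩ (Finset.Iio i).biUnion B then 1 else 0 := by positivity
  by_cases hi : z i ∈ B i
  · by_cases hfirst : ∀ j < i, z j ∉ B j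
    · have hvisit : z i ∈ B i ∧ ∀ j < i, z j ∉ B j := ⟨hi, hfirst⟩
      rw [if_pos hi, if_pos hvisit]
      linarith
    · simp only [hi, hfirst, and_false, if_true, if_false]
      push Not at hfirst
      obtain ⟨j, hji, hj⟩ := hfirst
      by_cases hij : z i ∈ B j
      · have : z i ∈ B i ∩ (Finset.Iio i).biUnion B :=
          Finset.mem_inter.2 ⟨hi, Finset.mem_biUnion.2 ⟨j, Finset.mem_Iio.2 hji, hij⟩⟩
        rw [if_pos this]
        linarith
      · have hle := Finset.single_le_sum hpair (Finset.mem_Iio.2 hji)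
        rw [if_pos hj, if_pos (Finset.mem_sdiff.2 ⟨hi, hij⟩)] at hle
        linarith
  · simp only [hi, false_and, if_false]
    linarith

variable {Γ : Type*} [Fintype Γ] [DecidableEq Γ] [Nonempty Γ]

theorem uniform_vecMul_resample (ρ : ℝ) :
    (fun _ : Γ => (Fintype.card Γ : ℝ)⁻¹) ᵥ* resample Γ ρ = fun _ => (Fintype.card Γ : ℝ)⁻¹ := by
  ext c
  rw [← Matrix.mulVec_transpose, (isSymm_resample ρ).eq, Matrix.mulVec, dotProduct,
    ← Finset.sum_mul, sum_resample, one_mul]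

theorem pathExp_resample_mem (ρ : ℝ) {t T : ℕ} (h : t ≤ T) (A : Finset Γ) :
    pathExp (fun _ => (Fintype.card Γ : ℝ)⁻¹) (resample Γ ρ) T
      (fun z => if z t ∈ A then 1 else 0) = A.card / Fintype.card Γ := by
  rw [pathExp_eval (sum_resample ρ) (uniform_vecMul_resample ρ) h fun c => if c ∈ A then 1 else 0,
    ← Finset.mul_sum, Finset.sum_boole, Finset.filter_univ_mem, inv_mul_eq_div]

theorem pathExp_resample_mem_mul_mem_le {ρ : ℝ} (h0 : 0 ≤ ρ) {s t T : ℕ} (hst : s ≤ t) (htT : t ≤ T)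
    {A A' : Finset Γ} (hdisj : Disjoint A A') :
    pathExp (fun _ => (Fintype.card Γ : ℝ)⁻¹) (resample Γ ρ) T
      (fun z => (if z s ∈ A then 1 else 0) * if z t ∈ A' then 1 else 0) ≤
        A.card / Fintype.card Γ * (A'.card / Fintype.card Γ) := by
  obtain ⟨n, rfl⟩ := Nat.exists_eq_add_of_le hst
  have hstep : ∀ c, (if c ∈ A then (1 : ℝ) else 0) *
      ((resample Γ ρ ^ n) *ᵥ fun c => if c ∈ A' then 1 else 0) c ≤
        (if c ∈ A then 1 else 0) * (A'.card / Fintype.card Γ) := by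
    intro c
    split_ifs with hc
    · rw [resample_pow, resample_mulVec, if_neg (Finset.disjoint_left.1 hdisj hc),
        Finset.sum_boole, Finset.filter_univ_mem, one_mul, one_mul, mul_zero, zero_add]
      exact mul_le_of_le_one_left (by positivity) (sub_le_self _ (pow_nonneg h0 n))
    · simp
  rw [pathExp_eval_mul_eval_add (sum_resample ρ) (uniform_vecMul_resample ρ) htT
    (fun c => if c ∈ A then 1 else 0) fun c => if c ∈ A' then 1 else 0]
  refine (Finset.sum_le_sum fun c _ => mul_le_mul_of_nonneg_left (hstep c) (by positivity)).trans
    (le_of_eq ?_)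
  rw [← Finset.mul_sum, ← Finset.sum_mul, Finset.sum_boole, Finset.filter_univ_mem,
    inv_mul_eq_div, mul_div_right_comm]

/-- The visit of `B i` at time `t i` is likely to be the first one: an earlier visit of `B j` takes
place either at a point of `B i ∩ B j` or, up to resampling, independently. -/
theorem le_pathExp_first_visit {ρ : ℝ} (h0 : 0 ≤ ρ) (h1 : ρ ≤ 1) {β Q : ℝ} {m : ℕ}
    {B : Fin (m + 1) → Finset Γ} (hβ : ∀ i, ((B i).card : ℝ) = β * Fintype.card Γ)
    {t : Fin (m + 1) → ℕ} (ht : Monotone t) {T : ℕ} (hT : ∀ i, t i ≤ T) {i : Fin (m + 1)}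
    (hQ : ((B i ∩ (Finset.Iio i).biUnion B).card : ℝ) ≤ Q * (β * Fintype.card Γ)) :
    β * (1 - Q - m * β) ≤ pathExp (fun _ => (Fintype.card Γ : ℝ)⁻¹) (resample Γ ρ) T
      (fun z => if z (t i) ∈ B i ∧ ∀ j < i, z (t j) ∉ B j then 1 else 0) := by
  have hcard : (0 : ℝ) < Fintype.card Γ := by exact_mod_cast Fintype.card_pos
  have hfreq : ∀ j, ((B j).card : ℝ) / Fintype.card Γ = β := fun j => by
    rw [hβ, mul_div_cancel_right₀ _ hcard.ne']
  have hoverlap : ((B i ∩ (Finset.Iio i).biUnion B).card : ℝ) / Fintype.card Γ ≤ Q * β := by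
    rwa [div_le_iff₀ hcard, mul_assoc]
  have hpair : ∀ j ∈ Finset.Iio i, pathExp (fun _ => (Fintype.card Γ : ℝ)⁻¹) (resample Γ ρ) T
      (fun z => (if z (t j) ∈ B j then 1 else 0) * if z (t i) ∈ B i \ B j then 1 else 0) ≤
        β * β := by
    intro j hj
    refine (pathExp_resample_mem_mul_mem_le h0 (ht (Finset.mem_Iio.1 hj).le) (hT i)
      Finset.disjoint_sdiff).trans ?_
    have hle : ((B i \ B j).card : ℝ) / Fintype.card Γ ≤ β := by
      rw [← hfreq i]
      gcongr
      exact Finset.sdiff_subset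
    rw [hfreq]
    exact mul_le_mul_of_nonneg_left hle (by rw [← hfreq j]; positivity)
  have hpairs := Finset.sum_le_card_nsmul _ _ _ hpair
  rw [Fin.card_Iio, nsmul_eq_mul] at hpairs
  have him : (i : ℝ) * (β * β) ≤ m * (β * β) :=
    mul_le_mul_of_nonneg_right (by exact_mod_cast Nat.lt_succ_iff.1 i.2) (mul_self_nonneg β)
  calc β * (1 - Q - m * β) ≤ _ := by
        rw [pathExp_sub, pathExp_add, pathExp_sum, pathExp_resample_mem ρ (hT i),
          pathExp_resample_mem ρ (hT i), hfreq]
        linarith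
    _ ≤ _ := pathExp_mono (fun _ => by positivity) (resample_nonneg h0 h1) T fun z =>
        ite_mem_sub_le_ite_first B (fun i => z (t i)) i

theorem pathExp_resample_avoid_le {ρ : ℝ} (h0 : 0 ≤ ρ) (h1 : ρ ≤ 1) {β Q : ℝ} {m : ℕ}
    {B : Fin (m + 1) → Finset Γ} (hβ : ∀ i, ((B i).card : ℝ) = β * Fintype.card Γ)
    (hQ : ∀ i, i ≠ 0 →
      ((B i ∩ (Finset.Iio i).biUnion B).card : ℝ) ≤ Q * (β * Fintype.card Γ))
    {t : Fin (m + 1) → ℕ} (ht : Monotone t) {T : ℕ} (hT : ∀ i, t i ≤ T) :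
    pathExp (fun _ => (Fintype.card Γ : ℝ)⁻¹) (resample Γ ρ) T
      (fun z => if ∀ i, z (t i) ∉ B i then 1 else 0) ≤ 1 - m * β * (1 - Q - m * β) := by
  have hu : ∀ _ : Γ, 0 ≤ (Fintype.card Γ : ℝ)⁻¹ := fun _ => by positivity
  refine (pathExp_mono hu (resample_nonneg h0 h1) T fun z =>
    ite_forall_not_le_one_sub_sum (Finset.univ.erase 0) fun i => z (t i) ∈ B i).trans ?_
  rw [pathExp_sub, pathExp_sum,
    pathExp_one (sum_resample ρ) (by simp [-Fintype.card_pi])]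
  have hsum := Finset.card_nsmul_le_sum (Finset.univ.erase (0 : Fin (m + 1))) _ _ fun i hi =>
    le_pathExp_first_visit h0 h1 hβ ht hT (hQ i (Finset.ne_of_mem_erase hi))
  rw [Finset.card_erase_of_mem (Finset.mem_univ _), Finset.card_univ, Fintype.card_fin,
    Nat.add_sub_cancel, nsmul_eq_mul] at hsum
  linarith

end Avoidance

/-! ### Sequences of assignments -/

section Sequence

variable {N k m : ℕ}

/-- The partition of the variables by the values of the assignments `X j` with `j < l`, the later
ones being replaced by the constant `1`. -/
def pattern (X : Fin (m + 1) → Cube N) (l : Fin (m + 1)) (i : Fin N) : Fin (m + 1) → ℤˣ :=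
  fun j => if j < l then X j i else 1

theorem pattern_congr {X X' : Fin (m + 1) → Cube N} {l : Fin (m + 1)}
    (h : ∀ j < l, X j = X' j) : pattern X l = pattern X' l := by
  funext i j
  exact ite_congr rfl (fun hj => congrFun (h j hj) i) fun _ => rfl

/-- A bound on the conditional probability that a clause violated by an assignment of conditional
entropy at least `b` is violated by one of `m` earlier assignments. The likelihood threshold is
`1 / k`; `l` is the order of the moment and `L` the truncation level of the log-likelihood. -/
def overlapBound (k m : ℕ) (l L b : ℝ) : ℝ :=
  m / k + (k : ℝ) ^ l * (1 - (1 - Real.exp (-(l * L))) / L * (b - 2 * (L * Real.exp (-L)))) ^ k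

theorem card_violatedClauses_inter_earlier_le (hk : k ≠ 0) (X : Fin (m + 1) → Cube N)
    (i : Fin (m + 1)) {l L b : ℝ} (hl : 0 ≤ l) (hL : 1 ≤ L)
    (hb : b ≤ condEntropy (pattern X i) (X i)) :
    ((violatedClauses k (X i) ∩
      (Finset.Iio i).biUnion fun j => violatedClauses k (X j)).card : ℝ) ≤
      overlapBound k m l L b * N ^ k := by
  have hk' : (0 : ℝ) < k := by positivity
  have hcard : ((Finset.Iio i).card : ℝ) ≤ m := by
    rw [Fin.card_Iio]; exact_mod_cast Nat.lt_succ_iff.1 i.2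
  have hθ : 0 ≤ (1 - Real.exp (-(l * L))) / L := by
    have : Real.exp (-(l * L)) ≤ 1 := Real.exp_le_one_iff.2 (neg_nonpos.2 (by positivity))
    exact div_nonneg (sub_nonneg.2 this) (by linarith)
  have hmoment : ∑ v, condFreq (pattern X i) (X i) (pattern X i v) (X i v) ^ l ≤
      N * (1 - (1 - Real.exp (-(l * L))) / L * (b - 2 * (L * Real.exp (-L)))) :=
    (sum_condFreq_rpow_le (pattern X i) (X i) hL hl).trans (by gcongr)
  have hmoment0 := Finset.sum_nonneg fun v (_ : v ∈ Finset.univ) =>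
    Real.rpow_nonneg (condFreq_nonneg (pattern X i) (X i) (pattern X i v) (X i v)) l
  have hagree : ((Finset.Iio i).biUnion fun j => Finset.univ.filter fun I : Fin k → Fin N =>
        ∀ s, X i (I s) = X j (I s)) =
      (Finset.Iio i).biUnion fun j => Finset.univ.filter fun I =>
        ∀ s, X i (I s) = pattern X i (I s) j :=
    Finset.biUnion_congr rfl fun j hj => by simp only [pattern, if_pos (Finset.mem_Iio.1 hj)]
  have hcount := card_biUnion_agree_le k (Finset.Iio i) (pattern X i) (X i) (fun j c => c j)
    (inv_pos.2 hk') hl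
  rw [← hagree] at hcount
  refine ((Nat.cast_le.2 (card_violatedClauses_inter_biUnion_le _ _ _)).trans hcount).trans ?_
  calc _
      ≤ m * ((k : ℝ)⁻¹ * N ^ k) + (k : ℝ)⁻¹⁻¹ ^ l *
        (N * (1 - (1 - Real.exp (-(l * L))) / L * (b - 2 * (L * Real.exp (-L))))) ^ k := by
        exact add_le_add (mul_le_mul_of_nonneg_right hcard (by positivity))
          (mul_le_mul_of_nonneg_left (pow_le_pow_left₀ hmoment0 hmoment k) (by positivity))
    _ = overlapBound k m l L b * N ^ k := by rw [overlapBound, inv_inv, mul_pow]; ring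

theorem pathExp_clause_le (hN : N ≠ 0) {ρ : ℝ} (h0 : 0 ≤ ρ) (h1 : ρ ≤ 1) {Q : ℝ}
    (X : Fin (m + 1) → Cube N) {t : Fin (m + 1) → ℕ} (ht : Monotone t) {T : ℕ} (hT : ∀ i, t i ≤ T)
    (hQ : ∀ i, i ≠ 0 → ((violatedClauses k (X i) ∩
      (Finset.Iio i).biUnion fun j => violatedClauses k (X j)).card : ℝ) ≤ Q * N ^ k) :
    pathExp (fun _ => (Fintype.card (Fin k → Literal N) : ℝ)⁻¹) (resample (Fin k → Literal N) ρ) T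
      (fun z => if ∀ i, z (t i) ∉ violatedClauses k (X i) then 1 else 0) ≤
      1 - m * (1 / 2) ^ k * (1 - Q - m * (1 / 2) ^ k) := by
  have : NeZero N := ⟨hN⟩
  have hcard : (1 / 2 : ℝ) ^ k * Fintype.card (Fin k → Literal N) = N ^ k := by
    rw [card_clause, ← mul_assoc, ← mul_pow]; norm_num
  refine pathExp_resample_avoid_le h0 h1 (fun i => ?_) (fun i hi => ?_) ht hT
  · rw [hcard, card_violatedClauses, Nat.cast_pow]
  · rw [hcard]; exact hQ i hi

end Sequence

/-! ### Counting sequences of assignments -/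

section Counting

theorem card_filter_forall_le_prod {α : Type*} [Fintype α] [Nonempty α] {n : ℕ}
    (R : Fin n → (Fin n → α) → Prop) [∀ i, DecidablePred (R i)]
    (hR : ∀ i X X', (∀ j ≤ i, X j = X' j) → R i X → R i X') {B : Fin n → ℝ}
    (hB : ∀ i X, ((Finset.univ.filter fun a => R i (Function.update X i a)).card : ℝ) ≤ B i) :
    ((Finset.univ.filter fun X => ∀ i, R i X).card : ℝ) ≤ ∏ i, B i := by
  classical
  induction n with
  | zero => simp
  | succ n ih =>
    let X₀ : Fin (n + 1) → α := fun _ => Classical.arbitrary α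
    have hrest : ∀ a, ((Finset.univ.filter fun Y : Fin n → α =>
        ∀ i : Fin n, R i.succ (Fin.cons a Y)).card : ℝ) ≤ ∏ i : Fin n, B i.succ := by
      intro a
      refine ih (fun i Y => R i.succ (Fin.cons a Y)) (fun i Y Y' h => hR _ _ _ fun j hj => ?_)
        fun i Y => ?_
      · cases j using Fin.cases with
        | zero => rfl
        | succ j => simpa using h j (Fin.succ_le_succ_iff.1 hj)
      · simpa only [Fin.cons_update] using hB i.succ (Fin.cons a Y)
    have hfirst : ∀ a (Y : Fin n → α), R 0 (Fin.cons a Y) → R 0 (Function.update X₀ 0 a) :=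
      fun a Y => hR 0 _ _ fun j hj => by rw [Fin.le_zero_iff.1 hj]; simp
    have hprod : 0 ≤ ∏ i : Fin n, B i.succ :=
      (Nat.cast_nonneg _).trans (hrest (Classical.arbitrary α))
    calc ((Finset.univ.filter fun X => ∀ i, R i X).card : ℝ)
        = ∑ a, ∑ Y : Fin n → α, if ∀ i, R i (Fin.cons a Y) then (1 : ℝ) else 0 := by
          rw [Finset.natCast_card_filter, ← Fintype.sum_prod_type']
          exact (Fintype.sum_equiv (Fin.consEquiv fun _ => α) _ _ fun _ => rfl).symm
      _ ≤ ∑ a, if R 0 (Function.update X₀ 0 a) then ∏ i : Fin n, B i.succ else 0 := by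
          refine Finset.sum_le_sum fun a _ => ?_
          split_ifs with h
          · refine le_trans ?_ (hrest a)
            rw [Finset.natCast_card_filter]
            exact Finset.sum_le_sum fun Y _ => by
              simp only [Fin.forall_fin_succ]
              split_ifs <;> simp_all
          · exact Finset.sum_nonpos fun Y _ => by
              rw [if_neg fun hall => h (hfirst a Y (hall 0))]
      _ = (Finset.univ.filter fun a => R 0 (Function.update X₀ 0 a)).card *
          ∏ i : Fin n, B i.succ := by
          rw [← Finset.sum_filter, Finset.sum_const, nsmul_eq_mul]
      _ ≤ ∏ i, B i := by
          rw [Fin.prod_univ_succ]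
          exact mul_le_mul_of_nonneg_right (hB 0 X₀) hprod

/-- A bound on the number of assignments whose conditional entropy, relative to a partition of the
variables by the values of at most `m + 1` assignments, is at most `b`. -/
def lowEntropyBound (N m : ℕ) (b : ℝ) : ℝ :=
  (N + 1) ^ 2 ^ (m + 1) * Real.exp (N * b)

theorem lowEntropyBound_nonneg (N m : ℕ) (b : ℝ) : 0 ≤ lowEntropyBound N m b := by
  unfold lowEntropyBound; positivity

theorem card_condEntropy_le_lowEntropyBound {N m : ℕ} (p : Fin N → Fin (m + 1) → ℤˣ) (b : ℝ) :
    ((Finset.univ.filter fun x : Cube N => condEntropy p x ≤ b).card : ℝ) ≤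
      lowEntropyBound N m b := by
  simpa [lowEntropyBound] using card_condEntropy_le p b

theorem card_sequences_le (N m : ℕ) (b : ℝ) :
    ((Finset.univ.filter fun X : Fin (m + 1) → Cube N =>
      ∀ i, i ≠ 0 → condEntropy (pattern X i) (X i) ≤ b).card : ℝ) ≤
      2 ^ N * lowEntropyBound N m b ^ m := by
  classical
  have hupdate : ∀ (X : Fin (m + 1) → Cube N) i x,
      pattern (Function.update X i x) i = pattern X i := fun X i x =>
    pattern_congr fun j hj => Function.update_of_ne hj.ne _ _
  refine (card_filter_forall_le_prod (fun i X => i ≠ 0 → condEntropy (pattern X i) (X i) ≤ b)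
    (fun i X X' h hX => ?_) (B := Fin.cons (2 ^ N) fun _ : Fin m => lowEntropyBound N m b)
    fun i X => ?_).trans_eq ?_
  · rwa [← pattern_congr fun j hj => h j hj.le, ← h i le_rfl]
  · cases i using Fin.cases with
    | zero => simp
    | succ i =>
      simpa [hupdate, Fin.succ_ne_zero] using
        card_condEntropy_le_lowEntropyBound (pattern X i.succ) b
  · rw [Fin.prod_univ_succ]
    simp

end Counting

/-! ### Choosing the times of a slowly moving sequence -/

section Times

theorem exists_mem_Icc_of_add_one_sub_le {f : ℕ → ℝ} {b' b : ℝ} {n : ℕ} (h0 : f 0 ≤ b)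
    (hn : b < f n) (hstep : ∀ r < n, f (r + 1) - f r ≤ b - b') :
    ∃ r < n, f r ∈ Set.Icc b' b := by
  induction n with
  | zero => exact absurd hn h0.not_gt
  | succ n ih =>
    rcases le_or_gt (f n) b with h | h
    · exact ⟨n, n.lt_succ_self, by linarith [hstep n n.lt_succ_self], h⟩
    · obtain ⟨r, hr, hmem⟩ := ih h fun r hr => hstep r (hr.trans n.lt_succ_self)
      exact ⟨r, hr.trans n.lt_succ_self, hmem⟩

theorem exists_monotone_of_forall_exists {m T₀ : ℕ} {P : Fin (m + 1) → (Fin (m + 1) → ℕ) → Prop}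
    (hP : ∀ i τ τ', (∀ j ≤ i, τ j = τ' j) → P i τ → P i τ')
    (hext : ∀ (i : Fin m) (τ : Fin (m + 1) → ℕ), Monotone τ → (∀ j, τ j ≤ i * T₀) → ∃ r ≤ T₀,
      P i.succ fun j => if j ≤ i.castSucc then τ j else τ i.castSucc + r) :
    ∃ τ : Fin (m + 1) → ℕ, Monotone τ ∧ (∀ i, τ i ≤ m * T₀) ∧ ∀ i, i ≠ 0 → P i τ := by
  suffices key : ∀ n ≤ m, ∃ τ : Fin (m + 1) → ℕ, Monotone τ ∧ (∀ i, τ i ≤ n * T₀) ∧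
      ∀ i : Fin (m + 1), i ≠ 0 → (i : ℕ) ≤ n → P i τ by
    obtain ⟨τ, hmono, hle, hτ⟩ := key m le_rfl
    exact ⟨τ, hmono, hle, fun i hi => hτ i hi (Nat.lt_succ_iff.1 i.2)⟩
  intro n
  induction n with
  | zero =>
    exact fun _ => ⟨fun _ => 0, monotone_const, by simp,
      fun i hi hi0 => absurd (Fin.ext (Nat.le_zero.1 hi0)) hi⟩
  | succ n ih =>
    intro hn
    obtain ⟨τ, hmono, hle, hτ⟩ := ih (by omega)
    let i₀ : Fin m := ⟨n, hn⟩
    obtain ⟨r, hr, hnew⟩ := hext i₀ τ hmono hle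
    refine ⟨fun j => if j ≤ i₀.castSucc then τ j else τ i₀.castSucc + r, ?_, fun j => ?_,
      fun i hi hin => ?_⟩
    · intro i j hij
      dsimp only
      split_ifs with hi hj hj
      · exact hmono hij
      · exact (hmono hi).trans (Nat.le_add_right _ _)
      · exact absurd (hij.trans hj) hi
      · exact le_rfl
    · have hj := hle j
      have hi₀ := hle i₀.castSucc
      rw [Nat.succ_mul]
      dsimp only
      split_ifs <;> omega
    · rcases Nat.lt_or_ge n i with h | h
      · obtain rfl : i = i₀.succ := Fin.ext (hin.antisymm h)
        exact hnew
      · refine hP i τ _ (fun j hj => (if_pos ?_).symm) (hτ i hi h)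
        exact Fin.le_def.2 (le_trans (Fin.le_def.1 hj) h)

variable {N m : ℕ}

theorem condEntropy_pattern_self (X : Fin (m + 1) → Cube N) {j l : Fin (m + 1)} (h : j < l) :
    condEntropy (pattern X l) (X j) = 0 := by
  have hfreq : ∀ i, condFreq (pattern X l) (X j) (pattern X l i) (X j i) = 1 := by
    intro i
    have hcell : cellCount (pattern X l) (X j) (pattern X l i) (X j i) =
        cellSize (pattern X l) (pattern X l i) := by
      unfold cellCount cellSize
      congr 1
      ext i'
      simp only [Finset.mem_filter, Finset.mem_univ, true_and, and_iff_left_iff_imp]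
      intro hpat
      simpa only [pattern, if_pos h] using congrFun hpat j
    rw [condFreq, hcell, div_self]
    exact_mod_cast (cellSize_pos (pattern X l) i).ne'
  simp [condEntropy, hfreq]

theorem exists_times {x : ℕ → Cube N} {b' b η : ℝ} {T T₀ : ℕ} (hb : 0 ≤ b)
    (hη : ∀ (p : Fin N → Fin (m + 1) → ℤˣ) (x x' : Cube N), (hammingDist x x' : ℝ) ≤ η * N →
      condEntropy p x' - condEntropy p x ≤ b - b')
    (hstep : ∀ t < T, (hammingDist (x t) (x (t + 1)) : ℝ) ≤ η * N) (hT : m * T₀ ≤ T)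
    (hfar : ∀ τ : Fin (m + 1) → ℕ, Monotone τ → (∀ i, τ i ≤ T) → ∀ i : Fin m,
      τ i.castSucc + T₀ ≤ T →
        b < condEntropy (pattern (fun j => x (τ j)) i.succ) (x (τ i.castSucc + T₀))) :
    ∃ τ : Fin (m + 1) → ℕ, Monotone τ ∧ (∀ i, τ i ≤ T) ∧
      ∀ i, i ≠ 0 → condEntropy (pattern (fun j => x (τ j)) i) (x (τ i)) ∈ Set.Icc b' b := by
  suffices hext : ∀ (i : Fin m) (τ : Fin (m + 1) → ℕ), Monotone τ → (∀ j, τ j ≤ i * T₀) →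
      ∃ r ≤ T₀, condEntropy (pattern (fun j => x (if j ≤ i.castSucc then τ j else
        τ i.castSucc + r)) i.succ) (x (if i.succ ≤ i.castSucc then τ i.succ else
        τ i.castSucc + r)) ∈ Set.Icc b' b by
    obtain ⟨τ, hmono, hle, hτ⟩ := exists_monotone_of_forall_exists
      (P := fun i τ => condEntropy (pattern (fun j => x (τ j)) i) (x (τ i)) ∈ Set.Icc b' b)
      (fun i τ τ' h hi => by
        rwa [← h i le_rfl, ← pattern_congr fun j hj => congrArg x (h j hj.le)]) hext
    exact ⟨τ, hmono, fun i => (hle i).trans hT, hτ⟩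
  intro i τ hmono hle
  have hend : (i : ℕ) * T₀ + T₀ ≤ T :=
    le_trans (by rw [← Nat.succ_mul]; exact Nat.mul_le_mul_right _ i.2) hT
  have hi := hle i.castSucc
  set p := pattern (fun j => x (τ j)) i.succ
  obtain ⟨r, hr, hmem⟩ := exists_mem_Icc_of_add_one_sub_le (b' := b')
    (f := fun r => condEntropy p (x (τ i.castSucc + r)))
    ((condEntropy_pattern_self (fun j => x (τ j)) i.castSucc_lt_succ).trans_le hb)
    (hfar τ hmono (fun j => (hle j).trans (by omega)) i (by omega))
    fun r hr => hη p _ _ (hstep _ (by omega))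
  refine ⟨r, hr.le, ?_⟩
  rw [pattern_congr (X' := fun j => x (τ j))
    fun j hj => congrArg x (if_pos (Fin.le_castSucc_iff.2 hj)),
    if_neg (Fin.castSucc_lt_succ (i := i)).not_ge]
  exact hmem

end Times

/-! ### First moments along the resampling chain -/

section Path

variable {N M k m : ℕ}

/-- A `k`-SAT instance, curried over its `M` clauses. -/
abbrev ClauseSeq (N M k : ℕ) : Type := Fin M → Fin k → Literal N

instance (x : Cube N) (y : Instance N M k) : Decidable (Satisfies x y) :=
  inferInstanceAs (Decidable (∀ a, ∃ j, (y (a, j)).Holds x))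

/-- The expectation along the stationary Markov chain of `k`-SAT instances which at each step
resamples every clause independently with probability `1 - ρ`. -/
def instExp (N M k : ℕ) (ρ : ℝ) (T : ℕ) (F : (ℕ → ClauseSeq N M k) → ℝ) : ℝ :=
  pathExp (fun _ => ∏ _a : Fin M, (Fintype.card (Fin k → Literal N) : ℝ)⁻¹)
    (noise (Fin M) (Fin k → Literal N) ρ) T F

theorem instExp_mono {ρ : ℝ} (h0 : 0 ≤ ρ) (h1 : ρ ≤ 1) (T : ℕ) {F G : (ℕ → ClauseSeq N M k) → ℝ}
    (h : ∀ y, F y ≤ G y) : instExp N M k ρ T F ≤ instExp N M k ρ T G :=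
  pathExp_mono (fun _ => by positivity) (noise_nonneg h0 h1) T h

theorem instExp_const (hN : N ≠ 0) (ρ : ℝ) (T : ℕ) (a : ℝ) :
    instExp N M k ρ T (fun _ => a) = a := by
  have : NeZero N := ⟨hN⟩
  rw [instExp, ← mul_one a, pathExp_const_mul, pathExp_one (sum_noise ρ), mul_one]
  rw [Finset.sum_const, Finset.card_univ, Fintype.card_fun (α := Fin M), nsmul_eq_mul,
    Finset.prod_const, Finset.card_univ, Nat.cast_pow, ← mul_pow, mul_inv_cancel₀, one_pow]
  exact_mod_cast Fintype.card_ne_zero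

theorem ite_satisfies_eq_prod (x : Cube N) (y : ClauseSeq N M k) :
    (if Satisfies x (Function.uncurry y) then (1 : ℝ) else 0) =
      ∏ a, if y a ∉ violatedClauses k x then 1 else 0 := by
  simp only [Finset.prod_ite_zero, satisfies_uncurry_iff, Finset.mem_univ, true_imp_iff,
    Finset.prod_const_one]

theorem sum_notMem_violatedClauses_div_card (hN : N ≠ 0) (x : Cube N) :
    (∑ c, if c ∉ violatedClauses k x then (1 : ℝ) else 0) / Fintype.card (Fin k → Literal N) =
      1 - (1 / 2) ^ k := by
  have hcard : (Finset.univ.filter fun c => c ∉ violatedClauses k x) = (violatedClauses k x)ᶜ := by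
    ext; simp
  have : (N : ℝ) ≠ 0 := by exact_mod_cast hN
  rw [Finset.sum_boole, hcard, Finset.card_compl, Nat.cast_sub (Finset.card_le_univ _),
    card_violatedClauses, card_clause]
  field_simp
  push_cast
  rw [mul_sub, mul_one, ← mul_pow, ← mul_pow]
  ring

theorem noise_mulVec_satisfies_le (hN : N ≠ 0) {ρ : ℝ} (h0 : 0 ≤ ρ) (h1 : ρ ≤ 1) (x : Cube N)
    (y : ClauseSeq N M k) :
    (noise (Fin M) (Fin k → Literal N) ρ *ᵥ
      fun y => if Satisfies x (Function.uncurry y) then 1 else 0) y ≤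
        (1 - (1 - ρ) * (1 / 2) ^ k) ^ M := by
  have hk : (1 / 2 : ℝ) ^ k ≤ 1 := pow_le_one₀ (by norm_num) (by norm_num)
  have hclause (c : Fin k → Literal N) :
      (resample (Fin k → Literal N) ρ *ᵥ fun c => if c ∉ violatedClauses k x then 1 else 0) c =
        ρ * (if c ∉ violatedClauses k x then 1 else 0) + (1 - ρ) * (1 - (1 / 2) ^ k) := by
    rw [resample_mulVec, sum_notMem_violatedClauses_div_card hN]
  simp only [ite_satisfies_eq_prod]
  rw [noise, piKernel_mulVec_prod _ fun _ c => if c ∉ violatedClauses k x then (1 : ℝ) else 0]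
  simp only [hclause]
  refine (Finset.prod_le_prod (g := fun _ => 1 - (1 - ρ) * (1 / 2) ^ k) (fun a _ => ?_)
    fun a _ => ?_).trans_eq (by simp)
  · have := mul_nonneg (sub_nonneg.2 h1) (sub_nonneg.2 hk)
    split_ifs <;> linarith
  · split_ifs <;> linarith

/-- The number of assignments that satisfy `y` and whose entropy conditional on the partition `p`
is at most `b`. -/
def lowEntropyCount (p : Fin N → Fin (m + 1) → ℤˣ) (b : ℝ) (y : ClauseSeq N M k) : ℕ :=
  (Finset.univ.filter fun x => condEntropy p x ≤ b ∧ Satisfies x (Function.uncurry y)).card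

theorem instExp_lowEntropyCount_le (hN : N ≠ 0) {ρ : ℝ} (h0 : 0 ≤ ρ) (h1 : ρ ≤ 1) (b : ℝ)
    {s n T : ℕ} (hT : s + n ≤ T) {p : (ℕ → ClauseSeq N M k) → Fin N → Fin (m + 1) → ℤˣ}
    (hp : DependsOn p (Set.Iic s)) :
    instExp N M k ρ T (fun y => (lowEntropyCount (p y) b (y (s + n)) : ℝ)) ≤
      lowEntropyBound N m b * (1 - (1 - ρ ^ n) * (1 / 2) ^ k) ^ M := by
  have : NeZero N := ⟨hN⟩
  have hρ0 : 0 ≤ ρ ^ n := pow_nonneg h0 n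
  have hρ1 : ρ ^ n ≤ 1 := pow_le_one₀ h0 h1
  have hk : (1 / 2 : ℝ) ^ k ≤ 1 := pow_le_one₀ (by norm_num) (by norm_num)
  set q : ℝ := (1 - (1 - ρ ^ n) * (1 / 2) ^ k) ^ M
  have hq0 : 0 ≤ q := pow_nonneg (by nlinarith [pow_pos (one_half_pos (α := ℝ)) k]) M
  let low (x : Cube N) (y : ℕ → ClauseSeq N M k) : ℝ := if condEntropy (p y) x ≤ b then 1 else 0
  have hlow (x : Cube N) : DependsOn (low x) (Set.Iic s) := fun y y' hy => by
    simp only [low, hp hy]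
  have hcount (y : ℕ → ClauseSeq N M k) : (lowEntropyCount (p y) b (y (s + n)) : ℝ) =
      ∑ x, low x y * if Satisfies x (Function.uncurry (y (s + n))) then 1 else 0 := by
    simp only [lowEntropyCount, low, ite_zero_mul_ite_zero, mul_one, Finset.sum_boole]
  calc instExp N M k ρ T (fun y => (lowEntropyCount (p y) b (y (s + n)) : ℝ))
      = instExp N M k ρ T (fun y => ∑ x, low x y * (noise (Fin M) (Fin k → Literal N) (ρ ^ n) *ᵥ
          fun y => if Satisfies x (Function.uncurry y) then 1 else 0) (y s)) := by
        simp only [hcount, instExp, pathExp_sum]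
        exact Finset.sum_congr rfl fun x _ => by
          rw [← noise_pow, pathExp_mul_eval_add (sum_noise ρ) hT (hlow x)
            fun y => if Satisfies x (Function.uncurry y) then 1 else 0]
    _ ≤ instExp N M k ρ T (fun _ => lowEntropyBound N m b * q) := instExp_mono h0 h1 T fun y => by
        calc _ ≤ ∑ x, low x y * q := Finset.sum_le_sum fun x _ =>
              mul_le_mul_of_nonneg_left (noise_mulVec_satisfies_le hN hρ0 hρ1 x _)
                (by dsimp only [low]; split_ifs <;> norm_num)
          _ = (Finset.univ.filter fun x => condEntropy (p y) x ≤ b).card * q := by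
              rw [← Finset.sum_mul, Finset.sum_boole]
          _ ≤ _ := mul_le_mul_of_nonneg_right (card_condEntropy_le_lowEntropyBound _ b) hq0
    _ = lowEntropyBound N m b * q := instExp_const hN ρ T _

/-- The number of sequences of assignments `X i` that satisfy `y i` and whose successive conditional
entropies lie in `[b', b]`. -/
def sequenceCount (b' b : ℝ) (y : Fin (m + 1) → ClauseSeq N M k) : ℕ :=
  (Finset.univ.filter fun X : Fin (m + 1) → Cube N =>
    (∀ i, i ≠ 0 → condEntropy (pattern X i) (X i) ∈ Set.Icc b' b) ∧
      ∀ i, Satisfies (X i) (Function.uncurry (y i))).card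

/-- The exponential rate, per clause, at which the probability decays that a sequence of `m + 1`
assignments of successive conditional entropies at least `b` satisfies a chain of instances. -/
def decayRate (k m : ℕ) (l L b : ℝ) : ℝ :=
  m * (1 / 2) ^ k * (1 - overlapBound k m l L b - m * (1 / 2) ^ k)

theorem instExp_forall_satisfies_le (hN : N ≠ 0) (hk : k ≠ 0) {ρ : ℝ} (h0 : 0 ≤ ρ) (h1 : ρ ≤ 1)
    {l L b : ℝ} (hl : 0 ≤ l) (hL : 1 ≤ L) {τ : Fin (m + 1) → ℕ} (hτ : Monotone τ) {T : ℕ}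
    (hT : ∀ i, τ i ≤ T) {X : Fin (m + 1) → Cube N}
    (hX : ∀ i, i ≠ 0 → b ≤ condEntropy (pattern X i) (X i)) :
    instExp N M k ρ T
      (fun y => if ∀ i, Satisfies (X i) (Function.uncurry (y (τ i))) then 1 else 0) ≤
        Real.exp (-(M * decayRate k m l L b)) := by
  let avoid (z : ℕ → Fin k → Literal N) : ℝ :=
    if ∀ i, z (τ i) ∉ violatedClauses k (X i) then 1 else 0
  have hprod (y : ℕ → ClauseSeq N M k) :
      (if ∀ i, Satisfies (X i) (Function.uncurry (y (τ i))) then (1 : ℝ) else 0) =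
        ∏ a, avoid fun t => y t a := by
    simp only [avoid, Finset.prod_ite_zero, Finset.prod_const_one, satisfies_uncurry_iff,
      Finset.mem_univ, true_imp_iff]
    exact if_congr forall_comm rfl rfl
  have hclause := (pathExp_clause_le hN h0 h1 X hτ hT fun i hi =>
    card_violatedClauses_inter_earlier_le hk X i hl hL (hX i hi)).trans
      (show _ ≤ Real.exp (-decayRate k m l L b) by
        linarith [Real.add_one_le_exp (-decayRate k m l L b),
          show decayRate k m l L b =
            m * (1 / 2) ^ k * (1 - overlapBound k m l L b - m * (1 / 2) ^ k) from rfl])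
  have hnonneg : 0 ≤ pathExp (fun _ => (Fintype.card (Fin k → Literal N) : ℝ)⁻¹)
      (resample (Fin k → Literal N) ρ) T avoid := by
    have h := pathExp_mono (π := fun _ => (Fintype.card (Fin k → Literal N) : ℝ)⁻¹)
      (K := resample (Fin k → Literal N) ρ) (fun _ => by positivity) (resample_nonneg h0 h1) T
      (F := fun _ => 0 * 1) (G := avoid) fun z => by dsimp only [avoid]; split_ifs <;> norm_num
    rwa [pathExp_const_mul, zero_mul] at h
  simp only [hprod]
  rw [instExp, noise, pathExp_pi (ι := Fin M) (fun _ => (Fintype.card (Fin k → Literal N) : ℝ)⁻¹)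
    (resample (Fin k → Literal N) ρ) T fun _ => avoid, Finset.prod_const, Finset.card_univ,
    Fintype.card_fin, ← mul_neg, Real.exp_nat_mul]
  exact pow_le_pow_left₀ hnonneg hclause M

theorem instExp_sequenceCount_le (hN : N ≠ 0) (hk : k ≠ 0) {ρ : ℝ} (h0 : 0 ≤ ρ) (h1 : ρ ≤ 1)
    {l L b' b : ℝ} (hl : 0 ≤ l) (hL : 1 ≤ L) {τ : Fin (m + 1) → ℕ} (hτ : Monotone τ) {T : ℕ}
    (hT : ∀ i, τ i ≤ T) :
    instExp N M k ρ T (fun y => (sequenceCount b' b fun i => y (τ i) : ℝ)) ≤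
      2 ^ N * lowEntropyBound N m b ^ m * Real.exp (-(M * decayRate k m l L b')) := by
  let W : Finset (Fin (m + 1) → Cube N) := Finset.univ.filter fun X =>
    ∀ i, i ≠ 0 → condEntropy (pattern X i) (X i) ∈ Set.Icc b' b
  have hW {X : Fin (m + 1) → Cube N} (hX : X ∈ W) (i : Fin (m + 1)) (hi : i ≠ 0) :
      condEntropy (pattern X i) (X i) ∈ Set.Icc b' b := (Finset.mem_filter.1 hX).2 i hi
  have hcard : (W.card : ℝ) ≤ 2 ^ N * lowEntropyBound N m b ^ m :=
    le_trans (Nat.cast_le.2 (Finset.card_le_card fun X hX =>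
      Finset.mem_filter.2 ⟨Finset.mem_univ X, fun i hi => (hW hX i hi).2⟩))
      (card_sequences_le N m b)
  have hcount (y : ℕ → ClauseSeq N M k) : (sequenceCount b' b fun i => y (τ i) : ℝ) =
      ∑ X ∈ W, if ∀ i, Satisfies (X i) (Function.uncurry (y (τ i))) then 1 else 0 := by
    rw [Finset.sum_boole, sequenceCount, Finset.filter_filter]
  calc instExp N M k ρ T (fun y => (sequenceCount b' b fun i => y (τ i) : ℝ))
      = ∑ X ∈ W, instExp N M k ρ T
          (fun y => if ∀ i, Satisfies (X i) (Function.uncurry (y (τ i))) then 1 else 0) := by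
        simp only [hcount, instExp, pathExp_sum]
    _ ≤ W.card * Real.exp (-(M * decayRate k m l L b')) := by
        rw [← nsmul_eq_mul, ← Finset.sum_const]
        exact Finset.sum_le_sum fun X hX =>
          instExp_forall_satisfies_le hN hk h0 h1 hl hL hτ hT fun i hi => (hW hX i hi).1
    _ ≤ _ := mul_le_mul_of_nonneg_right hcard (Real.exp_nonneg _)

end Path

/-! ### Stable assignment rules along the resampling chain -/

section Stable

variable {N M k m : ℕ}

/-- The indicator that the rule `f` satisfies both of two instances, by assignments at Hamming
distance at most `η N`. -/
def stablePair (f : ClauseSeq N M k → Cube N) (η : ℝ) :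
    Matrix (ClauseSeq N M k) (ClauseSeq N M k) ℝ :=
  fun y y' => if Satisfies (f y) (Function.uncurry y) ∧ Satisfies (f y') (Function.uncurry y') ∧
    (hammingDist (f y) (f y') : ℝ) ≤ η * N then 1 else 0

theorem isSymm_stablePair (f : ClauseSeq N M k → Cube N) (η : ℝ) : (stablePair f η).IsSymm := by
  ext y y'
  simp only [Matrix.transpose_apply, stablePair, hammingDist_comm (f y') (f y)]
  exact if_congr (by tauto) rfl rfl

theorem pow_le_instExp_prod (hN : N ≠ 0) (ρ : ℝ) {w : Matrix (ClauseSeq N M k) (ClauseSeq N M k) ℝ}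
    (hw : w.IsSymm) {γ : ℝ} (hγ : 0 ≤ γ)
    (h : γ * Fintype.card (ClauseSeq N M k) ≤
      ∑ y, ∑ y', noise (Fin M) (Fin k → Literal N) ρ y y' * w y y') (n : ℕ) :
    γ ^ 2 ^ n ≤ instExp N M k ρ (2 ^ n)
      (fun y => ∏ t ∈ Finset.range (2 ^ n), w (y t) (y (t + 1))) := by
  have : NeZero N := ⟨hN⟩
  have hcard : (0 : ℝ) < Fintype.card (ClauseSeq N M k) := by exact_mod_cast Fintype.card_pos
  have hsymm : (noise (Fin M) (Fin k → Literal N) ρ ⊙ w).IsSymm := by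
    ext y y'
    simp only [Matrix.transpose_apply, Matrix.hadamard_apply, (isSymm_noise ρ).apply, hw.apply]
  have huniform : (fun _ : ClauseSeq N M k =>
      ∏ _a : Fin M, (Fintype.card (Fin k → Literal N) : ℝ)⁻¹) =
        (Fintype.card (ClauseSeq N M k) : ℝ)⁻¹ • 1 := by
    ext y
    simp [Fintype.card_fun (α := Fin M)]
  have hpairs := pathExp_prod_pairs (π := fun _ : ClauseSeq N M k =>
    ∏ _a : Fin M, (Fintype.card (Fin k → Literal N) : ℝ)⁻¹)
    (K := noise (Fin M) (Fin k → Literal N) ρ) w (2 ^ n) 1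
  simp only [Pi.one_apply, mul_one] at hpairs
  rw [instExp, hpairs, huniform, smul_dotProduct, smul_eq_mul, inv_mul_eq_div, le_div_iff₀ hcard]
  exact pow_two_pow_mul_card_le hsymm hγ
    (by simpa [dotProduct, Matrix.mulVec, Matrix.hadamard_apply] using h) n

open Classical in
/-- The monotone sequences of `m + 1` times in `{0, …, T}`. -/
def monotoneTimes (m T : ℕ) : Finset (Fin (m + 1) → ℕ) :=
  (Fintype.piFinset fun _ => Finset.range (T + 1)).filter Monotone

theorem mem_monotoneTimes {T : ℕ} {τ : Fin (m + 1) → ℕ} :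
    τ ∈ monotoneTimes m T ↔ (∀ i, τ i ≤ T) ∧ Monotone τ := by
  simp [monotoneTimes]

theorem card_monotoneTimes_le (m T : ℕ) : (monotoneTimes m T).card ≤ (T + 1) ^ (m + 1) :=
  (Finset.card_filter_le _ _).trans_eq (by simp)

theorem satisfies_of_prod_stablePair_ne_zero {f : ClauseSeq N M k → Cube N} {η : ℝ} {T : ℕ}
    {y : ℕ → ClauseSeq N M k} (hT : T ≠ 0)
    (h : ∏ t ∈ Finset.range T, stablePair f η (y t) (y (t + 1)) ≠ 0) :
    (∀ t ≤ T, Satisfies (f (y t)) (Function.uncurry (y t))) ∧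
      ∀ t < T, (hammingDist (f (y t)) (f (y (t + 1))) : ℝ) ≤ η * N := by
  have hpair {t : ℕ} (ht : t < T) := (ite_ne_right_iff.1
    (Finset.prod_ne_zero_iff.1 h t (Finset.mem_range.2 ht))).1
  refine ⟨fun t ht => ?_, fun t ht => (hpair ht).2.2⟩
  rcases ht.lt_or_eq with ht | rfl
  · exact (hpair ht).1
  · obtain ⟨s, rfl⟩ := Nat.exists_eq_succ_of_ne_zero hT
    exact (hpair s.lt_succ_self).2.1

/-- Either some time step of length `T₀` ends at an assignment of small entropy relative to earlier
ones, or times with entropies in the window `[b', b]` can be chosen one after the other. -/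
theorem exists_lowEntropyCount_or_sequenceCount {f : ClauseSeq N M k → Cube N} {b' b η : ℝ}
    (hb : 0 ≤ b) {T T₀ : ℕ} (hT : m * T₀ ≤ T)
    (hη : ∀ (p : Fin N → Fin (m + 1) → ℤˣ) (x x' : Cube N), (hammingDist x x' : ℝ) ≤ η * N →
      condEntropy p x' - condEntropy p x ≤ b - b') {y : ℕ → ClauseSeq N M k}
    (hsat : ∀ t ≤ T, Satisfies (f (y t)) (Function.uncurry (y t)))
    (hstep : ∀ t < T, (hammingDist (f (y t)) (f (y (t + 1))) : ℝ) ≤ η * N) :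
    ∃ τ ∈ monotoneTimes m T,
      (∃ i : Fin m, τ i.castSucc + T₀ ≤ T ∧ 0 < lowEntropyCount
        (pattern (fun j => f (y (τ j))) i.succ) b (y (τ i.castSucc + T₀))) ∨
      0 < sequenceCount b' b fun i => y (τ i) := by
  by_cases hfar : ∀ τ ∈ monotoneTimes m T, ∀ i : Fin m, τ i.castSucc + T₀ ≤ T →
      b < condEntropy (pattern (fun j => f (y (τ j))) i.succ) (f (y (τ i.castSucc + T₀)))
  · obtain ⟨τ, hmono, hle, hwindow⟩ := exists_times (x := fun t => f (y t)) hb hη hstep hT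
      fun τ hτ hle => hfar τ (mem_monotoneTimes.2 ⟨hle, hτ⟩)
    exact ⟨τ, mem_monotoneTimes.2 ⟨hle, hmono⟩, .inr (Finset.card_pos.2 ⟨fun i => f (y (τ i)),
      Finset.mem_filter.2 ⟨Finset.mem_univ _, hwindow, fun i => hsat _ (hle i)⟩⟩)⟩
  · push Not at hfar
    obtain ⟨τ, hτ, i, hi, hlow⟩ := hfar
    exact ⟨τ, hτ, .inl ⟨i, hi, Finset.card_pos.2
      ⟨_, Finset.mem_filter.2 ⟨Finset.mem_univ _, hlow, hsat _ hi⟩⟩⟩⟩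

theorem prod_stablePair_le_sum (f : ClauseSeq N M k → Cube N) {b' b η : ℝ} (hb : 0 ≤ b) {T T₀ : ℕ}
    (hT : m * T₀ ≤ T) (hT0 : T ≠ 0)
    (hη : ∀ (p : Fin N → Fin (m + 1) → ℤˣ) (x x' : Cube N), (hammingDist x x' : ℝ) ≤ η * N →
      condEntropy p x' - condEntropy p x ≤ b - b') (y : ℕ → ClauseSeq N M k) :
    ∏ t ∈ Finset.range T, stablePair f η (y t) (y (t + 1)) ≤
      ∑ τ ∈ monotoneTimes m T,
        (∑ i : Fin m with τ i.castSucc + T₀ ≤ T, (lowEntropyCount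
            (pattern (fun j => f (y (τ j))) i.succ) b (y (τ i.castSucc + T₀)) : ℝ) +
          sequenceCount b' b fun i => y (τ i)) := by
  rcases eq_or_ne (∏ t ∈ Finset.range T, stablePair f η (y t) (y (t + 1))) 0 with h | h
  · rw [h]; positivity
  obtain ⟨hsat, hstep⟩ := satisfies_of_prod_stablePair_ne_zero hT0 h
  obtain ⟨τ, hτ, hpos⟩ := exists_lowEntropyCount_or_sequenceCount hb hT hη hsat hstep
  have hprod : ∏ t ∈ Finset.range T, stablePair f η (y t) (y (t + 1)) ≤ 1 :=
    Finset.prod_le_one (fun t _ => by unfold stablePair; split_ifs <;> norm_num)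
      fun t _ => by unfold stablePair; split_ifs <;> norm_num
  norm_cast
  refine hprod.trans (Nat.one_le_cast.2 (le_trans ?_
    (Finset.single_le_sum (fun _ _ => Nat.zero_le _) hτ)))
  rcases hpos with ⟨i, hi, hpos⟩ | hpos
  · exact hpos.trans_le ((Finset.single_le_sum
      (f := fun i : Fin m => lowEntropyCount (pattern (fun j => f (y (τ j))) i.succ) b
        (y (τ i.castSucc + T₀))) (fun _ _ => Nat.zero_le _)
      (Finset.mem_filter.2 ⟨Finset.mem_univ i, hi⟩)).trans (Nat.le_add_right _ _))
  · exact hpos.trans_le (Nat.le_add_left _ _)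

theorem instExp_prod_stablePair_le (hN : N ≠ 0) (hk : k ≠ 0) {ρ : ℝ} (h0 : 0 ≤ ρ) (h1 : ρ ≤ 1)
    (f : ClauseSeq N M k → Cube N) {l L b' b η : ℝ} (hl : 0 ≤ l) (hL : 1 ≤ L) (hb : 0 ≤ b)
    {T T₀ : ℕ} (hT : m * T₀ ≤ T) (hT0 : T ≠ 0)
    (hη : ∀ (p : Fin N → Fin (m + 1) → ℤˣ) (x x' : Cube N), (hammingDist x x' : ℝ) ≤ η * N →
      condEntropy p x' - condEntropy p x ≤ b - b') :
    instExp N M k ρ T (fun y => ∏ t ∈ Finset.range T, stablePair f η (y t) (y (t + 1))) ≤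
      (T + 1) ^ (m + 1) *
        (m * (lowEntropyBound N m b * (1 - (1 - ρ ^ T₀) * (1 / 2) ^ k) ^ M) +
          2 ^ N * lowEntropyBound N m b ^ m * Real.exp (-(M * decayRate k m l L b'))) := by
  set E₁ : ℝ := lowEntropyBound N m b * (1 - (1 - ρ ^ T₀) * (1 / 2) ^ k) ^ M
  set E₂ : ℝ := 2 ^ N * lowEntropyBound N m b ^ m * Real.exp (-(M * decayRate k m l L b'))
  have hE₁ : 0 ≤ E₁ := by
    have hk : (1 / 2 : ℝ) ^ k ≤ 1 := pow_le_one₀ (by norm_num) (by norm_num)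
    have hρk : (1 - ρ ^ T₀) * (1 / 2) ^ k ≤ 1 :=
      mul_le_one₀ (sub_le_self 1 (pow_nonneg h0 T₀)) (by positivity) hk
    exact mul_nonneg (lowEntropyBound_nonneg N m b) (pow_nonneg (sub_nonneg.2 hρk) M)
  have hE₂ : 0 ≤ E₂ := by
    have := lowEntropyBound_nonneg N m b
    positivity
  refine (instExp_mono h0 h1 T (prod_stablePair_le_sum f hb hT hT0 hη)).trans ?_
  have hbound : ∀ τ ∈ monotoneTimes m T, instExp N M k ρ T (fun y =>
      ∑ i : Fin m with τ i.castSucc + T₀ ≤ T, (lowEntropyCount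
          (pattern (fun j => f (y (τ j))) i.succ) b (y (τ i.castSucc + T₀)) : ℝ) +
        sequenceCount b' b fun i => y (τ i)) ≤ m * E₁ + E₂ := by
    intro τ hτ
    obtain ⟨hle, hmono⟩ := mem_monotoneTimes.1 hτ
    have hpast (i : Fin m) : DependsOn (fun y : ℕ → ClauseSeq N M k =>
        pattern (fun j => f (y (τ j))) i.succ) (Set.Iic (τ i.castSucc)) := fun y y' h =>
      pattern_congr fun j hj => congrArg f (h _ (hmono (Fin.le_castSucc_iff.2 hj)))
    rw [instExp, pathExp_add, pathExp_sum]
    refine add_le_add ?_ (instExp_sequenceCount_le hN hk h0 h1 hl hL hmono hle)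
    refine (Finset.sum_le_card_nsmul _ _ E₁ fun i hi => instExp_lowEntropyCount_le hN h0 h1 b
      (Finset.mem_filter.1 hi).2 (hpast i)).trans ?_
    rw [nsmul_eq_mul]
    refine mul_le_mul_of_nonneg_right (Nat.cast_le.2 ?_) hE₁
    exact (Finset.card_le_univ _).trans_eq (Fintype.card_fin m)
  rw [instExp, pathExp_sum]
  refine (Finset.sum_le_card_nsmul _ _ _ hbound).trans ?_
  rw [nsmul_eq_mul]
  exact mul_le_mul_of_nonneg_right (by exact_mod_cast card_monotoneTimes_le m T) (by positivity)

end Stable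

/-! ### Choice of parameters -/

section Parameters

theorem one_sub_mul_exp_pos {β : ℝ} (hβ : 1 < β) : 0 < 1 - β * Real.exp (-(β - 1)) := by
  have h := Real.add_one_lt_exp (sub_ne_zero.2 hβ.ne')
  rw [Real.exp_neg, sub_pos, ← div_eq_mul_inv, div_lt_one (Real.exp_pos _)]
  linarith

theorem exists_lt_mul_of_kappaStar_lt {κ : ℝ} (hκ : kappaStar < κ) :
    ∃ β, 1 < β ∧ β < κ * (1 - β * Real.exp (-(β - 1))) := by
  obtain ⟨_, ⟨β, hβ, rfl⟩, hβκ⟩ := exists_lt_of_csInf_lt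
    ((Set.nonempty_Ioi (a := (1 : ℝ))).image _) hκ
  exact ⟨β, hβ, (div_lt_iff₀ (one_sub_mul_exp_pos hβ)).1 hβκ⟩

/-- The exponent `x` in the estimate `overlapBound ≤ m / k + β e^{-x}` at the parameters of
`overlapBound_le`; there `e = k⁻ˢ`, and `s` is the slack left in them. -/
def overlapExponent (β s e : ℝ) : ℝ :=
  (1 - Real.exp (-((1 + s) * Real.log β))) / (1 + s) * ((1 - s) * β - 2 * (1 + s) * e)

theorem overlapExponent_zero_zero {β : ℝ} (hβ : 0 < β) : overlapExponent β 0 0 = β - 1 := by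
  simp only [overlapExponent, add_zero, one_mul, Real.exp_neg, Real.exp_log hβ]
  field_simp
  ring

theorem overlapExponent_le {β s e : ℝ} (hβ : 1 ≤ β) (hs : 0 ≤ s) (he : 0 ≤ e) :
    overlapExponent β s e ≤ β := by
  have hlog : 0 ≤ (1 + s) * Real.log β := mul_nonneg (by positivity) (Real.log_nonneg hβ)
  have hnonneg : 0 ≤ (1 - Real.exp (-((1 + s) * Real.log β))) / (1 + s) :=
    div_nonneg (sub_nonneg.2 (Real.exp_le_one_iff.2 (neg_nonpos.2 hlog))) (by positivity)
  have hle_one : (1 - Real.exp (-((1 + s) * Real.log β))) / (1 + s) ≤ 1 := by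
    rw [div_le_one (by positivity)]
    linarith [Real.exp_pos (-((1 + s) * Real.log β))]
  have hle : (1 - s) * β - 2 * (1 + s) * e ≤ β := by
    have : 0 ≤ 2 * (1 + s) * e := by positivity
    nlinarith
  calc overlapExponent β s e
      ≤ (1 - Real.exp (-((1 + s) * Real.log β))) / (1 + s) * β :=
        mul_le_mul_of_nonneg_left hle hnonneg
    _ ≤ β := mul_le_of_le_one_left (by positivity) hle_one

theorem exists_slack {κ β : ℝ} (hβ : 0 < β) (h : β < κ * (1 - β * Real.exp (-(β - 1)))) :
    ∃ s, 0 < s ∧ s < 1 ∧ β < κ * (1 - β * Real.exp (-overlapExponent β s 0)) := by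
  have hcont : ContinuousAt (fun s => κ * (1 - β * Real.exp (-overlapExponent β s 0))) 0 := by
    have : ContinuousAt (fun s => overlapExponent β s 0) 0 := by
      refine ContinuousAt.mul (ContinuousAt.div ?_ ?_ (by norm_num)) ?_ <;> fun_prop
    fun_prop
  have hgap : ∀ᶠ s in 𝓝 (0 : ℝ), β < κ * (1 - β * Real.exp (-overlapExponent β s 0)) :=
    hcont.eventually (lt_mem_nhds (by simpa only [overlapExponent_zero_zero hβ] using h))
  obtain ⟨s, hs, hs0, hs1⟩ := ((hgap.filter_mono nhdsWithin_le_nhds).and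
    (Ioo_mem_nhdsGT (zero_lt_one' ℝ))).exists
  exact ⟨s, hs0, hs1, hs⟩

theorem tendsto_overlapExponent (β : ℝ) {s : ℝ} (hs : 0 < s) :
    Tendsto (fun k : ℕ => overlapExponent β s ((k : ℝ) ^ (-s))) atTop
      (𝓝 (overlapExponent β s 0)) :=
  ((((tendsto_rpow_neg_atTop hs).comp tendsto_natCast_atTop_atTop).const_mul _).const_sub
    _).const_mul _

theorem tendsto_log_natCast_atTop : Tendsto (fun k : ℕ => Real.log k) atTop atTop :=
  Real.tendsto_log_atTop.comp tendsto_natCast_atTop_atTop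

theorem tendsto_ceil_mul_div_log_div {c : ℝ} (hc : 0 ≤ c) :
    Tendsto (fun k : ℕ => (⌈c * (k / Real.log k)⌉₊ : ℝ) / k) atTop (𝓝 0) := by
  have hlim : Tendsto (fun k : ℕ => c * (Real.log k)⁻¹ + (k : ℝ)⁻¹) atTop (𝓝 0) := by
    simpa using ((tendsto_inv_atTop_zero.comp tendsto_log_natCast_atTop).const_mul c).add
      (tendsto_inv_atTop_zero.comp tendsto_natCast_atTop_atTop)
  refine squeeze_zero' (Eventually.of_forall fun k => by positivity) ?_ hlim
  filter_upwards [tendsto_log_natCast_atTop.eventually_gt_atTop 0, eventually_gt_atTop 0]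
    with k hlog hk
  rw [div_le_iff₀ (Nat.cast_pos.2 hk)]
  refine (Nat.ceil_lt_add_one (by positivity)).le.trans (le_of_eq ?_)
  field_simp

theorem tendsto_mul_half_pow {m : ℕ → ℝ} (hm : Tendsto (fun k => m k / k) atTop (𝓝 0)) :
    Tendsto (fun k => m k * (1 / 2) ^ k) atTop (𝓝 0) := by
  have hpow : Tendsto (fun k : ℕ => (k : ℝ) * (1 / 2) ^ k) atTop (𝓝 0) :=
    tendsto_self_mul_const_pow_of_lt_one (by norm_num) (by norm_num)
  have hmul := hm.mul hpow
  rw [mul_zero] at hmul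
  refine hmul.congr' ?_
  filter_upwards [eventually_ne_atTop 0] with k hk
  field_simp

theorem overlapBound_le {k : ℕ} (m : ℕ) {β s : ℝ} (hβ : 1 < β) (hs : 0 < s) (hk : β ≤ k) :
    overlapBound k m (Real.log β / Real.log k) ((1 + s) * Real.log k)
        ((1 - s) * (β * Real.log k / k)) ≤
      m / k + β * Real.exp (-overlapExponent β s ((k : ℝ) ^ (-s))) := by
  have hk0 : (0 : ℝ) < k := by linarith
  have hlog : 0 < Real.log k := Real.log_pos (hβ.trans_le hk)
  have hrpow : (k : ℝ) ^ (Real.log β / Real.log k) = β := by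
    rw [Real.rpow_def_of_pos hk0, mul_div_cancel₀ _ hlog.ne', Real.exp_log (by positivity)]
  have hlL : Real.log β / Real.log k * ((1 + s) * Real.log k) = (1 + s) * Real.log β := by
    field_simp
  have hexp : Real.exp (-((1 + s) * Real.log k)) = (k : ℝ) ^ (-s) / k := by
    rw [← Real.rpow_sub_one hk0.ne', Real.rpow_def_of_pos hk0]
    ring_nf
  have hbase : (1 : ℝ) - (1 - Real.exp (-((1 + s) * Real.log β))) / ((1 + s) * Real.log k) *
      ((1 - s) * (β * Real.log k / k) - 2 * ((1 + s) * Real.log k * ((k : ℝ) ^ (-s) / k))) =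
      1 + -overlapExponent β s ((k : ℝ) ^ (-s)) / k := by
    rw [overlapExponent]
    field_simp
    ring
  rw [overlapBound, hrpow, hlL, hexp, hbase]
  gcongr
  refine one_add_div_pow_le_exp k (Nat.cast_pos.1 hk0).ne' _ ?_
  rw [neg_div, ← sub_eq_add_neg, sub_nonneg, div_le_one hk0]
  exact (overlapExponent_le hβ.le hs.le (by positivity)).trans hk

theorem eventually_gap_lt {κ β s g : ℝ} {m : ℕ → ℝ}
    (hm : Tendsto (fun k => m k / k) atTop (𝓝 0)) (hs : 0 < s)
    (hg : g < κ * (1 - β * Real.exp (-overlapExponent β s 0)) - β) :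
    ∀ᶠ k : ℕ in atTop, g < κ * (1 - (m k / k +
      β * Real.exp (-overlapExponent β s ((k : ℝ) ^ (-s)))) - m k * (1 / 2) ^ k) - β := by
  have hexp := (Real.continuous_exp.tendsto _).comp (tendsto_overlapExponent β hs).neg
  have hlim := ((((hm.add (hexp.const_mul β)).const_sub 1).sub
    (tendsto_mul_half_pow hm)).const_mul κ).sub_const β
  simp only [zero_add, sub_zero] at hlim
  exact hlim.eventually (lt_mem_nhds hg)

theorem log_two_add_lt_mul_decayRate {k m : ℕ} {κ β s g : ℝ} (hκ : 0 ≤ κ) (hβ : 1 < β) (hs : 0 < s)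
    (hg : 0 < g) (hk : β ≤ k) (hm : 1 / g ≤ m * (Real.log k / k))
    (hgap : g < κ * (1 - (m / k + β * Real.exp (-overlapExponent β s ((k : ℝ) ^ (-s)))) -
      m * (1 / 2) ^ k) - β) :
    Real.log 2 + m * (β * Real.log k / k) < κ * 2 ^ k * Real.log k / k *
      decayRate k m (Real.log β / Real.log k) ((1 + s) * Real.log k)
        ((1 - s) * (β * Real.log k / k)) := by
  have hk0 : (0 : ℝ) < k := by linarith
  have hoverlap := overlapBound_le m hβ hs hk
  rw [decayRate]
  set Q := overlapBound k m (Real.log β / Real.log k) ((1 + s) * Real.log k)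
    ((1 - s) * (β * Real.log k / k))
  have hgap' : g < κ * (1 - Q - m * (1 / 2) ^ k) - β := by
    refine hgap.trans_le ?_
    gcongr
  have hrate : κ * 2 ^ k * Real.log k / k * (m * (1 / 2) ^ k * (1 - Q - m * (1 / 2) ^ k)) =
      m * (Real.log k / k) * (κ * (1 - Q - m * (1 / 2) ^ k)) := by
    rw [one_div, inv_pow]
    field_simp
  have hone : 1 ≤ m * (Real.log k / k) * (κ * (1 - Q - m * (1 / 2) ^ k) - β) :=
    calc (1 : ℝ) = 1 / g * g := by field_simp
      _ ≤ _ := mul_le_mul hm hgap'.le hg.le ((by positivity : 0 ≤ 1 / g).trans hm)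
  linear_combination hone - hrate + Real.log_two_lt_d9

theorem exists_parameters {κ : ℝ} (hκ : kappaStar < κ) : ∃ k₀ : ℕ, ∀ k : ℕ, k₀ ≤ k →
    ∃ (m : ℕ) (l L b' b : ℝ), k ≠ 0 ∧ 0 ≤ l ∧ 1 ≤ L ∧ b' < b ∧ 0 ≤ b ∧
      b < κ * 2 ^ k * Real.log k / k * (1 / 2) ^ k ∧
      Real.log 2 + m * b < κ * 2 ^ k * Real.log k / k * decayRate k m l L b' := by
  obtain ⟨β, hβ, hβκ⟩ := exists_lt_mul_of_kappaStar_lt hκ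
  have hκ0 : 0 < κ := pos_of_mul_pos_left (by linarith) (one_sub_mul_exp_pos hβ).le
  have hβκ' : β < κ := hβκ.trans_le
    (mul_le_of_le_one_right hκ0.le (sub_le_self _ (by positivity)))
  obtain ⟨s, hs0, hs1, hs⟩ := exists_slack (by positivity) hβκ
  obtain ⟨g, hg0, hg⟩ := exists_between (sub_pos.2 hs)
  have hgap := eventually_gap_lt (tendsto_ceil_mul_div_log_div (c := 1 / g) (by positivity)) hs0 hg
  obtain ⟨k₀, hk₀⟩ := eventually_atTop.1 (hgap.and
    ((tendsto_log_natCast_atTop.eventually_ge_atTop 1).and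
      (tendsto_natCast_atTop_atTop.eventually_ge_atTop β)))
  refine ⟨k₀, fun k hk => ?_⟩
  obtain ⟨hgk, hlog, hkβ⟩ := hk₀ k hk
  have hk0 : (0 : ℝ) < k := by linarith
  have hlogβ : 0 < Real.log β := Real.log_pos hβ
  have hb0 : 0 < β * Real.log k / k := by positivity
  have hα : κ * 2 ^ k * Real.log k / k * (1 / 2) ^ k = κ * Real.log k / k := by
    rw [one_div, inv_pow]
    field_simp
  have hm : 1 / g ≤ ⌈1 / g * (k / Real.log k)⌉₊ * (Real.log k / k) := by
    rw [← div_le_iff₀ (by positivity), div_div_eq_mul_div, mul_div_assoc]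
    exact Nat.le_ceil _
  refine ⟨⌈1 / g * (k / Real.log k)⌉₊, Real.log β / Real.log k, (1 + s) * Real.log k,
    (1 - s) * (β * Real.log k / k), β * Real.log k / k, (Nat.cast_pos.1 hk0).ne', by positivity,
    by nlinarith, by nlinarith, hb0.le, ?_,
    log_two_add_lt_mul_decayRate hκ0.le hβ hs0 hg0 hkβ hm hgk⟩
  rw [hα]
  gcongr

end Parameters

/-! ### Laws of the instance and of the thresholds -/

section Laws

variable {N M k : ℕ}

instance : MeasurableSingletonClass ℤˣ :=
  ⟨fun u => ⟨{(u : ℤ)}, measurableSet_singleton _, by ext; simp [Units.ext_iff]⟩⟩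

instance : IsProbabilityMeasure (cond volume (Set.Icc (-1 : ℝ) 1)) :=
  cond_isProbabilityMeasure_of_finite (by simp [Real.volume_Icc]) (by simp [Real.volume_Icc])

instance (N : ℕ) : IsProbabilityMeasure (thresholdLaw N) := by
  unfold thresholdLaw
  infer_instance

instance (N M k : ℕ) : IsFiniteMeasure (instanceLaw N M k) := by
  unfold instanceLaw
  infer_instance

theorem instanceLaw_singleton (y : Instance N M k) :
    instanceLaw N M k {y} = (Fintype.card (Instance N M k) : ℝ≥0∞)⁻¹ := by
  rw [instanceLaw, Measure.pi_singleton]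
  simp only [uniformOn_univ, Measure.count_singleton, one_div, Finset.prod_const]
  rw [Fintype.card_fun, Nat.cast_pow, ENNReal.inv_pow, Finset.card_univ]

theorem lintegral_instanceLaw (f : Instance N M k → ℝ≥0∞) :
    ∫⁻ y, f y ∂(instanceLaw N M k) =
      (∑ y : ClauseSeq N M k, f (Function.uncurry y)) *
        (Fintype.card (ClauseSeq N M k) : ℝ≥0∞)⁻¹ := by
  rw [lintegral_fintype, Finset.sum_mul, ← (Equiv.curry (Fin M) (Fin k) (Literal N)).symm.sum_comp]
  refine Finset.sum_congr rfl fun y _ => ?_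
  rw [instanceLaw_singleton, Fintype.card_congr (Equiv.curry (Fin M) (Fin k) (Literal N))]
  rfl

theorem cond_Icc_uIoc_le (a b : ℝ) :
    cond volume (Set.Icc (-1 : ℝ) 1) (Set.uIoc a b) ≤ ENNReal.ofReal |a - b| := by
  rw [cond_apply measurableSet_Icc, Real.volume_Icc, abs_sub_comm, ← Real.volume_uIoc]
  refine mul_le_of_le_one_of_le ?_ (measure_mono Set.inter_subset_right)
  rw [ENNReal.inv_le_one, ENNReal.one_le_ofReal]
  norm_num

theorem thresholdLaw_separates_le (i : Fin N) (a b : ℝ) :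
    thresholdLaw N {u | ¬ (u i ≤ a ↔ u i ≤ b)} ≤ ENNReal.ofReal |a - b| := by
  have hset : {u : Fin N → ℝ | ¬ (u i ≤ a ↔ u i ≤ b)} = Function.eval i ⁻¹' Set.uIoc a b := by
    ext u
    simp only [Set.mem_ofPred_eq, Set.mem_preimage, Function.eval, Set.mem_uIoc, ← not_le]
    tauto
  rw [hset, thresholdLaw,
    (measurePreserving_eval _ i).measure_preimage measurableSet_uIoc.nullMeasurableSet]
  exact cond_Icc_uIoc_le a b

end Laws

/-! ### Fixing the internal randomness -/

section Derandomize

variable {N M k : ℕ} {W : Type*} [MeasurableSpace W]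

theorem exists_sq_integral_sub_le (Q : Measure W) [IsProbabilityMeasure Q] {X Y : W → ℝ}
    (hX : MemLp X 2 Q) (hY : Integrable Y Q) {a : ℝ} (ha : 0 ≤ a) :
    ∃ w, a * (∫ w, X w ∂Q) ^ 2 - ∫ w, Y w ∂Q ≤ a * X w ^ 2 - Y w := by
  have hjensen : (∫ w, X w ∂Q) ^ 2 ≤ ∫ w, X w ^ 2 ∂Q := by
    simpa [variance_eq_sub hX] using variance_nonneg X Q
  obtain ⟨w, hw⟩ := exists_integral_le ((hX.integrable_sq.const_mul a).sub hY)
  refine ⟨w, le_trans ?_ hw⟩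
  rw [integral_sub' (hX.integrable_sq.const_mul a) hY, integral_const_mul]
  gcongr

theorem integral_ite {Q : Measure W} {p : W → Prop} [DecidablePred p]
    (hp : MeasurableSet {w | p w}) :
    ∫ w, (if p w then (1 : ℝ) else 0) ∂Q = Q.real {w | p w} := by
  rw [← integral_indicator_one hp]
  exact integral_congr_ae (.of_forall fun w => by by_cases h : p w <;> simp [h])

theorem integral_hammingDist {ι α : Type*} [Fintype ι] [DecidableEq α] (Q : Measure W)
    [IsFiniteMeasure Q] {x x' : W → ι → α} (h : ∀ i, MeasurableSet {w | x w i ≠ x' w i}) :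
    ∫ w, (hammingDist (x w) (x' w) : ℝ) ∂Q = ∑ i, Q.real {w | x w i ≠ x' w i} := by
  simp only [hammingDist, ← Finset.sum_boole]
  rw [integral_finsetSum]
  · exact Finset.sum_congr rfl fun i _ => integral_ite (h i)
  · intro i _
    refine ((integrable_const (1 : ℝ)).indicator (h i)).congr (.of_forall fun w => ?_)
    by_cases hw : x w i = x' w i <;> simp [hw]

theorem sub_le_stablePair (f : ClauseSeq N M k → Cube N) {η : ℝ} (hη : 0 < η)
    (hN : N ≠ 0) (y y' : ClauseSeq N M k) :
    (if Satisfies (f y) (Function.uncurry y) then (1 : ℝ) else 0) *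
        (if Satisfies (f y') (Function.uncurry y') then 1 else 0) -
      hammingDist (f y) (f y') / (η * N) ≤ stablePair f η y y' := by
  have hdist : (0 : ℝ) ≤ hammingDist (f y) (f y') / (η * N) := by positivity
  rw [ite_zero_mul_ite_zero, stablePair, mul_one]
  by_cases hsat : Satisfies (f y) (Function.uncurry y) ∧ Satisfies (f y') (Function.uncurry y')
  · by_cases hclose : (hammingDist (f y) (f y') : ℝ) ≤ η * N
    · rw [if_pos hsat, if_pos ⟨hsat.1, hsat.2, hclose⟩]
      linarith
    · have hfar : 1 < (hammingDist (f y) (f y') : ℝ) / (η * N) := by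
        rwa [one_lt_div (by positivity), ← not_le]
      rw [if_pos hsat, if_neg fun h => hclose h.2.2]
      linarith
  · rw [if_neg hsat, if_neg fun h => hsat ⟨h.1, h.2.1⟩]
    linarith

theorem sq_sum_satisfies_sub_le (hN : N ≠ 0) {ρ : ℝ} (h0 : 0 ≤ ρ) (h1 : ρ ≤ 1) {η : ℝ} (hη : 0 < η)
    (f : ClauseSeq N M k → Cube N) :
    (Fintype.card (ClauseSeq N M k) : ℝ)⁻¹ *
        (∑ y, if Satisfies (f y) (Function.uncurry y) then 1 else 0) ^ 2 -
      (∑ y, ∑ y', noise (Fin M) (Fin k → Literal N) ρ y y' * hammingDist (f y) (f y')) / (η * N) ≤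
      ∑ y, ∑ y', noise (Fin M) (Fin k → Literal N) ρ y y' * stablePair f η y y' := by
  have : NeZero N := ⟨hN⟩
  set v : ClauseSeq N M k → ℝ := fun y => if Satisfies (f y) (Function.uncurry y) then 1 else 0
  have hv : v ⬝ᵥ noise (Fin M) (Fin k → Literal N) ρ *ᵥ v =
      ∑ y, ∑ y', noise (Fin M) (Fin k → Literal N) ρ y y' * (v y * v y') := by
    simp only [dotProduct, Matrix.mulVec, Finset.mul_sum, mul_left_comm]
  have hsq := sq_sum_le_card_mul_noise h0 v
  rw [hv, ← inv_mul_le_iff₀ (Nat.cast_pos.2 Fintype.card_pos)] at hsq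
  calc _ ≤ (∑ y, ∑ y', noise (Fin M) (Fin k → Literal N) ρ y y' * (v y * v y')) -
        (∑ y, ∑ y', noise (Fin M) (Fin k → Literal N) ρ y y' * hammingDist (f y) (f y')) /
          (η * N) := sub_le_sub_right hsq _
    _ = ∑ y, ∑ y', noise (Fin M) (Fin k → Literal N) ρ y y' *
          (v y * v y' - hammingDist (f y) (f y') / (η * N)) := by
        simp only [Finset.sum_div, ← Finset.sum_sub_distrib, mul_sub, mul_div_assoc]
    _ ≤ _ := Finset.sum_le_sum fun y _ => Finset.sum_le_sum fun y' _ =>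
        mul_le_mul_of_nonneg_left (sub_le_stablePair f hη hN y y') (noise_nonneg h0 h1 y y')

theorem exists_stable_realization (hN : N ≠ 0) (Q : Measure W) [IsProbabilityMeasure Q]
    {ρ : ℝ} (h0 : 0 ≤ ρ) (h1 : ρ ≤ 1) {η : ℝ} (hη : 0 < η)
    {F : W → ClauseSeq N M k → Cube N} (hF : Measurable F) {p R : ℝ}
    (hp : ∑ y, Q.real {w | Satisfies (F w y) (Function.uncurry y)} =
      Fintype.card (ClauseSeq N M k) * p)
    (hR : ∑ y, ∑ y', noise (Fin M) (Fin k → Literal N) ρ y y' *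
      ∫ w, (hammingDist (F w y) (F w y') : ℝ) ∂Q ≤ Fintype.card (ClauseSeq N M k) * (N * R)) :
    ∃ w, (p ^ 2 - R / η) * Fintype.card (ClauseSeq N M k) ≤
      ∑ y, ∑ y', noise (Fin M) (Fin k → Literal N) ρ y y' * stablePair (F w) η y y' := by
  have : NeZero N := ⟨hN⟩
  set c : ℝ := (Fintype.card (ClauseSeq N M k) : ℝ)
  have hc : 0 < c := Nat.cast_pos.2 Fintype.card_pos
  have hint (h : (ClauseSeq N M k → Cube N) → ℝ) : Integrable (fun w => h (F w)) Q :=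
    Integrable.of_finite.comp_measurable hF
  let S : (ClauseSeq N M k → Cube N) → ℝ := fun x =>
    ∑ y, if Satisfies (x y) (Function.uncurry y) then 1 else 0
  let H : (ClauseSeq N M k → Cube N) → ℝ := fun x =>
    (∑ y, ∑ y', noise (Fin M) (Fin k → Literal N) ρ y y' * hammingDist (x y) (x y')) / (η * N)
  have hS : ∫ w, S (F w) ∂Q = c * p := by
    rw [integral_finsetSum _ fun y _ =>
      hint fun x => if Satisfies (x y) (Function.uncurry y) then (1 : ℝ) else 0, ← hp]
    exact Finset.sum_congr rfl fun y _ => integral_ite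
      (hF (Set.toFinite {x | Satisfies (x y) (Function.uncurry y)}).measurableSet :)
  have hH : ∫ w, H (F w) ∂Q ≤ R / η * c := by
    have hintd (y y') : Integrable (fun w => noise (Fin M) (Fin k → Literal N) ρ y y' *
        (hammingDist (F w y) (F w y') : ℝ)) Q :=
      (hint fun x => (hammingDist (x y) (x y') : ℝ)).const_mul _
    rw [integral_div, integral_finsetSum _ fun y _ => integrable_finsetSum _ fun y' _ => hintd y y']
    simp_rw [integral_finsetSum _ fun y' _ => hintd _ y', integral_const_mul]
    rw [div_le_iff₀ (by positivity)]
    refine hR.trans (le_of_eq ?_)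
    field_simp
  obtain ⟨w, hw⟩ := exists_sq_integral_sub_le Q
    ((memLp_two_iff_integrable_sq (hint S).aestronglyMeasurable).2 (hint fun x => S x ^ 2))
    (hint H) (inv_nonneg.2 hc.le)
  refine ⟨w, le_trans ?_ (hw.trans (sq_sum_satisfies_sub_le hN h0 h1 hη (F w)))⟩
  have hmean : c⁻¹ * (c * p) ^ 2 = p ^ 2 * c := by field_simp
  rw [hS, hmean]
  linarith

end Derandomize

/-! ### Rounded low degree functions -/

section Rounded

variable {N M k : ℕ} {Ω : Type*} [MeasurableSpace Ω]

theorem roundAt_ne_iff (u : Fin N → ℝ) (z z' : EuclideanSpace ℝ (Fin N)) (i : Fin N) :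
    roundAt u z i ≠ roundAt u z' i ↔ ¬ (u i ≤ z i ↔ u i ≤ z' i) := by
  unfold roundAt
  by_cases h : u i ≤ z i <;> by_cases h' : u i ≤ z' i <;> simp [h, h']

theorem measurable_roundAt {z : Ω → EuclideanSpace ℝ (Fin N)} (hz : Measurable z) :
    Measurable fun w : Ω × (Fin N → ℝ) => roundAt w.2 (z w.1) :=
  measurable_pi_iff.2 fun i => Measurable.ite
    (measurableSet_le (by fun_prop)
      ((EuclideanSpace.proj (𝕜 := ℝ) i).continuous.measurable.comp (hz.comp measurable_fst)))
    measurable_const measurable_const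

theorem prod_thresholdLaw_roundAt_ne_le (P : Measure Ω) [IsProbabilityMeasure P]
    {z z' : Ω → EuclideanSpace ℝ (Fin N)} (hz : Measurable z) (hz' : Measurable z') (i : Fin N)
    (hint : Integrable (fun ω => (z ω i - z' ω i) ^ 2) P) {θ : ℝ} (hθ : 0 < θ) :
    (P.prod (thresholdLaw N)).real {w | roundAt w.2 (z w.1) i ≠ roundAt w.2 (z' w.1) i} ≤
      (θ + (∫ ω, (z ω i - z' ω i) ^ 2 ∂P) / θ) / 2 := by
  have hmeas : MeasurableSet
      {w : Ω × (Fin N → ℝ) | roundAt w.2 (z w.1) i ≠ roundAt w.2 (z' w.1) i} :=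
    (measurableSet_eq_fun (measurable_pi_iff.1 (measurable_roundAt hz) i)
      (measurable_pi_iff.1 (measurable_roundAt hz') i)).compl
  have hamgm (t : ℝ) : |t| ≤ (θ + t ^ 2 / θ) / 2 := by
    have hsq : (θ + t ^ 2 / θ) / 2 - |t| = (θ - |t|) ^ 2 / (2 * θ) := by
      rw [← sq_abs t]
      field_simp
      ring
    linarith [show 0 ≤ (θ - |t|) ^ 2 / (2 * θ) by positivity]
  have hint' : Integrable (fun ω => (θ + (z ω i - z' ω i) ^ 2 / θ) / 2) P :=
    ((integrable_const θ).add (hint.div_const θ)).div_const 2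
  have hval : ∫ ω, (θ + (z ω i - z' ω i) ^ 2 / θ) / 2 ∂P =
      (θ + (∫ ω, (z ω i - z' ω i) ^ 2 ∂P) / θ) / 2 := by
    rw [integral_div, integral_add (integrable_const θ) (hint.div_const θ), integral_div]
    simp
  have hnonneg : ∀ ω, 0 ≤ (θ + (z ω i - z' ω i) ^ 2 / θ) / 2 := fun ω => by positivity
  rw [← hval, Measure.real, Measure.prod_apply hmeas]
  refine ENNReal.toReal_le_of_le_ofReal (integral_nonneg hnonneg) ?_
  rw [ofReal_integral_eq_lintegral_ofReal hint' (.of_forall hnonneg)]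
  refine lintegral_mono fun ω => ?_
  simp only [Set.preimage_ofPred_eq, roundAt_ne_iff]
  exact (thresholdLaw_separates_le i _ _).trans (ENNReal.ofReal_le_ofReal (hamgm _))

theorem integral_hammingDist_roundAt_le (P : Measure Ω) [IsProbabilityMeasure P]
    {z z' : Ω → EuclideanSpace ℝ (Fin N)} (hz : Measurable z) (hz' : Measurable z')
    (hsub : MemLp (fun ω => z ω - z' ω) 2 P) {θ : ℝ} (hθ : 0 < θ) :
    ∫ w, (hammingDist (roundAt w.2 (z w.1)) (roundAt w.2 (z' w.1)) : ℝ) ∂(P.prod (thresholdLaw N)) ≤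
      (N * θ + (∫ ω, ‖z ω - z' ω‖ ^ 2 ∂P) / θ) / 2 := by
  have hint (i) : Integrable (fun ω => (z ω i - z' ω i) ^ 2) P := (hsub.eval_piLp i).integrable_sq
  have hnorm : ∑ i, ∫ ω, (z ω i - z' ω i) ^ 2 ∂P = ∫ ω, ‖z ω - z' ω‖ ^ 2 ∂P := by
    simp only [EuclideanSpace.real_norm_sq_eq, PiLp.sub_apply]
    exact (integral_finsetSum _ fun i _ => hint i).symm
  rw [integral_hammingDist _ fun i => (measurableSet_eq_fun
    (measurable_pi_iff.1 (measurable_roundAt hz) i)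
    (measurable_pi_iff.1 (measurable_roundAt hz') i)).compl]
  refine (Finset.sum_le_sum fun i _ =>
    prod_thresholdLaw_roundAt_ne_le P hz hz' i (hint i) hθ).trans_eq ?_
  rw [← hnorm, ← Finset.sum_div, Finset.sum_add_distrib, Finset.sum_const, Finset.card_univ,
    Fintype.card_fin, nsmul_eq_mul, Finset.sum_div]

theorem IsDegree.sum_noise_mul_norm_sq_sub_le {ι Γ : Type*} [Fintype ι] [DecidableEq ι] [Fintype Γ]
    [DecidableEq Γ] [Nonempty Γ] {ρ : ℝ} (h0 : 0 ≤ ρ) (h1 : ρ ≤ 1) {D : ℕ}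
    {F : (ι → Γ) → EuclideanSpace ℝ (Fin N)} (hF : IsDegree D F) :
    ∑ y, ∑ y', noise ι Γ ρ y y' * ‖F y - F y'‖ ^ 2 ≤ 2 * (1 - ρ ^ D) * ∑ y, ‖F y‖ ^ 2 := by
  calc _ = ∑ i, ∑ y, ∑ y', noise ι Γ ρ y y' * (F y i - F y' i) ^ 2 := by
        simp only [EuclideanSpace.real_norm_sq_eq, PiLp.sub_apply, Finset.mul_sum]
        exact (Finset.sum_congr rfl fun y _ => Finset.sum_comm).trans Finset.sum_comm
    _ ≤ ∑ i, 2 * (1 - ρ ^ D) * ∑ y, F y i ^ 2 :=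
        Finset.sum_le_sum fun i _ => sum_noise_mul_sq_sub_le h0 h1 (hF i)
    _ = _ := by
        rw [← Finset.mul_sum, Finset.sum_comm]
        simp only [EuclideanSpace.real_norm_sq_eq]

theorem IsDegree.sum_noise_mul_integral_le {ι Γ : Type*} [Fintype ι] [DecidableEq ι] [Fintype Γ]
    [DecidableEq Γ] [Nonempty Γ] {P : Measure Ω} {ρ : ℝ} (h0 : 0 ≤ ρ) (h1 : ρ ≤ 1) {D : ℕ}
    {F : (ι → Γ) → Ω → EuclideanSpace ℝ (Fin N)} (hF : ∀ ω, IsDegree D fun y => F y ω)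
    (hint : ∀ y, MemLp (F y) 2 P) :
    ∑ y, ∑ y', noise ι Γ ρ y y' * ∫ ω, ‖F y ω - F y' ω‖ ^ 2 ∂P ≤
      2 * (1 - ρ ^ D) * ∑ y, ∫ ω, ‖F y ω‖ ^ 2 ∂P := by
  have hsub (y y') : Integrable (fun ω => noise ι Γ ρ y y' * ‖F y ω - F y' ω‖ ^ 2) P :=
    ((hint y).sub (hint y')).norm.integrable_sq.const_mul _
  have hsq (y) : Integrable (fun ω => ‖F y ω‖ ^ 2) P := (hint y).norm.integrable_sq
  simp_rw [← integral_const_mul (noise ι Γ ρ _ _), ← integral_finsetSum _ fun y' _ => hsub _ y']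
  rw [← integral_finsetSum _ fun y _ => integrable_finsetSum _ fun y' _ => hsub y y',
    ← integral_finsetSum _ fun y _ => hsq y, ← integral_const_mul]
  exact integral_mono
    (integrable_finsetSum _ fun y _ => integrable_finsetSum _ fun y' _ => hsub y y')
    ((integrable_finsetSum _ fun y _ => hsq y).const_mul _)
    fun ω => (hF ω).sum_noise_mul_norm_sq_sub_le h0 h1

theorem IsDegree.sum_noise_mul_integral_hammingDist_le {ι Γ : Type*} [Fintype ι] [DecidableEq ι]
    [Fintype Γ] [DecidableEq Γ] [Nonempty Γ] (P : Measure Ω) [IsProbabilityMeasure P] {ρ : ℝ}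
    (h0 : 0 ≤ ρ) (h1 : ρ ≤ 1) {D : ℕ} {F : (ι → Γ) → Ω → EuclideanSpace ℝ (Fin N)}
    (hF : ∀ ω, IsDegree D fun y => F y ω) (hmeas : ∀ y, Measurable (F y))
    (hint : ∀ y, MemLp (F y) 2 P) {θ : ℝ} (hθ : 0 < θ) :
    ∑ y, ∑ y', noise ι Γ ρ y y' * ∫ w, (hammingDist (roundAt w.2 (F y w.1))
        (roundAt w.2 (F y' w.1)) : ℝ) ∂(P.prod (thresholdLaw N)) ≤
      Fintype.card (ι → Γ) * (N * θ / 2) + (1 - ρ ^ D) * (∑ y, ∫ ω, ‖F y ω‖ ^ 2 ∂P) / θ := by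
  calc _ ≤ ∑ y, ∑ y', noise ι Γ ρ y y' * ((N * θ + (∫ ω, ‖F y ω - F y' ω‖ ^ 2 ∂P) / θ) / 2) :=
        Finset.sum_le_sum fun y _ => Finset.sum_le_sum fun y' _ => mul_le_mul_of_nonneg_left
          (integral_hammingDist_roundAt_le P (hmeas y) (hmeas y') ((hint y).sub (hint y')) hθ)
          (noise_nonneg h0 h1 y y')
    _ = Fintype.card (ι → Γ) * (N * θ / 2) +
        (∑ y, ∑ y', noise ι Γ ρ y y' * ∫ ω, ‖F y ω - F y' ω‖ ^ 2 ∂P) / (2 * θ) := by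
        simp only [add_div, mul_add, Finset.sum_add_distrib, ← Finset.sum_mul, sum_noise,
          Finset.sum_const, Finset.card_univ, nsmul_eq_mul, mul_one, Finset.sum_div,
          mul_div_assoc, div_div, mul_comm θ 2]
    _ ≤ Fintype.card (ι → Γ) * (N * θ / 2) +
        2 * (1 - ρ ^ D) * (∑ y, ∫ ω, ‖F y ω‖ ^ 2 ∂P) / (2 * θ) := by
        gcongr
        exact IsDegree.sum_noise_mul_integral_le h0 h1 hF hint
    _ = _ := by rw [mul_assoc 2, mul_div_mul_left _ _ two_ne_zero]

theorem measurableSet_satisfies_roundAt {A : Instance N M k × Ω → EuclideanSpace ℝ (Fin N)}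
    (hA : Measurable A) :
    MeasurableSet {q : Instance N M k × Ω × (Fin N → ℝ) |
      Satisfies (roundAt q.2.2 (A (q.1, q.2.1))) q.1} := by
  have hunion : {q : Instance N M k × Ω × (Fin N → ℝ) |
      Satisfies (roundAt q.2.2 (A (q.1, q.2.1))) q.1} = ⋃ y : Instance N M k,
      {y} ×ˢ {w : Ω × (Fin N → ℝ) | Satisfies (roundAt w.2 (A (y, w.1))) y} := by
    ext q
    simp
  rw [hunion]
  exact MeasurableSet.iUnion fun y => (measurableSet_singleton y).prod
    (measurable_roundAt (hA.comp measurable_prodMk_left)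
      (Set.toFinite {x | Satisfies x y}).measurableSet)

theorem prob_satisfies_eq (P : Measure Ω) [IsProbabilityMeasure P]
    {A : Instance N M k × Ω → EuclideanSpace ℝ (Fin N)} (hA : Measurable A) :
    (((instanceLaw N M k).prod P).prod (thresholdLaw N))
      {q | Satisfies (roundAt q.2 (A q.1)) q.1.1} =
    (∑ y : ClauseSeq N M k, (P.prod (thresholdLaw N))
      {w | Satisfies (roundAt w.2 (A (Function.uncurry y, w.1))) (Function.uncurry y)}) *
        (Fintype.card (ClauseSeq N M k) : ℝ≥0∞)⁻¹ := by
  have hassoc : {q : (Instance N M k × Ω) × (Fin N → ℝ) | Satisfies (roundAt q.2 (A q.1)) q.1.1} =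
      MeasurableEquiv.prodAssoc ⁻¹' {q : Instance N M k × Ω × (Fin N → ℝ) |
        Satisfies (roundAt q.2.2 (A (q.1, q.2.1))) q.1} := rfl
  have hmeas := measurableSet_satisfies_roundAt hA
  rw [hassoc, ← Measure.map_apply MeasurableEquiv.prodAssoc.measurable hmeas,
    Measure.prodAssoc_prod, Measure.prod_apply hmeas, lintegral_instanceLaw]
  rfl

theorem sum_lintegral_enorm_sq_le (hN : N ≠ 0) (P : Measure Ω) [IsProbabilityMeasure P]
    {A : Instance N M k × Ω → EuclideanSpace ℝ (Fin N)} (hA : Measurable A) {C : ℝ≥0∞}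
    (hC : ∫⁻ p, ‖A p‖ₑ ^ 2 ∂((instanceLaw N M k).prod P) ≤ C) :
    ∑ y : ClauseSeq N M k, ∫⁻ ω, ‖A (Function.uncurry y, ω)‖ₑ ^ 2 ∂P ≤
      C * Fintype.card (ClauseSeq N M k) := by
  have : NeZero N := ⟨hN⟩
  rwa [lintegral_prod _ (hA.enorm.pow_const 2).aemeasurable, lintegral_instanceLaw,
    ← div_eq_mul_inv, ENNReal.div_le_iff (Nat.cast_ne_zero.2 Fintype.card_ne_zero)
      (ENNReal.natCast_ne_top _)] at hC

theorem memLp_two_and_sum_integral_le (hN : N ≠ 0) (P : Measure Ω) [IsProbabilityMeasure P]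
    {A : Instance N M k × Ω → EuclideanSpace ℝ (Fin N)} (hA : Measurable A) {C : ℝ≥0}
    (hC : ∫⁻ p, ‖A p‖ₑ ^ 2 ∂((instanceLaw N M k).prod P) ≤ C) :
    (∀ y : ClauseSeq N M k, MemLp (fun ω => A (Function.uncurry y, ω)) 2 P) ∧
      ∑ y : ClauseSeq N M k, ∫ ω, ‖A (Function.uncurry y, ω)‖ ^ 2 ∂P ≤
        C * Fintype.card (ClauseSeq N M k) := by
  have hsum := sum_lintegral_enorm_sq_le hN P hA hC
  have htop : (C : ℝ≥0∞) * Fintype.card (ClauseSeq N M k) ≠ ∞ :=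
    ENNReal.mul_ne_top ENNReal.coe_ne_top (ENNReal.natCast_ne_top _)
  have hytop (y : ClauseSeq N M k) : ∫⁻ ω, ‖A (Function.uncurry y, ω)‖ₑ ^ 2 ∂P ≠ ∞ :=
    ne_top_of_le_ne_top htop
      ((Finset.single_le_sum (fun _ _ => zero_le) (Finset.mem_univ y)).trans hsum)
  have hmeas (y : ClauseSeq N M k) : Measurable fun ω => A (Function.uncurry y, ω) :=
    hA.comp measurable_prodMk_left
  have hint (y : ClauseSeq N M k) : ∫ ω, ‖A (Function.uncurry y, ω)‖ ^ 2 ∂P =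
      (∫⁻ ω, ‖A (Function.uncurry y, ω)‖ₑ ^ 2 ∂P).toReal := by
    rw [integral_eq_lintegral_of_nonneg_ae (.of_forall fun ω => sq_nonneg _)
      ((hmeas y).norm.pow_const 2).aestronglyMeasurable]
    simp only [ENNReal.ofReal_pow (norm_nonneg _), ofReal_norm]
  refine ⟨fun y => (memLp_two_iff_integrable_sq_norm (hmeas y).aestronglyMeasurable).2
    ⟨((hmeas y).norm.pow_const 2).aestronglyMeasurable, ?_⟩, ?_⟩
  · rw [hasFiniteIntegral_iff_enorm]
    simp only [enorm_pow, enorm_norm]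
    exact (hytop y).lt_top
  · simp_rw [hint, ← ENNReal.toReal_sum fun y _ => hytop y]
    exact (ENNReal.toReal_mono htop hsum).trans_eq (by simp)

theorem exists_stable_rule (hN : N ≠ 0) (P : Measure Ω) [IsProbabilityMeasure P]
    {A : Instance N M k × Ω → EuclideanSpace ℝ (Fin N)} (hA : Measurable A) {D : ℕ}
    (hD : ∀ ω, IsDegree D fun y => A (y, ω)) {C : ℝ≥0}
    (hC : ∫⁻ p, ‖A p‖ₑ ^ 2 ∂((instanceLaw N M k).prod P) ≤ (C : ℝ≥0∞) * (N : ℝ≥0∞))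
    {ρ : ℝ} (h0 : 0 ≤ ρ) (h1 : ρ ≤ 1) {η θ : ℝ} (hη : 0 < η) (hθ : 0 < θ) :
    ∃ f : ClauseSeq N M k → Cube N,
      ((((instanceLaw N M k).prod P).prod (thresholdLaw N)).real
        {q | Satisfies (roundAt q.2 (A q.1)) q.1.1} ^ 2 -
          (θ / 2 + (1 - ρ ^ D) * C / θ) / η) * Fintype.card (ClauseSeq N M k) ≤
        ∑ y, ∑ y', noise (Fin M) (Fin k → Literal N) ρ y y' * stablePair f η y y' := by
  have : NeZero N := ⟨hN⟩
  set p := (((instanceLaw N M k).prod P).prod (thresholdLaw N)).real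
    {q | Satisfies (roundAt q.2 (A q.1)) q.1.1} with hp
  set c : ℝ := (Fintype.card (ClauseSeq N M k) : ℝ)
  have hc0 : c ≠ 0 := Nat.cast_ne_zero.2 Fintype.card_ne_zero
  have hmeas (y : ClauseSeq N M k) : Measurable fun ω => A (Function.uncurry y, ω) :=
    hA.comp measurable_prodMk_left
  obtain ⟨hL2, hsum⟩ := memLp_two_and_sum_integral_le (C := C * N) hN P hA (by simpa using hC)
  have hsat : ∑ y : ClauseSeq N M k, (P.prod (thresholdLaw N)).real
      {w | Satisfies (roundAt w.2 (A (Function.uncurry y, w.1))) (Function.uncurry y)} = c * p := by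
    rw [hp, Measure.real, prob_satisfies_eq P hA, ENNReal.toReal_mul, ENNReal.toReal_inv,
      ENNReal.toReal_natCast, ENNReal.toReal_sum fun y _ => measure_ne_top _ _, mul_left_comm,
      mul_inv_cancel₀ hc0, mul_one]
    rfl
  have hdist : ∑ y, ∑ y', noise (Fin M) (Fin k → Literal N) ρ y y' *
      ∫ w, (hammingDist (roundAt w.2 (A (Function.uncurry y, w.1)))
        (roundAt w.2 (A (Function.uncurry y', w.1))) : ℝ) ∂(P.prod (thresholdLaw N)) ≤
      c * (N * (θ / 2 + (1 - ρ ^ D) * C / θ)) := by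
    calc _ ≤ c * (N * θ / 2) + (1 - ρ ^ D) *
          (∑ y : ClauseSeq N M k, ∫ ω, ‖A (Function.uncurry y, ω)‖ ^ 2 ∂P) / θ :=
          IsDegree.sum_noise_mul_integral_hammingDist_le P h0 h1
            (fun ω i => degreeSpace_curry (hD ω i)) hmeas hL2 hθ
      _ ≤ c * (N * θ / 2) + (1 - ρ ^ D) * ((C * N : ℝ≥0) * c) / θ := by
          gcongr
          exact sub_nonneg.2 (pow_le_one₀ h0 h1)
      _ = c * (N * (θ / 2 + (1 - ρ ^ D) * C / θ)) := by
          push_cast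
          ring
  obtain ⟨w, hw⟩ := exists_stable_realization hN (P.prod (thresholdLaw N)) h0 h1 hη
    (measurable_pi_iff.2 fun y => measurable_roundAt (hmeas y)) hsat hdist
  exact ⟨_, hw⟩

end Rounded

/-! ### Asymptotics in the number of variables -/

theorem eventually_mul_pow_mul_exp_lt_one (c : ℝ) (E : ℕ) {ν : ℝ} (hν : 0 < ν) :
    ∀ᶠ N : ℕ in atTop, c * ((N : ℝ) + 1) ^ E * Real.exp (-(ν * N)) < 1 := by
  have hlim : Tendsto (fun n : ℕ => (n : ℝ) ^ E * Real.exp (-ν) ^ n) atTop (𝓝 0) :=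
    tendsto_pow_const_mul_const_pow_of_lt_one E (Real.exp_nonneg _)
      (Real.exp_lt_one_iff.2 (neg_neg_of_pos hν))
  have hshift := ((tendsto_add_atTop_iff_nat 1).2 hlim).const_mul (c * Real.exp ν)
  rw [mul_zero] at hshift
  filter_upwards [hshift.eventually (gt_mem_nhds one_pos)] with N hN
  have hexp : Real.exp (-(ν * N)) = Real.exp ν * Real.exp (-ν) ^ (N + 1) := by
    rw [← Real.exp_nat_mul, ← Real.exp_add]
    congr 1
    push_cast
    ring
  rw [hexp]
  push_cast at hN
  linarith

theorem eventually_natCast_mul_sub_le {M : ℕ → ℕ} {α c q ν : ℝ}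
    (hM : Tendsto (fun N => (M N : ℝ) / (N : ℝ)) atTop (𝓝 α)) (h : c - α * q < -ν) :
    ∀ᶠ N : ℕ in atTop, N * c - M N * q ≤ -(ν * N) := by
  filter_upwards [((hM.mul_const q).const_sub c).eventually (gt_mem_nhds h),
    eventually_ne_atTop 0] with N hN hN0
  have hmul := mul_le_mul_of_nonneg_right hN.le (Nat.cast_nonneg (α := ℝ) N)
  have heq : (c - (M N : ℝ) / N * q) * N = N * c - M N * q := by field_simp
  linarith

theorem eventually_mul_ceil_le {D : ℕ → ℕ}
    (hD : (fun N => (D N : ℝ)) =o[atTop] fun N => (N : ℝ)) (m : ℕ) {s : ℝ} (hs : 0 ≤ s) (c : ℝ) :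
    ∀ᶠ N : ℕ in atTop, c * (m * ⌈s * (D N + 1)⌉₊ + 1) ≤ N := by
  have hconst (a : ℝ) : (fun _ : ℕ => a) =o[atTop] fun N => (N : ℝ) :=
    isLittleO_const_left.2 (.inr (tendsto_norm_atTop_atTop.comp tendsto_natCast_atTop_atTop))
  have hceil : (fun N => (⌈s * ((D N : ℝ) + 1)⌉₊ : ℝ)) =o[atTop] fun N => (N : ℝ) := by
    refine (IsBigO.of_bound 1 (.of_forall fun N => ?_)).trans_isLittleO
      (((hD.add (hconst 1)).const_mul_left s).add (hconst 1))
    have hnonneg : 0 ≤ s * ((D N : ℝ) + 1) := by positivity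
    rw [one_mul, Real.norm_of_nonneg (Nat.cast_nonneg _), Real.norm_of_nonneg (by positivity)]
    exact (Nat.ceil_lt_add_one hnonneg).le
  filter_upwards [((((hceil.const_mul_left (m : ℝ)).add (hconst 1)).const_mul_left c).bound
    one_pos)] with N hN
  simpa using (le_abs_self _).trans hN

theorem exists_two_pow_between {x : ℕ} (hx : x ≠ 0) : ∃ n, x ≤ 2 ^ n ∧ 2 ^ n ≤ 2 * x := by
  refine ⟨Nat.log 2 x + 1, (Nat.lt_pow_succ_log_self one_lt_two x).le, ?_⟩
  rw [pow_succ, mul_comm]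
  exact Nat.mul_le_mul_left 2 (Nat.pow_log_le_self 2 hx)

section PathBound

variable {N M m : ℕ} {b q u r ν : ℝ}

theorem lowEntropyBound_mul_pow_le (hr0 : 0 ≤ r) (hr : r ≤ 1 - q)
    (h : N * b - M * q ≤ -(ν * N)) :
    lowEntropyBound N m b * r ^ M ≤
      (((N : ℝ) + 1) ^ 2 ^ (m + 1)) ^ (m + 1) * Real.exp (-(ν * N)) := by
  have hrM : r ^ M ≤ Real.exp (-(M * q)) := by
    rw [← mul_neg, Real.exp_nat_mul]
    exact pow_le_pow_left₀ hr0 (hr.trans (Real.one_sub_le_exp_neg q)) M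
  have hone : (1 : ℝ) ≤ ((N : ℝ) + 1) ^ 2 ^ (m + 1) := one_le_pow₀ (by simp)
  calc lowEntropyBound N m b * r ^ M ≤ lowEntropyBound N m b * Real.exp (-(M * q)) :=
        mul_le_mul_of_nonneg_left hrM (lowEntropyBound_nonneg N m b)
    _ = ((N : ℝ) + 1) ^ 2 ^ (m + 1) * Real.exp (N * b - M * q) := by
        rw [lowEntropyBound, mul_assoc, ← Real.exp_add, sub_eq_add_neg]
    _ ≤ _ := by
        gcongr
        exact le_self_pow₀ hone m.succ_ne_zero

theorem two_pow_mul_lowEntropyBound_pow_mul_exp_le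
    (h : N * (Real.log 2 + m * b) - M * u ≤ -(ν * N)) :
    2 ^ N * lowEntropyBound N m b ^ m * Real.exp (-(M * u)) ≤
      (((N : ℝ) + 1) ^ 2 ^ (m + 1)) ^ (m + 1) * Real.exp (-(ν * N)) := by
  have hone : (1 : ℝ) ≤ ((N : ℝ) + 1) ^ 2 ^ (m + 1) := one_le_pow₀ (by simp)
  have htwo : (2 : ℝ) ^ N = Real.exp (N * Real.log 2) := by
    rw [Real.exp_nat_mul, Real.exp_log two_pos]
  calc 2 ^ N * lowEntropyBound N m b ^ m * Real.exp (-(M * u))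
      = (((N : ℝ) + 1) ^ 2 ^ (m + 1)) ^ m * Real.exp (N * (Real.log 2 + m * b) - M * u) := by
        rw [lowEntropyBound, htwo, mul_pow, ← Real.exp_nat_mul,
          show N * (Real.log 2 + m * b) - M * u =
            N * Real.log 2 + (m * (N * b) + (-(M * u))) by ring, Real.exp_add, Real.exp_add]
        ring
    _ ≤ _ := by
        gcongr
        exact m.le_succ

theorem stable_path_bound_le {T : ℕ} (hTN : T ≤ N) (hr0 : 0 ≤ r) (hr : r ≤ 1 - q)
    (hq : N * b - M * q ≤ -(ν * N)) (hu : N * (Real.log 2 + m * b) - M * u ≤ -(ν * N)) :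
    ((T : ℝ) + 1) ^ (m + 1) * (m * (lowEntropyBound N m b * r ^ M) +
      2 ^ N * lowEntropyBound N m b ^ m * Real.exp (-(M * u))) ≤
      (m + 1) * ((N : ℝ) + 1) ^ ((2 ^ (m + 1) + 1) * (m + 1)) * Real.exp (-(ν * N)) := by
  have hTN' : (T : ℝ) ≤ N := by exact_mod_cast hTN
  have hpair := add_le_add
    (mul_le_mul_of_nonneg_left (lowEntropyBound_mul_pow_le (m := m) hr0 hr hq) m.cast_nonneg)
    (two_pow_mul_lowEntropyBound_pow_mul_exp_le hu)
  calc _ ≤ ((N : ℝ) + 1) ^ (m + 1) *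
        (m * ((((N : ℝ) + 1) ^ 2 ^ (m + 1)) ^ (m + 1) * Real.exp (-(ν * N))) +
          (((N : ℝ) + 1) ^ 2 ^ (m + 1)) ^ (m + 1) * Real.exp (-(ν * N))) := by
        refine mul_le_mul (by gcongr) hpair ?_ (by positivity)
        have := lowEntropyBound_nonneg N m b
        positivity
    _ = _ := by
        rw [pow_mul, pow_succ _ (2 ^ (m + 1)), mul_pow]
        ring

end PathBound

section NoiseLevel

variable {ε : ℝ} (D : ℕ)

theorem one_sub_div_nonneg (h1 : ε ≤ 1) : 0 ≤ 1 - ε / (D + 1) :=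
  sub_nonneg.2 (div_le_one_of_le₀ (h1.trans (by simp)) (by positivity))

theorem one_sub_div_le_one (h0 : 0 ≤ ε) : 1 - ε / (D + 1) ≤ 1 :=
  sub_le_self _ (by positivity)

theorem one_sub_one_sub_div_pow_le (h0 : 0 ≤ ε) (h1 : ε ≤ 1) :
    1 - (1 - ε / (D + 1)) ^ D ≤ ε := by
  have hbernoulli := one_add_mul_le_pow (a := -(ε / (D + 1)))
    (by linarith [one_sub_div_nonneg D h1]) D
  have hfrac : (D : ℝ) * (ε / (D + 1)) ≤ ε := by
    rw [mul_div_left_comm]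
    exact mul_le_of_le_one_right h0 (div_le_one_of_le₀ (by simp) (by positivity))
  rw [← sub_eq_add_neg] at hbernoulli
  linarith

theorem one_sub_div_pow_ceil_le (h0 : 0 < ε) (h1 : ε ≤ 1) (s : ℝ) :
    (1 - ε / (D + 1)) ^ ⌈s / ε * (D + 1)⌉₊ ≤ Real.exp (-s) := by
  refine (pow_le_pow_left₀ (one_sub_div_nonneg D h1) (Real.one_sub_le_exp_neg _) _).trans ?_
  rw [← Real.exp_nat_mul, Real.exp_le_exp, mul_neg, neg_le_neg_iff]
  calc s = s / ε * (D + 1) * (ε / (D + 1)) := by field_simp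
    _ ≤ _ := by
      gcongr
      exact Nat.le_ceil _

end NoiseLevel

section FixedSize

variable {N M k m D T : ℕ} {Ω : Type*} [MeasurableSpace Ω] {C : ℝ≥0}
  {ρ l L b' b η δ γ ν q : ℝ}

theorem exists_stable_rule_of_le_prob (hN : N ≠ 0) (P : Measure Ω) [IsProbabilityMeasure P]
    {A : Instance N M k × Ω → EuclideanSpace ℝ (Fin N)} (hA : Measurable A)
    (hD : ∀ ω, IsDegree D fun y => A (y, ω))
    (hC : ∫⁻ p, ‖A p‖ₑ ^ 2 ∂((instanceLaw N M k).prod P) ≤ (C : ℝ≥0∞) * (N : ℝ≥0∞))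
    (h0 : 0 ≤ ρ) (h1 : ρ ≤ 1) (hη : 0 < η) (hδ : 0 < δ)
    (hρ : (1 - ρ ^ D) * C ≤ (δ ^ 2 * η) ^ 2 / 8)
    (hp : δ ≤ (((instanceLaw N M k).prod P).prod (thresholdLaw N)).real
      {q | Satisfies (roundAt q.2 (A q.1)) q.1.1}) :
    ∃ f : ClauseSeq N M k → Cube N, δ ^ 2 / 2 * Fintype.card (ClauseSeq N M k) ≤
      ∑ y, ∑ y', noise (Fin M) (Fin k → Literal N) ρ y y' * stablePair f η y y' := by
  obtain ⟨f, hf⟩ := exists_stable_rule hN P hA hD hC h0 h1 hη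
    (show 0 < δ ^ 2 * η / 2 by positivity)
  refine ⟨f, (mul_le_mul_of_nonneg_right ?_ (Nat.cast_nonneg _)).trans hf⟩
  have hmove : (1 - ρ ^ D) * C / (δ ^ 2 * η / 2) ≤ δ ^ 2 * η / 4 := by
    rw [div_le_iff₀ (by positivity)]
    linarith
  have hloss : (δ ^ 2 * η / 2 / 2 + (1 - ρ ^ D) * C / (δ ^ 2 * η / 2)) / η ≤ δ ^ 2 / 2 := by
    rw [div_le_iff₀ hη]
    linarith
  linarith [pow_le_pow_left₀ hδ.le hp 2]

theorem pow_two_pow_le_of_stable (hN : N ≠ 0) (hk : k ≠ 0) (h0 : 0 ≤ ρ) (h1 : ρ ≤ 1)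
    {f : ClauseSeq N M k → Cube N} (hγ : 0 ≤ γ)
    (hf : γ * Fintype.card (ClauseSeq N M k) ≤
      ∑ y, ∑ y', noise (Fin M) (Fin k → Literal N) ρ y y' * stablePair f η y y')
    (hl : 0 ≤ l) (hL : 1 ≤ L) (hb : 0 ≤ b)
    (hη : ∀ (p : Fin N → Fin (m + 1) → ℤˣ) (x x' : Cube N), (hammingDist x x' : ℝ) ≤ η * N →
      condEntropy p x' - condEntropy p x ≤ b - b')
    {n : ℕ} (hT : m * T ≤ 2 ^ n) (hnN : 2 ^ n ≤ N) (hq : q ≤ (1 - ρ ^ T) * (1 / 2) ^ k)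
    (hMq : N * b - M * q ≤ -(ν * N))
    (hMu : N * (Real.log 2 + m * b) - M * decayRate k m l L b' ≤ -(ν * N)) :
    γ ^ 2 ^ n ≤
      (m + 1) * ((N : ℝ) + 1) ^ ((2 ^ (m + 1) + 1) * (m + 1)) * Real.exp (-(ν * N)) := by
  have hr : 0 ≤ 1 - (1 - ρ ^ T) * (1 / 2) ^ k :=
    sub_nonneg.2 (mul_le_one₀ (sub_le_self _ (pow_nonneg h0 T)) (by positivity)
      (pow_le_one₀ (by norm_num) (by norm_num)))
  calc γ ^ 2 ^ n ≤ _ := pow_le_instExp_prod hN ρ (isSymm_stablePair f η) hγ hf n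
    _ ≤ _ := instExp_prod_stablePair_le hN hk h0 h1 f hl hL hb hT (pow_pos two_pos n).ne' hη
    _ ≤ _ := stable_path_bound_le hnN hr (sub_le_sub_left hq 1) hMq hMu

theorem prob_satisfies_le (hN : N ≠ 0) (hk : k ≠ 0) (P : Measure Ω) [IsProbabilityMeasure P]
    {A : Instance N M k × Ω → EuclideanSpace ℝ (Fin N)} (hA : Measurable A)
    (hD : ∀ ω, IsDegree D fun y => A (y, ω))
    (hC : ∫⁻ p, ‖A p‖ₑ ^ 2 ∂((instanceLaw N M k).prod P) ≤ (C : ℝ≥0∞) * (N : ℝ≥0∞))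
    (h0 : 0 ≤ ρ) (h1 : ρ ≤ 1) (hl : 0 ≤ l) (hL : 1 ≤ L) (hb : 0 ≤ b) (hη0 : 0 < η)
    (hη : ∀ (p : Fin N → Fin (m + 1) → ℤˣ) (x x' : Cube N), (hammingDist x x' : ℝ) ≤ η * N →
      condEntropy p x' - condEntropy p x ≤ b - b')
    (hδ0 : 0 < δ) (hδ1 : δ ≤ 1) (hρ : (1 - ρ ^ D) * C ≤ (δ ^ 2 * η) ^ 2 / 8)
    (hq : q ≤ (1 - ρ ^ T) * (1 / 2) ^ k) (hTN : 2 * (m * T + 1) ≤ N)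
    (hTν : 2 * (m * T + 1) * -Real.log (δ ^ 2 / 2) ≤ ν * N)
    (hMq : N * b - M * q ≤ -(2 * ν * N))
    (hMu : N * (Real.log 2 + m * b) - M * decayRate k m l L b' ≤ -(2 * ν * N))
    (hpoly : ((m : ℝ) + 1) * ((N : ℝ) + 1) ^ ((2 ^ (m + 1) + 1) * (m + 1)) *
      Real.exp (-(ν * N)) < 1) :
    (((instanceLaw N M k).prod P).prod (thresholdLaw N))
      {q | Satisfies (roundAt q.2 (A q.1)) q.1.1} ≤ ENNReal.ofReal δ := by
  by_contra! hlarge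
  obtain ⟨f, hf⟩ := exists_stable_rule_of_le_prob hN P hA hD hC h0 h1 hη0 hδ0 hρ
    ((ENNReal.ofReal_lt_iff_lt_toReal hδ0.le (measure_ne_top _ _)).1 hlarge).le
  obtain ⟨n, hTn, hn⟩ := exists_two_pow_between (m * T).succ_ne_zero
  have hγ : 0 < δ ^ 2 / 2 := by positivity
  have hlower : Real.exp (-(ν * N)) ≤ (δ ^ 2 / 2) ^ 2 ^ n := by
    have hn' : (2 : ℝ) ^ n ≤ 2 * (m * T + 1) := by exact_mod_cast hn
    have hlog : Real.log (δ ^ 2 / 2) ≤ 0 :=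
      Real.log_nonpos hγ.le (by linarith [pow_le_one₀ hδ0.le hδ1 (n := 2)])
    rw [← Real.exp_log (pow_pos hγ _), Real.exp_le_exp, Real.log_pow]
    push_cast
    linarith [mul_le_mul_of_nonneg_right hn' (neg_nonneg.2 hlog)]
  have hupper := pow_two_pow_le_of_stable hN hk h0 h1 hγ.le hf hl hL hb hη
    ((m * T).le_succ.trans hTn) (hn.trans hTN) hq hMq hMu
  have hsplit : Real.exp (-(2 * ν * N)) = Real.exp (-(ν * N)) * Real.exp (-(ν * N)) := by
    rw [← Real.exp_add]
    congr 1
    ring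
  rw [hsplit, ← mul_assoc] at hupper
  linarith [mul_lt_of_lt_one_left (Real.exp_pos (-(ν * N))) hpoly]

end FixedSize

theorem exists_lt_mul_one_sub_exp_neg {b c : ℝ} (h : b < c) :
    ∃ s, 0 ≤ s ∧ b < c * (1 - Real.exp (-s)) := by
  have hlim : Tendsto (fun s : ℝ => c * (1 - Real.exp (-s))) atTop (𝓝 (c * (1 - 0))) :=
    (Real.tendsto_exp_neg_atTop_nhds_zero.const_sub 1).const_mul c
  rw [sub_zero, mul_one] at hlim
  exact ((eventually_ge_atTop 0).and (hlim.eventually (lt_mem_nhds h))).exists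

theorem exists_pos_le_one_mul_le {C c : ℝ} (hC : 0 ≤ C) (hc : 0 < c) :
    ∃ ε : ℝ, 0 < ε ∧ ε ≤ 1 ∧ ε * C ≤ c := by
  refine ⟨min 1 (c / (C + 1)), by positivity, min_le_left _ _, ?_⟩
  calc min 1 (c / (C + 1)) * C ≤ c / (C + 1) * (C + 1) := by
        gcongr
        · exact min_le_right _ _
        · simp
    _ = c := by field_simp

theorem eventually_prob_satisfies_le {k m : ℕ} (hk : k ≠ 0) {M : ℕ → ℕ} {α l L b' b δ : ℝ}
    (hM : Tendsto (fun N => (M N : ℝ) / (N : ℝ)) atTop (𝓝 α)) (hl : 0 ≤ l) (hL : 1 ≤ L)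
    (hbb : b' < b) (hb : 0 ≤ b) (hbα : b < α * (1 / 2) ^ k)
    (hgap : Real.log 2 + m * b < α * decayRate k m l L b') {Ω : ℕ → Type*}
    [∀ N, MeasurableSpace (Ω N)] (P : ∀ N, Measure (Ω N)) [∀ N, IsProbabilityMeasure (P N)]
    {D : ℕ → ℕ} {C : ℝ≥0} {A : ∀ N, Instance N (M N) k × Ω N → EuclideanSpace ℝ (Fin N)}
    (hD : (fun N => (D N : ℝ)) =o[atTop] fun N => (N : ℝ)) (hA : ∀ N, Measurable (A N))
    (hdeg : ∀ N (ω : Ω N), IsDegree (D N) fun y => A N (y, ω))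
    (hC : ∀ N, ∫⁻ p, ‖A N p‖ₑ ^ 2 ∂((instanceLaw N (M N) k).prod (P N)) ≤
      (C : ℝ≥0∞) * (N : ℝ≥0∞))
    (hδ0 : 0 < δ) (hδ1 : δ ≤ 1) :
    ∀ᶠ N in atTop, (((instanceLaw N (M N) k).prod (P N)).prod (thresholdLaw N))
      {q | Satisfies (roundAt q.2 (A N q.1)) q.1.1} ≤ ENNReal.ofReal δ := by
  obtain ⟨η, hη0, hη⟩ := exists_condEntropy_sub_le (Fin (m + 1) → ℤˣ) (sub_pos.2 hbb)
  obtain ⟨s, hs, hbs⟩ := exists_lt_mul_one_sub_exp_neg hbα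
  obtain ⟨ε, hε0, hε1, hεC⟩ := exists_pos_le_one_mul_le C.coe_nonneg
    (show 0 < (δ ^ 2 * η) ^ 2 / 8 by positivity)
  set q : ℝ := (1 - Real.exp (-s)) * (1 / 2) ^ k
  have hbq : b < α * q := by linarith
  obtain ⟨ν, hν0, hν⟩ := exists_between (half_pos (lt_min (sub_pos.2 hbq) (sub_pos.2 hgap)))
  obtain ⟨hνq, hνu⟩ := lt_min_iff.1 ((lt_div_iff₀' two_pos).1 hν)
  have hMq := eventually_natCast_mul_sub_le hM (lt_neg.2 (hνq.trans_eq (neg_sub b _).symm))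
  have hMu := eventually_natCast_mul_sub_le hM (lt_neg.2 (hνu.trans_eq (neg_sub _ _).symm))
  have hceil := eventually_mul_ceil_le hD m (div_nonneg hs hε0.le)
  filter_upwards [hMq, hMu, hceil 2, hceil (2 * -Real.log (δ ^ 2 / 2) / ν),
    eventually_mul_pow_mul_exp_lt_one (m + 1) ((2 ^ (m + 1) + 1) * (m + 1)) hν0,
    eventually_ne_atTop 0] with N hMq hMu hTN hTν hpoly hN
  refine prob_satisfies_le (T := ⌈s / ε * ((D N : ℝ) + 1)⌉₊) hN hk (P N) (hA N) (hdeg N) (hC N)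
    (one_sub_div_nonneg (D N) hε1) (one_sub_div_le_one (D N) hε0.le) hl hL hb hη0 (hη N) hδ0 hδ1
    ((mul_le_mul_of_nonneg_right (one_sub_one_sub_div_pow_le (D N) hε0.le hε1) C.2).trans hεC)
    ?_ (by exact_mod_cast hTN) ?_ hMq hMu hpoly
  · exact mul_le_mul_of_nonneg_right
      (sub_le_sub_left (one_sub_div_pow_ceil_le (D N) hε0 hε1 s) 1) (by positivity)
  · rw [div_mul_eq_mul_div, div_le_iff₀ hν0] at hTν
    linarith

end RandomKSat

end

theorem corollary3p15 (κ : ℝ) (hκ : RandomKSat.kappaStar < κ) :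
    ∃ k₀ : ℕ, ∀ k : ℕ, k₀ ≤ k →
      ∀ M : ℕ → ℕ,
        Tendsto (fun N => (M N : ℝ) / (N : ℝ)) atTop
          (𝓝 (κ * 2 ^ k * Real.log (k : ℝ) / (k : ℝ))) →
      ∀ (Ω : ℕ → Type*) [∀ N, MeasurableSpace (Ω N)]
        (P : ∀ N, Measure (Ω N)) [∀ N, IsProbabilityMeasure (P N)]
        (D : ℕ → ℕ) (C : ℝ≥0)
        (A : ∀ N, RandomKSat.Instance N (M N) k × Ω N → EuclideanSpace ℝ (Fin N)),
        (fun N => (D N : ℝ)) =o[atTop] (fun N => (N : ℝ)) →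
        (∀ N, Measurable (A N)) →
        (∀ N (ω : Ω N), RandomKSat.IsDegree (D N) fun y => A N (y, ω)) →
        (∀ N, ∫⁻ p, ‖A N p‖ₑ ^ 2 ∂((RandomKSat.instanceLaw N (M N) k).prod (P N))
          ≤ (C : ℝ≥0∞) * (N : ℝ≥0∞)) →
        Tendsto
          (fun N =>
            (((RandomKSat.instanceLaw N (M N) k).prod (P N)).prod (RandomKSat.thresholdLaw N))
              {q | RandomKSat.Satisfies (RandomKSat.roundAt q.2 (A N q.1)) q.1.1})
          atTop (𝓝 0) := by
  obtain ⟨k₀, hk₀⟩ := RandomKSat.exists_parameters hκ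
  refine ⟨k₀, fun k hk M hM Ω _ P _ D C A hD hA hdeg hC => ?_⟩
  obtain ⟨m, l, L, b', b, hk0, hl, hL, hbb, hb, hbα, hgap⟩ := hk₀ k hk
  rw [ENNReal.tendsto_nhds_zero]
  intro ε hε
  obtain ⟨δ, hδ0, hδ⟩ := ENNReal.lt_iff_exists_nnreal_btwn.1 (lt_min hε one_pos)
  obtain ⟨hδε, hδ1⟩ := lt_min_iff.1 hδ
  filter_upwards [RandomKSat.eventually_prob_satisfies_le hk0 hM hl hL hbb hb hbα hgap P hD hA
    hdeg hC (δ := δ) (by exact_mod_cast hδ0) (by exact_mod_cast hδ1.le)] with N hN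
  rw [ENNReal.ofReal_coe_nnreal] at hN
  exact hN.trans hδε.le
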